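/- Let $\mathcal G$ be a connected metric graph with finitely many edges (multiple edges and self-loops allowed), each bounded edge $e$ being identified with an interval $[0,\ell_e]$, $\ell_e>0$, and each unbounded edge (half-line) with $[0,\infty)$, its endpoint $0$ being a vertex. Assume that $\mathcal G$ has at least one half-line and at least one bounded edge, and let $\mathcal K$ be its compact core, i.e. the subgraph of all bounded edges. Let $H^1(\mathcal G)$ be the space of continuous functions $u:\mathcal G\to\mathbb R$ whose restriction to every edge $e$ belongs to $H^1(e)$, and put $$C_{\mathcal K}:=\sup_{0\neq u\in H^1(\mathcal G)}\frac{\|u\|_{L^6(\mathcal K)}^6}{\|u\|_{L^2(\mathcal G)}^4\,\|u'\|_{L^2(\mathcal G)}^2}.$$ For $I=\mathbb R$ and $I=\mathbb R^+=[0,\infty)$ let $$C_I:=\sup_{0\neq u\in H^1(I)}\frac{\|u\|_{L^6(I)}^6}{\|u\|_{L^2(I)}^4\,\|u'\|_{L^2(I)}^2}.$$ A terminal edge is an edge that ends in a vertex of degree $1$. The graph $\mathcal G$ admits a cycle covering if every edge (bounded or not) belongs to a cycle, where a cycle is either a closed path of consecutive, pairwise distinct bounded edges, or an unbounded path formed by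 two distinct half-lines and a (possibly empty) path of pairwise distinct bounded edges joining their endpoints. Then: (i) if $\mathcal G$ has at least one terminal edge, then $C_{\mathcal K}=C_{\mathbb R^+}$; (ii) if $\mathcal G$ has no terminal edge, then $C_{\mathcal K}<C_{\mathbb R^+}$; if, in addition, $\mathcal G$ admits a cycle covering, then $C_{\mathcal K}=C_{\mathbb R}$; (iii) if $\mathcal G$ has exactly one half-line and no terminal edge, then $C_{\mathcal K}>1$. -/

import Mathlib

open MeasureTheory Set
open scoped ENNReal ContDiff

/-! ### Sobolev functions on an interval -/

/-- `g` is the weak derivative of `u` on the interior of `I`, tested against smooth functions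
with compact support in the interior of `I`. -/
def HasWeakDerivOn (I : Set ℝ) (u g : ℝ → ℝ) : Prop :=
  ∀ φ : ℝ → ℝ, ContDiff ℝ ∞ φ → HasCompactSupport φ → tsupport φ ⊆ interior I →
    ∫ x in I, u x * deriv φ x = -∫ x in I, g x * φ x

/-- `u`, restricted to the interval `I`, is (the continuous representative of) an element of
`H¹(I)`, and `g` is its weak derivative. Values outside `I` are irrelevant. -/
structure IsH1On (I : Set ℝ) (u g : ℝ → ℝ) : Prop where
  continuousOn : ContinuousOn u I
  memLp : MemLp u 2 (volume.restrict I)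
  memLp_deriv : MemLp g 2 (volume.restrict I)
  hasWeakDeriv : HasWeakDerivOn I u g

/-- The Gagliardo–Nirenberg quotient `‖u‖₆⁶ / (‖u‖₂⁴ ‖g‖₂²)` on `I`, with `g` in the role of
`u'`. For `u = 0` it has the harmless value `0 / 0 = 0`. -/
noncomputable def gnQuotient (I : Set ℝ) (u g : ℝ → ℝ) : ℝ≥0∞ :=
  (∫⁻ x in I, ‖u x‖ₑ ^ 6) / ((∫⁻ x in I, ‖u x‖ₑ ^ 2) ^ 2 * ∫⁻ x in I, ‖g x‖ₑ ^ 2)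

/-- The best constant `C` of `‖u‖₆⁶ ≤ C ‖u‖₂⁴ ‖u'‖₂²` on `H¹(I)`. -/
noncomputable def gnConst (I : Set ℝ) : ℝ≥0∞ :=
  ⨆ (u : ℝ → ℝ) (g : ℝ → ℝ) (_ : IsH1On I u g), gnQuotient I u g

/-- The constant of the real line. -/
noncomputable def gnConstLine : ℝ≥0∞ := gnConst univ

/-- The constant of the half-line `[0, ∞)`. -/
noncomputable def gnConstHalfLine : ℝ≥0∞ := gnConst (Ici 0)

/-! ### Metric graphs -/

/-- A metric graph with vertices `V`, bounded edges `E` and half-lines `H` (multiple edges and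
self-loops are allowed). The bounded edge `e` is the interval `[0, length e]` with `0` glued to
the vertex `src e` and `length e` to the vertex `tgt e`; the half-line `h` is `[0, ∞)` with `0`
glued to the vertex `origin h`. -/
structure MetricGraph (V E H : Type*) where
  src : E → V
  tgt : E → V
  length : E → ℝ
  length_pos : ∀ e, 0 < length e
  origin : H → V

namespace MetricGraph

variable {V E H : Type*}

/-- The bounded edge `e` has endpoints `v` and `w`. -/
def Joins (G : MetricGraph V E H) (e : E) (v w : V) : Prop :=
  (G.src e = v ∧ G.tgt e = w) ∨ (G.src e = w ∧ G.tgt e = v)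

/-- Any two vertices are linked by a chain of bounded edges (a half-line has only one vertex and
does not link vertices). -/
def Connected (G : MetricGraph V E H) : Prop :=
  ∀ v w : V, Relation.ReflTransGen (fun a b => ∃ e, G.Joins e a b) v w

/-- `G` is connected, it is noncompact, i.e. it has a half-line, and its compact core, i.e. the
subgraph of the bounded edges, is non-empty. (Finiteness of the edge sets is expressed by
`Fintype` instances.) -/
structure Admissible (G : MetricGraph V E H) : Prop where
  connected : G.Connected
  noncompact : Nonempty H
  core_nonempty : Nonempty E

/-- The degree of a vertex: the number of ends of edges glued to it; a self-loop counts twice. -/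
noncomputable def degree (G : MetricGraph V E H) (v : V) : ℕ :=
  {e | G.src e = v}.ncard + {e | G.tgt e = v}.ncard + {h | G.origin h = v}.ncard

/-- The edge (bounded edge or half-line) is incident at the vertex `v`. -/
def Incident (G : MetricGraph V E H) : E ⊕ H → V → Prop
  | Sum.inl e, v => G.src e = v ∨ G.tgt e = v
  | Sum.inr h, v => G.origin h = v

/-- A terminal edge is an edge that ends in a vertex of degree one. -/
def IsTerminalEdge (G : MetricGraph V E H) (e : E ⊕ H) : Prop :=
  ∃ v, G.Incident e v ∧ G.degree v = 1

def HasTerminalEdge (G : MetricGraph V E H) : Prop :=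
  ∃ e, G.IsTerminalEdge e

/-- The list of bounded edges is a path of consecutive edges from `v` to `w`. -/
def IsPath (G : MetricGraph V E H) : V → List E → V → Prop
  | v, [], w => v = w
  | v, e :: es, w => ∃ x, G.Joins e v x ∧ G.IsPath x es w

/-- The edge sets of cycles. A cycle is either a closed path of consecutive, pairwise distinct
bounded edges, or an unbounded path formed by two distinct half-lines and a path of pairwise
distinct bounded edges (possibly none) between their origins. -/
inductive IsCycle (G : MetricGraph V E H) : Set (E ⊕ H) → Prop
  | loop (v : V) (es : List E) (hne : es ≠ []) (hnd : es.Nodup) (hp : G.IsPath v es v) :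
      IsCycle G (Sum.inl '' {e | e ∈ es})
  | unbounded (h₁ h₂ : H) (hh : h₁ ≠ h₂) (es : List E) (hnd : es.Nodup)
      (hp : G.IsPath (G.origin h₁) es (G.origin h₂)) :
      IsCycle G (Sum.inl '' {e | e ∈ es} ∪ {Sum.inr h₁, Sum.inr h₂})

/-- Every edge, bounded or not, belongs to a cycle. -/
def HasCycleCovering (G : MetricGraph V E H) : Prop :=
  ∀ e : E ⊕ H, ∃ S, G.IsCycle S ∧ e ∈ S

/-- An element `u` of `H¹(G)` together with its derivative: an `H¹` function on each bounded edge
and each half-line, such that the values at edge ends glued to the same vertex `v` coincide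
(their common value is `atVertex v`), i.e. `u` is continuous on `G`. -/
structure H1 (G : MetricGraph V E H) where
  onEdge : E → ℝ → ℝ
  onEdgeDeriv : E → ℝ → ℝ
  onHalf : H → ℝ → ℝ
  onHalfDeriv : H → ℝ → ℝ
  isH1On_edge : ∀ e, IsH1On (Icc 0 (G.length e)) (onEdge e) (onEdgeDeriv e)
  isH1On_half : ∀ h, IsH1On (Ici 0) (onHalf h) (onHalfDeriv h)
  atVertex : V → ℝ
  edge_src : ∀ e, onEdge e 0 = atVertex (G.src e)
  edge_tgt : ∀ e, onEdge e (G.length e) = atVertex (G.tgt e)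
  half_origin : ∀ h, onHalf h 0 = atVertex (G.origin h)

variable [Fintype E] [Fintype H]

/-- `‖u‖₆⁶` over the compact core. -/
noncomputable def coreSix (G : MetricGraph V E H) (u : G.H1) : ℝ≥0∞ :=
  ∑ e, ∫⁻ x in Icc 0 (G.length e), ‖u.onEdge e x‖ₑ ^ 6

/-- `‖u‖₂²` over the whole graph. -/
noncomputable def mass (G : MetricGraph V E H) (u : G.H1) : ℝ≥0∞ :=
  (∑ e, ∫⁻ x in Icc 0 (G.length e), ‖u.onEdge e x‖ₑ ^ 2)
    + ∑ h, ∫⁻ x in Ici (0 : ℝ), ‖u.onHalf h x‖ₑ ^ 2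

/-- `‖u'‖₂²` over the whole graph. -/
noncomputable def kinetic (G : MetricGraph V E H) (u : G.H1) : ℝ≥0∞ :=
  (∑ e, ∫⁻ x in Icc 0 (G.length e), ‖u.onEdgeDeriv e x‖ₑ ^ 2)
    + ∑ h, ∫⁻ x in Ici (0 : ℝ), ‖u.onHalfDeriv h x‖ₑ ^ 2

/-- The quotient `Q(u)`: the sixth power of the `L⁶` norm over the core, divided by
`‖u‖₂⁴ ‖u'‖₂²` over the whole graph. For `u = 0` it has the harmless value `0 / 0 = 0`. -/
noncomputable def quotient (G : MetricGraph V E H) (u : G.H1) : ℝ≥0∞ :=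
  G.coreSix u / (G.mass u ^ 2 * G.kinetic u)

/-- The optimal constant of the graph with the nonlinearity localized on the compact core. -/
noncomputable def coreConst (G : MetricGraph V E H) : ℝ≥0∞ :=
  ⨆ u : G.H1, G.quotient u

end MetricGraph

/-! The constants are explicit: 16/π² on the half-line and 4/π² on the line, both reached by the
profile (cosh x)^(-1/2). Every upper bound comes from a calibration: a function whose increments are
bounded by a combination of the kinetic, mass and L⁶ integrals, the slack in the derivative being a
square.

Mass calibration. If m is the mass met so far, the derivative of k cot(k m) u⁴ is 4u'² - k²u⁶ minus
a square. Coming from infinity along a half-line of mass M, with k = π/(2M), the final cotangent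
vanishes and the half-line inequality results. On the line, k is chosen so that the angles of the
two halves add up to π, and the two cotangents cancel (`halfLine_mass_calibration`,
`line_gagliardoNirenberg`).

General graphs. Let B be the maximum of u² on the core, and run the mass calibration along a path
from infinity to a maximum point. Let R be the mass off the path. With k = π/(2M) the final boundary
term is k tan(kR) B². Its linear part k²RB² pays exactly for the L⁶ norm off the path, which is at
most B²R; this gives the half-line constant. The cubic part of tan is a gain
(`H1.exists_totalSix_add_le`). Without terminal edges one can leave the maximum point along a
segment off the path, so R is at least a fixed fraction of M whenever the quotient exceeds 1, and
the gain becomes a strict inequality with a uniform constant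
(`exists_totalSix_le_of_not_hasTerminalEdge`).

Cycle coverings. Here the calibration is s Φ(u²), with Φ the area under a circle of radius B. Cycles
cross a cut an even number of times, so every superlevel set is left by at least two edges
(`two_le_cut`); integrated over the levels, the total variation of Φ(u²) is at least 2Φ(B) = πB²/2.
With s = π/(2M) this is the inequality with the constant of the line
(`H1.totalSix_le_of_hasCycleCovering`).

Lower bounds. Truncated and rescaled profiles are placed inside one edge (4/π²), or as half a
profile peaked at a vertex of degree one (16/π²). With a single half-line, the function equal to 1
on the core and to an optimal exponential outside has quotient 1, and a small bump on the core
raises it (`one_lt_coreConst`). -/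

/-! ### Absolutely continuous functions -/

/-- Post-composition with a Lipschitz function preserves absolute continuity. -/
theorem AbsolutelyContinuousOnInterval.lipschitzOnWith_comp {f F : ℝ → ℝ} {a b : ℝ} {s : Set ℝ}
    {L : NNReal} (hF : LipschitzOnWith L F s) (hf : AbsolutelyContinuousOnInterval f a b)
    (hmaps : MapsTo f (uIcc a b) s) :
    AbsolutelyContinuousOnInterval (fun x => F (f x)) a b := by
  rw [absolutelyContinuousOnInterval_iff] at hf ⊢
  intro ε hε
  obtain ⟨δ, hδ, h⟩ := hf (ε / (L + 1)) (by positivity)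
  refine ⟨δ, hδ, fun I hI hlen => ?_⟩
  have hmem := hI.1
  calc ∑ i ∈ Finset.range I.1, dist (F (f (I.2 i).1)) (F (f (I.2 i).2))
      ≤ ∑ i ∈ Finset.range I.1, L * dist (f (I.2 i).1) (f (I.2 i).2) := by
        refine Finset.sum_le_sum fun i hi => ?_
        exact hF.dist_le_mul _ (hmaps (hmem i hi).1) _ (hmaps (hmem i hi).2)
    _ = L * ∑ i ∈ Finset.range I.1, dist (f (I.2 i).1) (f (I.2 i).2) := by rw [Finset.mul_sum]
    _ ≤ L * (ε / (L + 1)) := by gcongr; exact (h I hI hlen).le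
    _ < (L + 1) * (ε / (L + 1)) := by gcongr; linarith
    _ = ε := by field

/-- If the derivative of an absolutely continuous function is bounded above by an integrable
function, its increment is bounded by the integral. -/
theorem AbsolutelyContinuousOnInterval.sub_le_integral {f f' r : ℝ → ℝ} {a b : ℝ} (hab : a ≤ b)
    (hf : AbsolutelyContinuousOnInterval f a b)
    (hderiv : ∀ᵐ x, x ∈ Ioo a b → HasDerivAt f (f' x) x)
    (hr : IntervalIntegrable r volume a b) (hle : ∀ x ∈ Ioo a b, f' x ≤ r x) :
    f b - f a ≤ ∫ x in a..b, r x := by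
  rw [← hf.integral_deriv_eq_sub]
  refine intervalIntegral.integral_mono_ae_restrict hab hf.intervalIntegrable_deriv hr ?_
  rw [← restrict_Ioo_eq_restrict_Icc]
  refine (ae_restrict_iff' measurableSet_Ioo).2 ?_
  filter_upwards [hderiv] with x hx hxI
  rw [(hx hxI).deriv]
  exact hle x hxI

/-! ### Sobolev functions as primitives -/

/-- On `[a, b]` the function `u` is a primitive of the square integrable function `g`. -/
structure SobolevOn (u g : ℝ → ℝ) (a b : ℝ) : Prop where
  le : a ≤ b
  memLp : MemLp g 2 (volume.restrict (Icc a b))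
  ftc : ∀ x ∈ Icc a b, u x = u a + ∫ t in a..x, g t

namespace SobolevOn

variable {u g : ℝ → ℝ} {a b : ℝ}

theorem intervalIntegrable (h : SobolevOn u g a b) : IntervalIntegrable g volume a b := by
  rw [intervalIntegrable_iff_integrableOn_Icc_of_le h.le]
  exact h.memLp.integrable (by norm_num)

theorem intervalIntegrable_sq (h : SobolevOn u g a b) :
    IntervalIntegrable (fun x => g x ^ 2) volume a b := by
  rw [intervalIntegrable_iff_integrableOn_Icc_of_le h.le]
  exact h.memLp.integrable_sq

theorem absolutelyContinuous (h : SobolevOn u g a b) : AbsolutelyContinuousOnInterval u a b := by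
  have h1 := h.intervalIntegrable.absolutelyContinuousOnInterval_intervalIntegral
    (c := a) left_mem_uIcc
  have hlip : LipschitzOnWith 1 (fun y : ℝ => u a + y) univ := by
    refine LipschitzOnWith.of_dist_le_mul fun x _ y _ => by simp
  have h2 := AbsolutelyContinuousOnInterval.lipschitzOnWith_comp hlip h1 (mapsTo_univ _ _)
  -- `u` agrees with `u a + ∫ g` only on `[a, b]`, so the property is transferred through its ε–δ
  -- form, whose points all lie there.
  rw [absolutelyContinuousOnInterval_iff] at h2 ⊢
  intro ε hε
  obtain ⟨δ, hδ, hh⟩ := h2 ε hε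
  refine ⟨δ, hδ, fun I hI hlen => ?_⟩
  have := hh I hI hlen
  refine lt_of_eq_of_lt (Finset.sum_congr rfl fun i hi => ?_) this
  have hmem := hI.1 i hi
  rw [uIcc_of_le h.le] at hmem
  rw [h.ftc _ hmem.1, h.ftc _ hmem.2]

theorem continuousOn (h : SobolevOn u g a b) : ContinuousOn u (Icc a b) := by
  have := h.absolutelyContinuous.continuousOn
  rwa [uIcc_of_le h.le] at this

theorem continuousOn_uIcc (h : SobolevOn u g a b) : ContinuousOn u (uIcc a b) :=
  h.absolutelyContinuous.continuousOn

theorem ae_hasDerivAt (h : SobolevOn u g a b) :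
    ∀ᵐ x, x ∈ Ioo a b → HasDerivAt u (g x) x := by
  filter_upwards [h.intervalIntegrable.ae_hasDerivAt_integral] with x hx hxI
  have hx' : x ∈ uIcc a b := by rw [uIcc_of_le h.le]; exact Ioo_subset_Icc_self hxI
  have h1 := (hx hx' a left_mem_uIcc).const_add (u a)
  refine h1.congr_of_eventuallyEq ?_
  filter_upwards [Ioo_mem_nhds hxI.1 hxI.2] with y hy
  exact h.ftc y (Ioo_subset_Icc_self hy)

theorem mono (h : SobolevOn u g a b) {c d : ℝ} (hac : a ≤ c) (hcd : c ≤ d) (hdb : d ≤ b) :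
    SobolevOn u g c d := by
  refine ⟨hcd, h.memLp.mono_measure (Measure.restrict_mono (Icc_subset_Icc hac hdb) le_rfl), ?_⟩
  intro x hx
  have hi : ∀ y ∈ Icc a b, IntervalIntegrable g volume a y := fun y hy =>
    h.intervalIntegrable.mono_set (by
      rw [uIcc_of_le hy.1, uIcc_of_le h.le]; exact Icc_subset_Icc le_rfl hy.2)
  have hc : c ∈ Icc a b := ⟨hac, hcd.trans hdb⟩
  have hx' : x ∈ Icc a b := ⟨hac.trans hx.1, hx.2.trans hdb⟩
  rw [h.ftc x hx', h.ftc c hc, add_assoc,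
    intervalIntegral.integral_add_adjacent_intervals (hi c hc) ((hi c hc).symm.trans (hi x hx'))]

theorem reflect (h : SobolevOn u g a b) (c : ℝ) :
    SobolevOn (fun x => u (c - x)) (fun x => -g (c - x)) (c - b) (c - a) := by
  refine ⟨by linarith [h.le], ?_, ?_⟩
  · have hmp : MeasurePreserving (fun x : ℝ => c - x) (volume.restrict (Icc (c - b) (c - a)))
        (volume.restrict (Icc a b)) := by
      have := (Measure.measurePreserving_sub_left (volume : Measure ℝ) c).restrict_preimage
        (s := Icc a b) measurableSet_Icc
      simpa [Set.preimage_const_sub_Icc] using this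
    exact (h.memLp.comp_measurePreserving hmp).neg
  · intro x hx
    have hx' : c - x ∈ Icc a b := ⟨by linarith [hx.2], by linarith [hx.1]⟩
    have h1 := h.mono hx'.1 hx'.2 le_rfl
    have h2 := h1.ftc b ⟨hx'.2, le_rfl⟩
    simp only [intervalIntegral.integral_neg, sub_sub_cancel,
      intervalIntegral.integral_comp_sub_left (fun t => g t) c]
    linarith

end SobolevOn

/-! ### From weak derivatives to primitives and back -/

theorem exists_Icc_subset_of_isCompact {K : Set ℝ} {a b : ℝ} (hab : a < b) (hK : IsCompact K)
    (hKab : K ⊆ Ioo a b) : ∃ p q, a < p ∧ p ≤ q ∧ q < b ∧ K ⊆ Icc p q := by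
  rcases K.eq_empty_or_nonempty with rfl | hne
  · exact ⟨(a + b) / 2, (a + b) / 2, by linarith, le_rfl, by linarith, empty_subset _⟩
  · obtain ⟨p, hp⟩ := hK.exists_isLeast hne
    obtain ⟨q, hq⟩ := hK.exists_isGreatest hne
    exact ⟨p, q, (hKab hp.1).1, hp.2 hq.1, (hKab hq.1).2, fun x hx => ⟨hp.2 hx, hq.2 hx⟩⟩

/-- A smooth function with compact support in `(a, b)` and integral zero is the derivative of a
smooth function with compact support in `(a, b)`. -/
theorem exists_primitive_of_integral_eq_zero {ψ : ℝ → ℝ} {a b : ℝ} (hab : a < b)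
    (hψ : ContDiff ℝ ∞ ψ) (hc : HasCompactSupport ψ) (hs : tsupport ψ ⊆ Ioo a b)
    (h0 : ∫ x in a..b, ψ x = 0) :
    ∃ φ : ℝ → ℝ, ContDiff ℝ ∞ φ ∧ HasCompactSupport φ ∧ tsupport φ ⊆ Ioo a b ∧ deriv φ = ψ := by
  obtain ⟨p, q, hap, hpq, hqb, hK⟩ := exists_Icc_subset_of_isCompact hab hc hs
  have hzero : ∀ x, x ∉ Icc p q → ψ x = 0 := fun x hx =>
    image_eq_zero_of_notMem_tsupport fun h => hx (hK h)
  have hint : ∀ x y, IntervalIntegrable ψ volume x y :=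
    fun x y => hψ.continuous.intervalIntegrable x y
  have hd : ∀ x, HasDerivAt (fun x => ∫ t in a..x, ψ t) (ψ x) x := fun x =>
    (hψ.continuous.integral_hasStrictDerivAt a x).hasDerivAt
  have hderiv : deriv (fun x => ∫ t in a..x, ψ t) = ψ := funext fun x => (hd x).deriv
  have hsupp : Function.support (fun x => ∫ t in a..x, ψ t) ⊆ Icc p q := by
    intro x hx
    by_contra hxK
    apply hx
    rcases lt_or_ge x p with hxp | hxp
    · refine (intervalIntegral.integral_congr (g := fun _ => 0) fun t ht => ?_).trans (by simp)
      refine hzero t fun h => ?_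
      have : t ≤ max a x := ht.2
      have := h.1
      grind
    · have hxq : q < x := by
        by_contra hcon
        exact hxK ⟨hxp, not_lt.1 hcon⟩
      have h1 : ∫ t in x..b, ψ t = 0 := by
        refine (intervalIntegral.integral_congr (g := fun _ => 0) fun t ht => ?_).trans (by simp)
        refine hzero t fun h => ?_
        have : min x b ≤ t := ht.1
        have := h.2
        grind
      have := intervalIntegral.integral_add_adjacent_intervals (hint a x) (hint x b)
      simp only
      linarith
  have hts : tsupport (fun x => ∫ t in a..x, ψ t) ⊆ Icc p q :=
    closure_minimal hsupp isClosed_Icc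
  refine ⟨fun x => ∫ t in a..x, ψ t, ?_, ?_, ?_, hderiv⟩
  · rw [contDiff_infty_iff_deriv, hderiv]
    exact ⟨fun x => (hd x).differentiableAt, hψ⟩
  · exact HasCompactSupport.of_support_subset_isCompact isCompact_Icc hsupp
  · exact hts.trans fun x hx => ⟨hap.trans_le hx.1, hx.2.trans_lt hqb⟩

theorem intervalIntegral_eq_integral_of_tsupport {φ v : ℝ → ℝ} {a b : ℝ} (hab : a ≤ b)
    (hs : tsupport φ ⊆ Ioo a b) {I : Set ℝ} (hI : MeasurableSet I) (hsub : Ioc a b ⊆ I) :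
    ∫ x in I, v x * φ x = ∫ x in a..b, v x * φ x := by
  rw [intervalIntegral.integral_of_le hab]
  refine setIntegral_eq_of_subset_of_forall_sdiff_eq_zero hI hsub fun x hx => ?_
  rw [image_eq_zero_of_notMem_tsupport fun h => hx.2 (Ioo_subset_Ioc_self (hs h)), mul_zero]

/-- The lemma of du Bois-Reymond. -/
theorem eqOn_const_of_integral_mul_deriv_eq_zero {v : ℝ → ℝ} {a b : ℝ} (hab : a < b)
    (hv : ContinuousOn v (Icc a b))
    (h : ∀ φ : ℝ → ℝ, ContDiff ℝ ∞ φ → HasCompactSupport φ → tsupport φ ⊆ Ioo a b →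
      ∫ x in a..b, v x * deriv φ x = 0) :
    ∀ x ∈ Icc a b, v x = v a := by
  -- A bump of integral one inside `(a, b)`: subtracting a multiple of it turns any test function
  -- into a derivative of a test function. The constant value of `v` is then `κ = ∫ v η`.
  let η : ContDiffBump ((a + b) / 2) := ⟨(b - a) / 8, (b - a) / 4, by linarith, by linarith⟩
  have hηs : tsupport (η.normed volume) ⊆ Ioo a b := by
    rw [η.tsupport_normed_eq, Real.closedBall_eq_Icc]
    intro x hx
    have h1 : η.rOut = (b - a) / 4 := rfl
    rw [h1] at hx
    exact ⟨by linarith [hx.1], by linarith [hx.2]⟩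
  have hηc : ContDiff ℝ ∞ (η.normed volume) := η.contDiff_normed
  have hη1 : ∫ x in a..b, η.normed volume x = 1 := by
    have := intervalIntegral_eq_integral_of_tsupport (v := fun _ => 1) hab.le hηs
      MeasurableSet.univ (subset_univ _)
    simp only [one_mul, Measure.restrict_univ, η.integral_normed] at this
    exact this.symm
  have hvi : ∀ {ψ : ℝ → ℝ}, Continuous ψ → IntervalIntegrable (fun x => v x * ψ x) volume a b := by
    intro ψ hψ
    apply ContinuousOn.intervalIntegrable
    rw [uIcc_of_le hab.le]
    exact hv.mul hψ.continuousOn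
  set κ := ∫ x in a..b, v x * η.normed volume x with hκ
  have key : ∀ᵐ x ∂(volume : Measure ℝ), x ∈ Ioo a b → v x - κ = 0 := by
    refine isOpen_Ioo.ae_eq_zero_of_integral_contDiff_smul_eq_zero (f := fun x => v x - κ) ?_ ?_
    · exact ((hv.mono Ioo_subset_Icc_self).sub continuousOn_const).locallyIntegrableOn
        measurableSet_Ioo
    · intro ψ hψ hψc hψs
      have hψi : Continuous ψ := hψ.continuous
      set c := ∫ x in a..b, ψ x with hc
      have hsub : tsupport (fun x => ψ x - c * η.normed volume x) ⊆ Ioo a b := by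
        refine (tsupport_sub _ _).trans (union_subset hψs ?_)
        exact (tsupport_mul_subset_right (f := fun _ => c)).trans hηs
      obtain ⟨φ, hφ, hφc, hφs, hφd⟩ := exists_primitive_of_integral_eq_zero hab
        (ψ := fun x => ψ x - c * η.normed volume x) (hψ.sub (contDiff_const.mul hηc))
        (hψc.sub (η.hasCompactSupport_normed.mul_left (f := fun _ => c))) hsub (by
          rw [intervalIntegral.integral_sub (hψi.intervalIntegrable _ _)
            ((hηc.continuous.intervalIntegrable _ _).const_mul c),
            intervalIntegral.integral_const_mul, hη1]
          ring)
      have h0 := h φ hφ hφc hφs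
      rw [hφd] at h0
      have e1 : ∫ x in a..b, v x * (ψ x - c * η.normed volume x)
          = (∫ x in a..b, v x * ψ x) - c * κ := by
        rw [hκ, ← intervalIntegral.integral_const_mul,
          ← intervalIntegral.integral_sub (hvi hψi) ((hvi hηc.continuous).const_mul c)]
        exact intervalIntegral.integral_congr fun x _ => by ring
      have e2 : ∫ x, ψ x • (v x - κ) = ∫ x in a..b, (v x - κ) * ψ x := by
        rw [← intervalIntegral_eq_integral_of_tsupport hab.le hψs MeasurableSet.univ
          (subset_univ _), Measure.restrict_univ]
        simp [mul_comm]
      have e3 : ∫ x in a..b, (v x - κ) * ψ x = (∫ x in a..b, v x * ψ x) - κ * c := by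
        rw [hc, ← intervalIntegral.integral_const_mul,
          ← intervalIntegral.integral_sub (hvi hψi) ((hψi.intervalIntegrable _ _).const_mul κ)]
        exact intervalIntegral.integral_congr fun x _ => by ring
      rw [e2, e3]
      linarith
  have hEq : EqOn v (fun _ => κ) (Ioo a b) := by
    refine Measure.eqOn_open_of_ae_eq (μ := volume) ?_ isOpen_Ioo (hv.mono Ioo_subset_Icc_self)
      continuousOn_const
    refine (ae_restrict_iff' measurableSet_Ioo).2 ?_
    filter_upwards [key] with x hx hxI
    exact sub_eq_zero.1 (hx hxI)
  have hEq' : EqOn v (fun _ => κ) (Icc a b) := by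
    refine hEq.of_subset_closure hv continuousOn_const Ioo_subset_Icc_self ?_
    rw [closure_Ioo hab.ne]
  intro x hx
  rw [hEq' hx, hEq' ⟨le_rfl, hab.le⟩]

/-- Integration by parts for absolutely continuous functions shows that `u - ∫ g` has weak
derivative zero; the lemma of du Bois-Reymond makes it constant. From here on the calibrations can
use the fundamental theorem of calculus. -/
theorem IsH1On.sobolevOn {I : Set ℝ} {u g : ℝ → ℝ} (h : IsH1On I u g) (hI : MeasurableSet I)
    {a b : ℝ} (hab : a ≤ b) (hsub : Icc a b ⊆ I) : SobolevOn u g a b := by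
  have hg : MemLp g 2 (volume.restrict (Icc a b)) :=
    h.memLp_deriv.mono_measure (Measure.restrict_mono hsub le_rfl)
  rcases hab.eq_or_lt with rfl | hlt
  · exact ⟨le_rfl, hg, fun x hx => by
      have : x = a := le_antisymm hx.2 hx.1
      simp [this]⟩
  have hgi : IntervalIntegrable g volume a b := by
    rw [intervalIntegrable_iff_integrableOn_Icc_of_le hab]
    exact hg.integrable (by norm_num)
  have hac := hgi.absolutelyContinuousOnInterval_intervalIntegral (c := a) left_mem_uIcc
  have hGc : ContinuousOn (fun x => ∫ t in a..x, g t) (Icc a b) := by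
    have := hac.continuousOn
    rwa [uIcc_of_le hab] at this
  have huc : ContinuousOn u (Icc a b) := h.continuousOn.mono hsub
  refine ⟨hab, hg, fun x hx => ?_⟩
  have key := eqOn_const_of_integral_mul_deriv_eq_zero (v := fun x => u x - ∫ t in a..x, g t) hlt
    (huc.sub hGc) ?_ x hx
  · simp only [intervalIntegral.integral_same, sub_zero] at key
    linarith
  intro φ hφ hφc hφs
  have hsupp' : tsupport (deriv φ) ⊆ Ioo a b :=
    (closure_minimal (support_deriv_subset) (isClosed_tsupport φ)).trans hφs
  have h1 := h.hasWeakDeriv φ hφ hφc (hφs.trans (interior_maximal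
    (Ioo_subset_Icc_self.trans hsub) isOpen_Ioo))
  rw [intervalIntegral_eq_integral_of_tsupport hab hsupp' hI (Ioc_subset_Icc_self.trans hsub),
    intervalIntegral_eq_integral_of_tsupport hab hφs hI (Ioc_subset_Icc_self.trans hsub)] at h1
  have hφ1 : ContDiff ℝ 1 φ := hφ.of_le (by exact_mod_cast le_top)
  have hφa : φ a = 0 := image_eq_zero_of_notMem_tsupport fun hh => lt_irrefl _ (hφs hh).1
  have hφb : φ b = 0 := image_eq_zero_of_notMem_tsupport fun hh => lt_irrefl _ (hφs hh).2
  have h2 := hac.integral_mul_deriv_eq_deriv_mul (g := φ)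
    hφ1.contDiffOn.absolutelyContinuousOnInterval
  rw [hφa, hφb] at h2
  have h3 : ∫ x in a..b, deriv (fun x => ∫ t in a..x, g t) x * φ x = ∫ x in a..b, g x * φ x := by
    refine intervalIntegral.integral_congr_ae ?_
    filter_upwards [hgi.ae_hasDerivAt_integral] with x hx hxI
    rw [(hx (uIoc_subset_uIcc hxI) a left_mem_uIcc).deriv]
  have hdc : Continuous (deriv φ) := hφ1.continuous_deriv le_rfl
  have h4 : ∫ x in a..b, (u x - ∫ t in a..x, g t) * deriv φ x
      = (∫ x in a..b, u x * deriv φ x) - ∫ x in a..b, (∫ t in a..x, g t) * deriv φ x := by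
    rw [← intervalIntegral.integral_sub]
    · exact intervalIntegral.integral_congr fun x _ => by ring
    · apply ContinuousOn.intervalIntegrable
      rw [uIcc_of_le hab]
      exact huc.mul hdc.continuousOn
    · apply ContinuousOn.intervalIntegrable
      rw [uIcc_of_le hab]
      exact hGc.mul hdc.continuousOn
  rw [h4, h1, h2, h3]
  ring

/-- A `C¹` function with square integrable values and derivative is an `H¹` function. -/
theorem isH1On_of_hasDerivAt {I : Set ℝ} {u g : ℝ → ℝ}
    (hd : ∀ x, HasDerivAt u (g x) x) (hg : Continuous g)
    (hu2 : IntegrableOn (fun x => u x ^ 2) I) (hg2 : IntegrableOn (fun x => g x ^ 2) I) :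
    IsH1On I u g := by
  have huc : Continuous u := continuous_iff_continuousAt.2 fun x => (hd x).continuousAt
  refine ⟨huc.continuousOn, (memLp_two_iff_integrable_sq huc.aestronglyMeasurable).2 hu2,
    (memLp_two_iff_integrable_sq hg.aestronglyMeasurable).2 hg2, ?_⟩
  intro φ hφ hφc hφs
  have hφ1 : ContDiff ℝ 1 φ := hφ.of_le (by exact_mod_cast le_top)
  have hdc : Continuous (deriv φ) := hφ1.continuous_deriv le_rfl
  have hzero : ∀ x, x ∉ I → φ x = 0 := fun x hx =>
    image_eq_zero_of_notMem_tsupport fun h => hx (interior_subset (hφs h))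
  have hzero' : ∀ x, x ∉ I → deriv φ x = 0 := fun x hx => by
    by_contra hne
    exact hx (interior_subset (hφs (support_deriv_subset hne)))
  rw [setIntegral_eq_integral_of_forall_compl_eq_zero fun x hx => by rw [hzero' x hx, mul_zero],
    setIntegral_eq_integral_of_forall_compl_eq_zero fun x hx => by rw [hzero x hx, mul_zero]]
  refine integral_mul_deriv_eq_deriv_mul_of_integrable (fun x _ => hd x)
    (fun x _ => (hφ1.differentiable (by norm_num) x).hasDerivAt) ?_ ?_ ?_
  · exact (huc.mul hdc).integrable_of_hasCompactSupport hφc.deriv.mul_left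
  · exact (hg.mul hφ1.continuous).integrable_of_hasCompactSupport hφc.mul_left
  · exact (huc.mul hφ1.continuous).integrable_of_hasCompactSupport hφc.mul_left

/-! ### Calibration by the mass -/

namespace SobolevOn

variable {u g : ℝ → ℝ} {a b : ℝ}

theorem intervalIntegrable_pow (h : SobolevOn u g a b) (n : ℕ) :
    IntervalIntegrable (fun x => u x ^ n) volume a b :=
  (h.continuousOn_uIcc.pow n).intervalIntegrable

/-- With `m` the mass accumulated along `[a, b]`, starting from `c`, the function
`k cot (k m) u⁴` has a derivative which differs from `4 u'² - k² u⁶` by a square. -/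
theorem mass_calibration (h : SobolevOn u g a b) {c k : ℝ}
    (hsin : ∀ y ∈ Icc c (c + ∫ x in a..b, u x ^ 2), Real.sin (k * y) ≠ 0) :
    k * Real.cot (k * (c + ∫ x in a..b, u x ^ 2)) * u b ^ 4 - k * Real.cot (k * c) * u a ^ 4
      ≤ 4 * (∫ x in a..b, g x ^ 2) - k ^ 2 * ∫ x in a..b, u x ^ 6 := by
  set p := c + ∫ x in a..b, u x ^ 2 with hp
  have hi2 := h.intervalIntegrable_pow 2
  have hi2' : ∀ x ∈ Icc a b, IntervalIntegrable (fun x => u x ^ 2) volume a x ∧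
      IntervalIntegrable (fun x => u x ^ 2) volume x b := by
    intro x hx
    exact ⟨(h.mono le_rfl hx.1 hx.2).intervalIntegrable_pow 2,
      (h.mono hx.1 hx.2 le_rfl).intervalIntegrable_pow 2⟩
  have hmem : ∀ x ∈ Icc a b, c + ∫ t in a..x, u t ^ 2 ∈ Icc c p := by
    intro x hx
    have h1 : 0 ≤ ∫ t in a..x, u t ^ 2 :=
      intervalIntegral.integral_nonneg hx.1 fun t _ => sq_nonneg _
    have h2 : 0 ≤ ∫ t in x..b, u t ^ 2 :=
      intervalIntegral.integral_nonneg hx.2 fun t _ => sq_nonneg _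
    have h3 := intervalIntegral.integral_add_adjacent_intervals (hi2' x hx).1 (hi2' x hx).2
    exact ⟨by linarith, by rw [hp]; linarith⟩
  have hacm : AbsolutelyContinuousOnInterval (fun x => ∫ t in a..x, u t ^ 2) a b :=
    hi2.absolutelyContinuousOnInterval_intervalIntegral left_mem_uIcc
  set F : ℝ → ℝ := fun y => k * Real.cos (k * (c + y)) / Real.sin (k * (c + y)) with hF
  have hFd : ∀ y, Real.sin (k * (c + y)) ≠ 0 →
      HasDerivAt F (-k ^ 2 - k ^ 2 * (Real.cos (k * (c + y)) / Real.sin (k * (c + y))) ^ 2) y := by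
    intro y hy
    have h1 : HasDerivAt (fun y => k * (c + y)) k y := by
      simpa using ((hasDerivAt_id y).const_add c).const_mul k
    have h2 := (h1.cos.const_mul k).div h1.sin hy
    refine h2.congr_deriv ?_
    field_simp
  -- The sine has no zero on the compact range of the mass, so `F` is Lipschitz there and its
  -- composition with the mass stays absolutely continuous.
  have hFc : ContDiffOn ℝ 1 F (Icc 0 (p - c)) := by
    refine ContDiffOn.div (by fun_prop) (by fun_prop) fun y hy => ?_
    exact hsin _ ⟨by linarith [hy.1], by linarith [hy.2]⟩
  obtain ⟨L, hL⟩ := hFc.exists_lipschitzOnWith (by norm_num) (convex_Icc _ _) isCompact_Icc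
  have hacF : AbsolutelyContinuousOnInterval (fun x => F (∫ t in a..x, u t ^ 2)) a b := by
    refine AbsolutelyContinuousOnInterval.lipschitzOnWith_comp hL hacm fun x hx => ?_
    rw [uIcc_of_le h.le] at hx
    have := hmem x hx
    exact ⟨by linarith [this.1], by linarith [this.2]⟩
  have hacu := h.absolutelyContinuous
  have hacu4 := (hacu.fun_mul hacu).fun_mul (hacu.fun_mul hacu)
  have hac := hacF.fun_mul hacu4
  have hr : IntervalIntegrable (fun x => 4 * g x ^ 2 - k ^ 2 * u x ^ 6) volume a b :=
    (h.intervalIntegrable_sq.const_mul 4).sub ((h.intervalIntegrable_pow 6).const_mul _)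
  have key := hac.sub_le_integral h.le
    (f' := fun x => (-k ^ 2 - k ^ 2 * (Real.cos (k * (c + ∫ t in a..x, u t ^ 2))
      / Real.sin (k * (c + ∫ t in a..x, u t ^ 2))) ^ 2) * u x ^ 2 * u x ^ 4
      + F (∫ t in a..x, u t ^ 2) * (4 * u x ^ 3 * g x)) ?_ hr ?_
  · rw [intervalIntegral.integral_sub (h.intervalIntegrable_sq.const_mul 4)
      ((h.intervalIntegrable_pow 6).const_mul _), intervalIntegral.integral_const_mul,
      intervalIntegral.integral_const_mul] at key
    refine le_trans (le_of_eq ?_) key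
    simp only [hF, Real.cot_eq_cos_div_sin, intervalIntegral.integral_same, add_zero, ← hp]
    ring
  · filter_upwards [h.ae_hasDerivAt] with x hx hxI
    have hxI' := Ioo_subset_Icc_self hxI
    have hu := hx hxI
    have hm : HasDerivAt (fun x => ∫ t in a..x, u t ^ 2) (u x ^ 2) x := by
      have hca : ContinuousOn (fun t => u t ^ 2) (Icc a b) := h.continuousOn.pow 2
      refine intervalIntegral.integral_hasDerivAt_right (hi2' x hxI').1 ?_
        (hca.continuousAt (Icc_mem_nhds hxI.1 hxI.2))
      exact ContinuousOn.stronglyMeasurableAtFilter isOpen_Ioo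
        (hca.mono Ioo_subset_Icc_self) x hxI
    have h1 := ((hFd _ (hsin _ (hmem x hxI'))).comp x hm).mul
      ((hu.mul hu).mul (hu.mul hu))
    refine h1.congr_deriv ?_
    simp only [Pi.mul_apply, Function.comp_apply]
    ring
  · intro x _
    simp only [hF]
    -- This square is exactly the slack between the derivative and `4 u'² - k² u⁶`.
    have := sq_nonneg (2 * g x - k * (Real.cos (k * (c + ∫ t in a..x, u t ^ 2))
      / Real.sin (k * (c + ∫ t in a..x, u t ^ 2))) * u x ^ 3)
    rw [mul_div_assoc]
    nlinarith [this]

end SobolevOn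

/-! ### Gagliardo–Nirenberg inequalities on the half-line and on the line -/

theorem Real.cot_le_cot_of_le {x y : ℝ} (hx : 0 < x) (hxy : x ≤ y) (hy : y < Real.pi) :
    Real.cot y ≤ Real.cot x := by
  have h1 := Real.sin_pos_of_pos_of_lt_pi hx (hxy.trans_lt hy)
  have h2 := Real.sin_pos_of_pos_of_lt_pi (hx.trans_le hxy) hy
  have h3 := Real.sin_nonneg_of_nonneg_of_le_pi (sub_nonneg.2 hxy) (by linarith)
  rw [Real.sin_sub] at h3
  rw [Real.cot_eq_cos_div_sin, Real.cot_eq_cos_div_sin, div_le_div_iff₀ h2 h1]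
  linarith

/-- An integrable function cannot stay above `δ` on a set of infinite measure. This supplies
far-away points at which boundary terms are negligible. -/
theorem exists_sq_lt_of_integrableOn_Ici {u : ℝ → ℝ}
    (hu : IntegrableOn (fun x => u x ^ 2) (Ici 0)) {δ : ℝ} (hδ : 0 < δ) {X : ℝ} (hX : 0 ≤ X) :
    ∃ Y, X ≤ Y ∧ u Y ^ 2 < δ := by
  by_contra! hcon
  have h1 := hu.measure_ge_lt_top hδ
  have h2 : (volume.restrict (Ici (0 : ℝ))) (Ici X) ≤
      (volume.restrict (Ici (0 : ℝ))) {x | δ ≤ u x ^ 2} := measure_mono fun x hx => hcon x hx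
  rw [Measure.restrict_apply measurableSet_Ici,
    inter_eq_left.2 (Ici_subset_Ici.2 hX), Real.volume_Ici] at h2
  exact absurd (h2.trans_lt h1) (by simp)

theorem intervalIntegral_le_setIntegral_Ici {f : ℝ → ℝ} (hf : IntegrableOn f (Ici 0))
    (h0 : ∀ x, 0 ≤ f x) {Y : ℝ} (hY : 0 ≤ Y) : ∫ x in 0..Y, f x ≤ ∫ x in Ici 0, f x := by
  rw [intervalIntegral.integral_of_le hY]
  exact setIntegral_mono_set hf (Filter.Eventually.of_forall h0)
    (Filter.Eventually.of_forall fun x (hx : x ∈ Ioc 0 Y) => mem_Ici.2 hx.1.le)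

/-- The calibration along a half-line, coming from infinity with initial mass `ε`. -/
theorem halfLine_mass_calibration {u g : ℝ → ℝ} (h : ∀ X, 0 ≤ X → SobolevOn u g 0 X)
    (hu2 : IntegrableOn (fun x => u x ^ 2) (Ici 0)) (hg2 : IntegrableOn (fun x => g x ^ 2) (Ici 0))
    {ε k : ℝ} (hε : 0 < ε) (hk : 0 < k) (hkε : k * (ε + ∫ x in Ici 0, u x ^ 2) < Real.pi)
    {X : ℝ} (hX : 0 ≤ X) :
    k * Real.cot (k * (ε + ∫ x in Ici 0, u x ^ 2)) * u 0 ^ 4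
      ≤ 4 * (∫ x in Ici 0, g x ^ 2) - k ^ 2 * ∫ x in 0..X, u x ^ 6 := by
  set M := ∫ x in Ici 0, u x ^ 2 with hM
  have hM0 : 0 ≤ M := setIntegral_nonneg measurableSet_Ici fun x _ => sq_nonneg _
  have hkε' : k * ε < Real.pi := lt_of_le_of_lt (by gcongr; linarith) hkε
  refine le_of_forall_pos_le_add fun η hη => ?_
  -- `C` bounds `k cot (k c)` for the starting mass `c` of every cut-off `Y`, because `c ≥ ε`. The
  -- boundary term at `Y` is then at most `C u(Y)⁴`, and `u(Y)² < min 1 (η / C)` makes it at most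
  -- `η`.
  set C := k * |Real.cot (k * ε)| + 1 with hC
  have hCpos : 0 < C := by positivity
  have hδ : 0 < min 1 (η / C) := lt_min one_pos (by positivity)
  obtain ⟨Y, hXY, hY⟩ := exists_sq_lt_of_integrableOn_Ici hu2 hδ hX
  have hY0 : 0 ≤ Y := hX.trans hXY
  have hs := h Y hY0
  have hr := hs.reflect Y
  rw [sub_self, sub_zero] at hr
  have hmass : ∫ x in 0..Y, u (Y - x) ^ 2 = ∫ x in 0..Y, u x ^ 2 := by
    simp [intervalIntegral.integral_comp_sub_left (fun x => u x ^ 2) Y]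
  have hle := intervalIntegral_le_setIntegral_Ici hu2 (fun x => sq_nonneg _) hY0
  have h0 : 0 ≤ ∫ x in 0..Y, u x ^ 2 :=
    intervalIntegral.integral_nonneg hY0 fun x _ => sq_nonneg _
  -- The mass beyond `Y` is counted in advance, so that the calibration run inward from `Y` ends at
  -- `0` with the mass `ε + M`.
  set c := ε + (M - ∫ x in 0..Y, u x ^ 2) with hc
  have hcε : ε ≤ c := by rw [hc]; linarith
  have hcal := hr.mass_calibration (c := c) (k := k) (by
    intro y hy
    rw [hmass, hc] at hy
    refine (Real.sin_pos_of_pos_of_lt_pi (mul_pos hk (by linarith [hy.1])) ?_).ne'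
    refine lt_of_le_of_lt ?_ hkε
    gcongr
    linarith [hy.2])
  have e1 : ∫ x in 0..Y, (-g (Y - x)) ^ 2 = ∫ x in 0..Y, g x ^ 2 := by
    simp [intervalIntegral.integral_comp_sub_left (fun x => g x ^ 2) Y]
  have e2 : ∫ x in 0..Y, u (Y - x) ^ 6 = ∫ x in 0..Y, u x ^ 6 := by
    simp [intervalIntegral.integral_comp_sub_left (fun x => u x ^ 6) Y]
  have e3 : c + ∫ x in 0..Y, u x ^ 2 = ε + M := by rw [hc]; ring
  rw [hmass, e1, e2, e3, sub_self, sub_zero] at hcal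
  have hgle := intervalIntegral_le_setIntegral_Ici hg2 (fun x => sq_nonneg _) hY0
  have h6 : ∫ x in 0..X, u x ^ 6 ≤ ∫ x in 0..Y, u x ^ 6 := by
    have := intervalIntegral.integral_add_adjacent_intervals ((h X hX).intervalIntegrable_pow 6)
      ((hs.mono hX hXY le_rfl).intervalIntegrable_pow 6)
    have h7 : 0 ≤ ∫ x in X..Y, u x ^ 6 :=
      intervalIntegral.integral_nonneg hXY fun x _ => by positivity
    linarith
  have h8 : k ^ 2 * ∫ x in 0..X, u x ^ 6 ≤ k ^ 2 * ∫ x in 0..Y, u x ^ 6 := by gcongr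
  have hcot : Real.cot (k * c) ≤ |Real.cot (k * ε)| := by
    refine (Real.cot_le_cot_of_le (by positivity) (by gcongr) ?_).trans (le_abs_self _)
    refine lt_of_le_of_lt ?_ hkε
    gcongr
    rw [hc]; linarith
  have h9 : k * Real.cot (k * c) * u Y ^ 4 ≤ η := by
    have hu4 : u Y ^ 4 ≤ η / C := by
      have h10 : u Y ^ 2 ≤ 1 := hY.le.trans (min_le_left _ _)
      have h11 : u Y ^ 2 ≤ η / C := hY.le.trans (min_le_right _ _)
      nlinarith [sq_nonneg (u Y)]
    calc k * Real.cot (k * c) * u Y ^ 4 ≤ k * |Real.cot (k * ε)| * u Y ^ 4 := by gcongr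
      _ ≤ C * u Y ^ 4 := by gcongr; linarith
      _ ≤ C * (η / C) := by gcongr
      _ = η := by field_simp
  linarith

/-- The sharp Gagliardo–Nirenberg inequality on the half-line. -/
theorem halfLine_gagliardoNirenberg {u g : ℝ → ℝ} (h : ∀ X, 0 ≤ X → SobolevOn u g 0 X)
    (hu2 : IntegrableOn (fun x => u x ^ 2) (Ici 0)) (hg2 : IntegrableOn (fun x => g x ^ 2) (Ici 0))
    {X : ℝ} (hX : 0 ≤ X) :
    ∫ x in 0..X, u x ^ 6
      ≤ 16 / Real.pi ^ 2 * (∫ x in Ici 0, u x ^ 2) ^ 2 * ∫ x in Ici 0, g x ^ 2 := by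
  set M := ∫ x in Ici 0, u x ^ 2 with hM
  set K := ∫ x in Ici 0, g x ^ 2 with hK
  have hM0 : 0 ≤ M := setIntegral_nonneg measurableSet_Ici fun x _ => sq_nonneg _
  have hpi := Real.pi_pos
  -- The additional mass `ε` keeps the angle away from the pole of cot and covers `M = 0`; it tends
  -- to zero at the end.
  have key : ∀ ε > 0, ∫ x in 0..X, u x ^ 6 ≤ 16 / Real.pi ^ 2 * (ε + M) ^ 2 * K := by
    intro ε hε
    have hk : Real.pi / (2 * (ε + M)) * (ε + M) = Real.pi / 2 := by field_simp
    have h1 := halfLine_mass_calibration h hu2 hg2 hε (k := Real.pi / (2 * (ε + M)))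
      (by positivity) (by rw [hk]; linarith) hX
    rw [hk, Real.cot_eq_cos_div_sin, Real.cos_pi_div_two] at h1
    simp only [zero_div, mul_zero, zero_mul] at h1
    rw [div_pow, div_mul_eq_mul_div, sub_nonneg, div_le_iff₀ (by positivity)] at h1
    rw [div_mul_eq_mul_div, div_mul_eq_mul_div, le_div_iff₀ (by positivity)]
    linarith
  have hlim : Filter.Tendsto (fun ε : ℝ => 16 / Real.pi ^ 2 * (ε + M) ^ 2 * K)
      (nhdsWithin 0 (Ioi 0)) (nhds (16 / Real.pi ^ 2 * (0 + M) ^ 2 * K)) := by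
    refine Filter.Tendsto.mono_left (Continuous.tendsto (by fun_prop) 0) nhdsWithin_le_nhds
  rw [zero_add] at hlim
  exact ge_of_tendsto hlim (eventually_nhdsWithin_of_forall key)

/-- The sharp Gagliardo–Nirenberg inequality on the line, whose two halves are described by
`u₁, g₁` and `u₂, g₂`. -/
theorem line_gagliardoNirenberg {u₁ g₁ u₂ g₂ : ℝ → ℝ}
    (h₁ : ∀ X, 0 ≤ X → SobolevOn u₁ g₁ 0 X) (h₂ : ∀ X, 0 ≤ X → SobolevOn u₂ g₂ 0 X)
    (hu₁ : IntegrableOn (fun x => u₁ x ^ 2) (Ici 0))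
    (hg₁ : IntegrableOn (fun x => g₁ x ^ 2) (Ici 0))
    (hu₂ : IntegrableOn (fun x => u₂ x ^ 2) (Ici 0))
    (hg₂ : IntegrableOn (fun x => g₂ x ^ 2) (Ici 0))
    (h0 : u₁ 0 = u₂ 0) {X : ℝ} (hX : 0 ≤ X) :
    (∫ x in 0..X, u₁ x ^ 6) + ∫ x in 0..X, u₂ x ^ 6
      ≤ 4 / Real.pi ^ 2 * ((∫ x in Ici 0, u₁ x ^ 2) + ∫ x in Ici 0, u₂ x ^ 2) ^ 2
        * ((∫ x in Ici 0, g₁ x ^ 2) + ∫ x in Ici 0, g₂ x ^ 2) := by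
  set M₁ := ∫ x in Ici 0, u₁ x ^ 2 with hM₁
  set K₁ := ∫ x in Ici 0, g₁ x ^ 2 with hK₁
  set M₂ := ∫ x in Ici 0, u₂ x ^ 2 with hM₂
  set K₂ := ∫ x in Ici 0, g₂ x ^ 2 with hK₂
  have hM₁0 : 0 ≤ M₁ := setIntegral_nonneg measurableSet_Ici fun x _ => sq_nonneg _
  have hM₂0 : 0 ≤ M₂ := setIntegral_nonneg measurableSet_Ici fun x _ => sq_nonneg _
  have hpi := Real.pi_pos
  have key : ∀ ε > 0, (∫ x in 0..X, u₁ x ^ 6) + ∫ x in 0..X, u₂ x ^ 6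
      ≤ 4 / Real.pi ^ 2 * ((ε + M₁) + (ε + M₂)) ^ 2 * (K₁ + K₂) := by
    intro ε hε
    -- The angles reached from both sides are supplementary: their cotangents are opposite, and the
    -- boundary terms cancel because `u₁ 0 = u₂ 0`.
    set k := Real.pi / ((ε + M₁) + (ε + M₂)) with hkdef
    have hkpos : 0 < k := by positivity
    have hk : k * (ε + M₁) + k * (ε + M₂) = Real.pi := by rw [hkdef]; field_simp
    have hp1 : 0 < k * (ε + M₁) := by positivity
    have hp2 : 0 < k * (ε + M₂) := by positivity
    have c1 := halfLine_mass_calibration h₁ hu₁ hg₁ hε hkpos (by linarith) hX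
    have c2 := halfLine_mass_calibration h₂ hu₂ hg₂ hε hkpos (by linarith) hX
    have e : Real.cot (k * (ε + M₂)) = -Real.cot (k * (ε + M₁)) := by
      rw [eq_sub_of_add_eq' hk, Real.cot_eq_cos_div_sin, Real.cot_eq_cos_div_sin,
        Real.cos_pi_sub, Real.sin_pi_sub, neg_div]
    rw [← hM₁, ← hK₁] at c1
    rw [← hM₂, ← hK₂, e, ← h0] at c2
    have h3 : k ^ 2 * ((∫ x in 0..X, u₁ x ^ 6) + ∫ x in 0..X, u₂ x ^ 6) ≤ 4 * (K₁ + K₂) := by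
      linarith
    rw [hkdef, div_pow, div_mul_eq_mul_div, div_le_iff₀ (by positivity)] at h3
    rw [div_mul_eq_mul_div, div_mul_eq_mul_div, le_div_iff₀ (by positivity)]
    linarith
  have hlim : Filter.Tendsto
      (fun ε : ℝ => 4 / Real.pi ^ 2 * ((ε + M₁) + (ε + M₂)) ^ 2 * (K₁ + K₂))
      (nhdsWithin 0 (Ioi 0))
      (nhds (4 / Real.pi ^ 2 * ((0 + M₁) + (0 + M₂)) ^ 2 * (K₁ + K₂))) := by
    refine Filter.Tendsto.mono_left (Continuous.tendsto (by fun_prop) 0) nhdsWithin_le_nhds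
  rw [zero_add, zero_add] at hlim
  exact ge_of_tendsto hlim (eventually_nhdsWithin_of_forall key)

/-! ### The constants of the line and of the half-line: upper bounds -/

theorem enorm_pow_eq_ofReal_pow (r : ℝ) {n : ℕ} (hn : Even n) :
    ‖r‖ₑ ^ n = ENNReal.ofReal (r ^ n) := by
  rw [Real.enorm_eq_ofReal_abs, ← ENNReal.ofReal_pow (abs_nonneg _), hn.pow_abs]

theorem lintegral_enorm_pow_eq_ofReal {μ : Measure ℝ} {f : ℝ → ℝ} {n : ℕ} (hn : Even n)
    (hf : Integrable (fun x => f x ^ n) μ) :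
    ∫⁻ x, ‖f x‖ₑ ^ n ∂μ = ENNReal.ofReal (∫ x, f x ^ n ∂μ) := by
  rw [ofReal_integral_eq_lintegral_ofReal hf (Filter.Eventually.of_forall fun x => hn.pow_nonneg _)]
  exact lintegral_congr fun x => enorm_pow_eq_ofReal_pow _ hn

/-- Integrability of `u⁶` on the half-line is not known beforehand. Its lower integral is reached as
a limit of genuine integrals over `[0, X]`, to which the real inequalities apply. -/
theorem exists_tendsto_lintegral_Ici_pow_six {u g : ℝ → ℝ} (h : ∀ X, 0 ≤ X → SobolevOn u g 0 X) :
    ∃ s : ℝ → ℝ≥0∞, Filter.Tendsto s Filter.atTop (nhds (∫⁻ x in Ici 0, ‖u x‖ₑ ^ 6)) ∧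
      ∀ X, 0 ≤ X → s X = ENNReal.ofReal (∫ x in 0..X, u x ^ 6) := by
  have hcov : AECover (volume.restrict (Ici (0 : ℝ))) Filter.atTop (fun X : ℝ => Iic X) :=
    aecover_Iic Filter.tendsto_id
  have hmeas : AEMeasurable (fun x => ‖u x‖ₑ ^ 6) (volume.restrict (Ici (0 : ℝ))) := by
    have : ContinuousOn u (Ici 0) := by
      intro x hx
      have h1 : 0 ≤ x := hx
      have h2 : ContinuousWithinAt u (Icc 0 (x + 1)) x :=
        (h (x + 1) (by linarith)).continuousOn x ⟨hx, by linarith⟩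
      refine h2.mono_of_mem_nhdsWithin ?_
      rw [← Ici_inter_Iic]
      exact inter_mem_nhdsWithin _ (Iic_mem_nhds (by linarith))
    exact ((this.aemeasurable measurableSet_Ici).enorm).pow_const 6
  refine ⟨_, hcov.lintegral_tendsto_of_countably_generated hmeas, fun X hX => ?_⟩
  rw [Measure.restrict_restrict measurableSet_Iic, inter_comm, Ici_inter_Iic,
    intervalIntegral.integral_of_le hX, ← integral_Icc_eq_integral_Ioc]
  refine lintegral_enorm_pow_eq_ofReal (by decide) ?_
  exact (intervalIntegrable_iff_integrableOn_Icc_of_le hX).1 ((h X hX).intervalIntegrable_pow 6)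

theorem IsH1On.integrableOn_sq {I : Set ℝ} {u g : ℝ → ℝ} (h : IsH1On I u g) :
    IntegrableOn (fun x => u x ^ 2) I := h.memLp.integrable_sq

theorem IsH1On.integrableOn_deriv_sq {I : Set ℝ} {u g : ℝ → ℝ} (h : IsH1On I u g) :
    IntegrableOn (fun x => g x ^ 2) I := h.memLp_deriv.integrable_sq

theorem gnConstHalfLine_le : gnConstHalfLine ≤ ENNReal.ofReal (16 / Real.pi ^ 2) := by
  refine iSup_le fun u => iSup_le fun g => iSup_le fun h => ?_
  have hs : ∀ X, 0 ≤ X → SobolevOn u g 0 X := fun X hX =>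
    h.sobolevOn measurableSet_Ici hX fun x hx => hx.1
  refine ENNReal.div_le_of_le_mul ?_
  rw [lintegral_enorm_pow_eq_ofReal (by decide) h.integrableOn_sq,
    lintegral_enorm_pow_eq_ofReal (by decide) h.integrableOn_deriv_sq]
  have hM0 : 0 ≤ ∫ x in Ici 0, u x ^ 2 :=
    setIntegral_nonneg measurableSet_Ici fun x _ => sq_nonneg _
  rw [← ENNReal.ofReal_pow hM0, ← ENNReal.ofReal_mul (by positivity),
    ← ENNReal.ofReal_mul (by positivity)]
  obtain ⟨s, hlim, hsX⟩ := exists_tendsto_lintegral_Ici_pow_six hs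
  refine le_of_tendsto hlim ?_
  filter_upwards [Filter.eventually_ge_atTop (0 : ℝ)] with X hX
  rw [hsX X hX]
  refine ENNReal.ofReal_le_ofReal ?_
  rw [← mul_assoc]
  exact halfLine_gagliardoNirenberg hs h.integrableOn_sq h.integrableOn_deriv_sq hX

theorem lintegral_eq_lintegral_Ici_add (f : ℝ → ℝ≥0∞) :
    ∫⁻ x, f x = (∫⁻ x in Ici 0, f x) + ∫⁻ x in Ici 0, f (-x) := by
  rw [← lintegral_add_compl f (measurableSet_Ici (a := (0 : ℝ)))]
  congr 1
  have h1 := (Measure.measurePreserving_neg (volume : Measure ℝ)).setLIntegral_comp_preimage_emb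
    (MeasurableEquiv.neg ℝ).measurableEmbedding f (Iio 0)
  rw [compl_Ici, ← h1, show Neg.neg ⁻¹' Iio (0 : ℝ) = Ioi 0 by ext; simp,
    Measure.restrict_congr_set Ioi_ae_eq_Ici]

theorem gnConstLine_le : gnConstLine ≤ ENNReal.ofReal (4 / Real.pi ^ 2) := by
  refine iSup_le fun u => iSup_le fun g => iSup_le fun h => ?_
  have hs₁ : ∀ X, 0 ≤ X → SobolevOn u g 0 X := fun X hX =>
    h.sobolevOn MeasurableSet.univ hX (subset_univ _)
  have hs₂ : ∀ X, 0 ≤ X → SobolevOn (fun x => u (-x)) (fun x => -g (-x)) 0 X := by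
    intro X hX
    have := (h.sobolevOn MeasurableSet.univ (a := -X) (b := 0) (by linarith)
      (subset_univ _)).reflect 0
    simpa using this
  have hu : Integrable (fun x => u x ^ 2) := by simpa using h.integrableOn_sq
  have hg : Integrable (fun x => g x ^ 2) := by simpa using h.integrableOn_deriv_sq
  have hu' : IntegrableOn (fun x => u (-x) ^ 2) (Ici 0) := hu.comp_neg.integrableOn
  have hg' : IntegrableOn (fun x => (-g (-x)) ^ 2) (Ici 0) := by
    simpa using (hg.comp_neg.integrableOn (s := Ici 0))
  refine ENNReal.div_le_of_le_mul ?_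
  simp only [Measure.restrict_univ]
  rw [lintegral_eq_lintegral_Ici_add (fun x => ‖u x‖ₑ ^ 6),
    lintegral_eq_lintegral_Ici_add (fun x => ‖u x‖ₑ ^ 2),
    lintegral_eq_lintegral_Ici_add (fun x => ‖g x‖ₑ ^ 2)]
  have e1 : ∫⁻ x in Ici 0, ‖g (-x)‖ₑ ^ 2 = ∫⁻ x in Ici 0, ‖-g (-x)‖ₑ ^ 2 := by simp
  rw [e1, lintegral_enorm_pow_eq_ofReal (by decide) hu.integrableOn,
    lintegral_enorm_pow_eq_ofReal (by decide) hg.integrableOn,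
    lintegral_enorm_pow_eq_ofReal (by decide) hu',
    lintegral_enorm_pow_eq_ofReal (by decide) hg']
  have nn : ∀ f : ℝ → ℝ, 0 ≤ ∫ x in Ici 0, f x ^ 2 := fun f =>
    setIntegral_nonneg measurableSet_Ici fun x _ => sq_nonneg _
  have n1 := nn u
  have n2 := nn g
  have n3 := nn fun x => u (-x)
  have n4 := nn fun x => -g (-x)
  rw [← ENNReal.ofReal_add n1 n3, ← ENNReal.ofReal_add n2 n4, ← ENNReal.ofReal_pow (by linarith),
    ← ENNReal.ofReal_mul (by positivity), ← ENNReal.ofReal_mul (by positivity)]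
  obtain ⟨s₁, hlim₁, hsX₁⟩ := exists_tendsto_lintegral_Ici_pow_six hs₁
  obtain ⟨s₂, hlim₂, hsX₂⟩ := exists_tendsto_lintegral_Ici_pow_six hs₂
  refine le_of_tendsto (hlim₁.add hlim₂) ?_
  filter_upwards [Filter.eventually_ge_atTop (0 : ℝ)] with X hX
  have n6 : ∀ f : ℝ → ℝ, 0 ≤ ∫ x in 0..X, f x ^ 6 := fun f =>
    intervalIntegral.integral_nonneg hX fun x _ => by positivity
  rw [hsX₁ X hX, hsX₂ X hX, ← ENNReal.ofReal_add (n6 _) (n6 _)]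
  refine ENNReal.ofReal_le_ofReal ?_
  rw [← mul_assoc]
  exact line_gagliardoNirenberg hs₁ hs₂ hu.integrableOn hg.integrableOn hu' hg' (by simp) hX

/-! ### The optimal profile -/

/-- The profile `(cosh x)^(-1/2)`, which is optimal on the line and on the half-line. -/
noncomputable def soliton (x : ℝ) : ℝ := 1 / √(Real.cosh x)

/-- The derivative of `soliton`. -/
noncomputable def solitonDeriv (x : ℝ) : ℝ := -(Real.sinh x / (2 * Real.cosh x * √(Real.cosh x)))

theorem soliton_pos (x : ℝ) : 0 < soliton x := by
  have := Real.cosh_pos x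
  unfold soliton
  positivity

theorem soliton_neg (x : ℝ) : soliton (-x) = soliton x := by simp [soliton]

theorem solitonDeriv_neg (x : ℝ) : solitonDeriv (-x) = -solitonDeriv x := by
  simp [solitonDeriv, neg_div]

theorem soliton_le_one (x : ℝ) : soliton x ≤ 1 := by
  unfold soliton
  rw [div_le_one (by have := Real.cosh_pos x; positivity)]
  exact Real.one_le_sqrt.2 (Real.one_le_cosh x)

theorem soliton_sq (x : ℝ) : soliton x ^ 2 = 1 / Real.cosh x := by
  rw [soliton, div_pow, Real.sq_sqrt (Real.cosh_pos x).le, one_pow]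

theorem soliton_pow_six (x : ℝ) : soliton x ^ 6 = 1 / Real.cosh x ^ 3 := by
  rw [show soliton x ^ 6 = (soliton x ^ 2) ^ 3 by ring, soliton_sq, div_pow, one_pow]

/-- The first integral of the profile equation, u'² = (u² - u⁶)/4. It reduces the kinetic integral
to the mass and the sixth power. -/
theorem solitonDeriv_sq (x : ℝ) :
    solitonDeriv x ^ 2 = (1 / Real.cosh x - 1 / Real.cosh x ^ 3) / 4 := by
  have h := Real.cosh_pos x
  rw [solitonDeriv, neg_sq, div_pow, mul_pow, Real.sq_sqrt h.le, Real.sinh_sq]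
  field_simp
  norm_num

theorem hasDerivAt_soliton (x : ℝ) : HasDerivAt soliton (solitonDeriv x) x := by
  have h := Real.cosh_pos x
  have h1 := ((Real.hasDerivAt_cosh x).sqrt h.ne').inv (Real.sqrt_pos.2 h).ne'
  have h2 : soliton = (fun y => √(Real.cosh y))⁻¹ := by
    funext y; simp [soliton]
  rw [h2]
  refine h1.congr_deriv ?_
  rw [Real.sq_sqrt h.le, solitonDeriv]
  field_simp

theorem continuous_soliton : Continuous soliton :=
  continuous_iff_continuousAt.2 fun x => (hasDerivAt_soliton x).continuousAt

theorem continuous_solitonDeriv : Continuous solitonDeriv := by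
  refine Continuous.neg (Continuous.div Real.continuous_sinh ?_ fun x => ?_)
  · exact (continuous_const.mul Real.continuous_cosh).mul Real.continuous_cosh.sqrt
  · have := Real.cosh_pos x
    positivity

theorem hasDerivAt_arctan_sinh (x : ℝ) :
    HasDerivAt (fun x => Real.arctan (Real.sinh x)) (1 / Real.cosh x) x := by
  refine (Real.hasDerivAt_sinh x).arctan.congr_deriv ?_
  have h := Real.cosh_pos x
  rw [add_comm, ← Real.cosh_sq]
  field_simp

theorem hasDerivAt_primitive_soliton_pow_six (x : ℝ) :
    HasDerivAt (fun x => (Real.sinh x / Real.cosh x ^ 2 + Real.arctan (Real.sinh x)) / 2)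
      (1 / Real.cosh x ^ 3) x := by
  have h := Real.cosh_pos x
  refine ((((Real.hasDerivAt_sinh x).div ((Real.hasDerivAt_cosh x).pow 2)
    (pow_ne_zero 2 h.ne')).add (hasDerivAt_arctan_sinh x)).div_const 2).congr_deriv ?_
  have := Real.sinh_sq x
  simp only [Pi.pow_apply]
  field_simp
  rw [this]
  ring

theorem tendsto_sinh_atTop : Filter.Tendsto Real.sinh Filter.atTop Filter.atTop :=
  Filter.tendsto_atTop_mono' _ ((Filter.eventually_ge_atTop 0).mono fun _ hx =>
    Real.self_le_sinh_iff.2 hx) Filter.tendsto_id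

theorem tendsto_cosh_atTop : Filter.Tendsto Real.cosh Filter.atTop Filter.atTop :=
  Filter.tendsto_atTop_mono (fun x => (Real.sinh_lt_cosh x).le) tendsto_sinh_atTop

theorem tendsto_arctan_sinh :
    Filter.Tendsto (fun x => Real.arctan (Real.sinh x)) Filter.atTop (nhds (Real.pi / 2)) :=
  (Real.tendsto_arctan_atTop.mono_right nhdsWithin_le_nhds).comp tendsto_sinh_atTop

theorem tendsto_cosh_inv :
    Filter.Tendsto (fun x => (Real.cosh x)⁻¹) Filter.atTop (nhds 0) :=
  tendsto_inv_atTop_zero.comp tendsto_cosh_atTop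

theorem tendsto_soliton : Filter.Tendsto soliton Filter.atTop (nhds 0) := by
  have h := (Real.continuous_sqrt.tendsto 0).comp tendsto_cosh_inv
  rw [Real.sqrt_zero] at h
  refine h.congr fun x => ?_
  simp [soliton, Real.sqrt_inv]

theorem tendsto_primitive_soliton_pow_six :
    Filter.Tendsto (fun x => (Real.sinh x / Real.cosh x ^ 2 + Real.arctan (Real.sinh x)) / 2)
      Filter.atTop (nhds (Real.pi / 4)) := by
  have h0 : Filter.Tendsto (fun x => Real.sinh x / Real.cosh x ^ 2) Filter.atTop (nhds 0) := by
    refine tendsto_of_tendsto_of_tendsto_of_le_of_le' tendsto_const_nhds tendsto_cosh_inv ?_ ?_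
    · filter_upwards [Filter.eventually_ge_atTop (0 : ℝ)] with x hx
      have := Real.sinh_nonneg_iff.2 hx
      positivity
    · filter_upwards with x
      have h := Real.cosh_pos x
      have := (Real.sinh_lt_cosh x).le
      rw [inv_eq_one_div, div_le_div_iff₀ (by positivity) h]
      nlinarith
  have := (h0.add tendsto_arctan_sinh).div_const 2
  convert this using 2
  ring

theorem soliton_mass : IntegrableOn (fun x => soliton x ^ 2) (Ici 0) ∧
    ∫ x in Ici 0, soliton x ^ 2 = Real.pi / 2 := by
  simp only [soliton_sq, integral_Ici_eq_integral_Ioi]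
  have hn : ∀ x ∈ Ioi (0 : ℝ), 0 ≤ 1 / Real.cosh x := fun x _ => by
    have := Real.cosh_pos x; positivity
  refine ⟨(integrableOn_Ici_iff_integrableOn_Ioi enorm_ne_top).2 <|
    integrableOn_Ioi_deriv_of_nonneg' (fun x _ => hasDerivAt_arctan_sinh x) hn
    tendsto_arctan_sinh, ?_⟩
  rw [integral_Ioi_of_hasDerivAt_of_nonneg' (fun x _ => hasDerivAt_arctan_sinh x) hn
    tendsto_arctan_sinh]
  simp

theorem soliton_six : IntegrableOn (fun x => soliton x ^ 6) (Ici 0) ∧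
    ∫ x in Ici 0, soliton x ^ 6 = Real.pi / 4 := by
  simp only [soliton_pow_six, integral_Ici_eq_integral_Ioi]
  have hn : ∀ x ∈ Ioi (0 : ℝ), 0 ≤ 1 / Real.cosh x ^ 3 := fun x _ => by
    have := Real.cosh_pos x; positivity
  refine ⟨(integrableOn_Ici_iff_integrableOn_Ioi enorm_ne_top).2 <|
    integrableOn_Ioi_deriv_of_nonneg' (fun x _ => hasDerivAt_primitive_soliton_pow_six x) hn
    tendsto_primitive_soliton_pow_six, ?_⟩
  rw [integral_Ioi_of_hasDerivAt_of_nonneg' (fun x _ => hasDerivAt_primitive_soliton_pow_six x) hn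
    tendsto_primitive_soliton_pow_six]
  simp

theorem soliton_kinetic : IntegrableOn (fun x => solitonDeriv x ^ 2) (Ici 0) ∧
    ∫ x in Ici 0, solitonDeriv x ^ 2 = Real.pi / 16 := by
  have h2 := soliton_mass
  have h6 := soliton_six
  simp only [soliton_sq] at h2
  simp only [soliton_pow_six] at h6
  simp only [solitonDeriv_sq]
  refine ⟨(h2.1.sub h6.1).div_const 4, ?_⟩
  rw [integral_div, integral_sub h2.1 h6.1, h2.2, h6.2]
  ring

theorem le_gnConstHalfLine : ENNReal.ofReal (16 / Real.pi ^ 2) ≤ gnConstHalfLine := by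
  have h : IsH1On (Ici 0) soliton solitonDeriv :=
    isH1On_of_hasDerivAt hasDerivAt_soliton continuous_solitonDeriv soliton_mass.1 soliton_kinetic.1
  refine le_trans ?_ (le_iSup_of_le soliton (le_iSup_of_le solitonDeriv (le_iSup_of_le h le_rfl)))
  have hpi := Real.pi_pos
  rw [gnQuotient, lintegral_enorm_pow_eq_ofReal (by decide) soliton_mass.1,
    lintegral_enorm_pow_eq_ofReal (by decide) soliton_six.1,
    lintegral_enorm_pow_eq_ofReal (by decide) soliton_kinetic.1, soliton_mass.2, soliton_six.2,
    soliton_kinetic.2, ← ENNReal.ofReal_pow (by positivity), ← ENNReal.ofReal_mul (by positivity),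
    ← ENNReal.ofReal_div_of_pos (by positivity)]
  refine ENNReal.ofReal_le_ofReal (le_of_eq ?_)
  field_simp
  norm_num

theorem integrable_of_integrableOn_Ici_of_even {f : ℝ → ℝ} (hf : Continuous f)
    (heven : ∀ x, f (-x) = f x) (h : IntegrableOn f (Ici 0)) : Integrable f := by
  refine ⟨hf.aestronglyMeasurable, ?_⟩
  rw [hasFiniteIntegral_iff_enorm, lintegral_eq_lintegral_Ici_add]
  simp only [heven]
  have := hasFiniteIntegral_iff_enorm.1 h.2
  exact ENNReal.add_lt_top.2 ⟨this, this⟩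

theorem le_gnConstLine : ENNReal.ofReal (4 / Real.pi ^ 2) ≤ gnConstLine := by
  have hu : Integrable (fun x => soliton x ^ 2) := integrable_of_integrableOn_Ici_of_even
    (continuous_soliton.pow 2) (fun x => by rw [soliton_neg]) soliton_mass.1
  have hg : Integrable (fun x => solitonDeriv x ^ 2) := integrable_of_integrableOn_Ici_of_even
    (continuous_solitonDeriv.pow 2) (fun x => by rw [solitonDeriv_neg, neg_sq]) soliton_kinetic.1
  have h : IsH1On univ soliton solitonDeriv :=
    isH1On_of_hasDerivAt hasDerivAt_soliton continuous_solitonDeriv hu.integrableOn hg.integrableOn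
  refine le_trans ?_ (le_iSup_of_le soliton (le_iSup_of_le solitonDeriv (le_iSup_of_le h le_rfl)))
  have hpi := Real.pi_pos
  simp only [gnQuotient, Measure.restrict_univ]
  rw [lintegral_eq_lintegral_Ici_add (fun x => ‖soliton x‖ₑ ^ 6),
    lintegral_eq_lintegral_Ici_add (fun x => ‖soliton x‖ₑ ^ 2),
    lintegral_eq_lintegral_Ici_add (fun x => ‖solitonDeriv x‖ₑ ^ 2)]
  simp only [soliton_neg, solitonDeriv_neg, enorm_neg]
  rw [lintegral_enorm_pow_eq_ofReal (by decide) soliton_mass.1,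
    lintegral_enorm_pow_eq_ofReal (by decide) soliton_six.1,
    lintegral_enorm_pow_eq_ofReal (by decide) soliton_kinetic.1, soliton_mass.2, soliton_six.2,
    soliton_kinetic.2, ← ENNReal.ofReal_add (by positivity) (by positivity),
    ← ENNReal.ofReal_add (by positivity) (by positivity),
    ← ENNReal.ofReal_add (by positivity) (by positivity),
    ← ENNReal.ofReal_pow (by positivity), ← ENNReal.ofReal_mul (by positivity),
    ← ENNReal.ofReal_div_of_pos (by positivity)]
  refine ENNReal.ofReal_le_ofReal (le_of_eq ?_)
  field_simp
  norm_num

/-! ### Real-valued functionals on a metric graph -/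

namespace MetricGraph

variable {V E H : Type*} {G : MetricGraph V E H}

namespace H1

/-- `‖u‖₂²` over the bounded edge `e`. -/
noncomputable def edgeMass (u : G.H1) (e : E) : ℝ := ∫ x in 0..G.length e, u.onEdge e x ^ 2

/-- `‖u'‖₂²` over the bounded edge `e`. -/
noncomputable def edgeKinetic (u : G.H1) (e : E) : ℝ :=
  ∫ x in 0..G.length e, u.onEdgeDeriv e x ^ 2

/-- `‖u‖₆⁶` over the bounded edge `e`. -/
noncomputable def edgeSix (u : G.H1) (e : E) : ℝ := ∫ x in 0..G.length e, u.onEdge e x ^ 6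

/-- `‖u‖₂²` over the half-line `h`. -/
noncomputable def halfMass (u : G.H1) (h : H) : ℝ := ∫ x in Ici 0, u.onHalf h x ^ 2

/-- `‖u'‖₂²` over the half-line `h`. -/
noncomputable def halfKinetic (u : G.H1) (h : H) : ℝ := ∫ x in Ici 0, u.onHalfDeriv h x ^ 2

theorem sobolevOn_edge (u : G.H1) (e : E) :
    SobolevOn (u.onEdge e) (u.onEdgeDeriv e) 0 (G.length e) :=
  (u.isH1On_edge e).sobolevOn measurableSet_Icc (G.length_pos e).le Subset.rfl

theorem sobolevOn_half (u : G.H1) (h : H) (X : ℝ) (hX : 0 ≤ X) :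
    SobolevOn (u.onHalf h) (u.onHalfDeriv h) 0 X :=
  (u.isH1On_half h).sobolevOn measurableSet_Ici hX fun _ hx => hx.1

theorem edgeMass_nonneg (u : G.H1) (e : E) : 0 ≤ u.edgeMass e :=
  intervalIntegral.integral_nonneg (G.length_pos e).le fun _ _ => sq_nonneg _

theorem edgeKinetic_nonneg (u : G.H1) (e : E) : 0 ≤ u.edgeKinetic e :=
  intervalIntegral.integral_nonneg (G.length_pos e).le fun _ _ => sq_nonneg _

theorem edgeSix_nonneg (u : G.H1) (e : E) : 0 ≤ u.edgeSix e :=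
  intervalIntegral.integral_nonneg (G.length_pos e).le fun _ _ => by positivity

theorem halfMass_nonneg (u : G.H1) (h : H) : 0 ≤ u.halfMass h :=
  setIntegral_nonneg measurableSet_Ici fun _ _ => sq_nonneg _

theorem halfKinetic_nonneg (u : G.H1) (h : H) : 0 ≤ u.halfKinetic h :=
  setIntegral_nonneg measurableSet_Ici fun _ _ => sq_nonneg _

/-- `‖u‖₆⁶` over the compact core, as a real number. -/
noncomputable def totalSix [Fintype E] (u : G.H1) : ℝ := ∑ e, u.edgeSix e

variable [Fintype E] [Fintype H]

/-- `‖u‖₂²` over the graph, as a real number. -/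
noncomputable def totalMass (u : G.H1) : ℝ := ∑ e, u.edgeMass e + ∑ h, u.halfMass h

/-- `‖u'‖₂²` over the graph, as a real number. -/
noncomputable def totalKinetic (u : G.H1) : ℝ := ∑ e, u.edgeKinetic e + ∑ h, u.halfKinetic h

theorem totalMass_nonneg (u : G.H1) : 0 ≤ u.totalMass :=
  add_nonneg (Finset.sum_nonneg fun _ _ => u.edgeMass_nonneg _)
    (Finset.sum_nonneg fun _ _ => u.halfMass_nonneg _)

theorem totalKinetic_nonneg (u : G.H1) : 0 ≤ u.totalKinetic :=
  add_nonneg (Finset.sum_nonneg fun _ _ => u.edgeKinetic_nonneg _)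
    (Finset.sum_nonneg fun _ _ => u.halfKinetic_nonneg _)

end H1

theorem lintegral_Icc_enorm_pow_eq_ofReal {f : ℝ → ℝ} {n : ℕ} (hn : Even n) {ℓ : ℝ} (hℓ : 0 ≤ ℓ)
    (hf : IntervalIntegrable (fun x => f x ^ n) volume 0 ℓ) :
    ∫⁻ x in Icc 0 ℓ, ‖f x‖ₑ ^ n = ENNReal.ofReal (∫ x in 0..ℓ, f x ^ n) := by
  rw [lintegral_enorm_pow_eq_ofReal hn ((intervalIntegrable_iff_integrableOn_Icc_of_le hℓ).1 hf),
    intervalIntegral.integral_of_le hℓ, integral_Icc_eq_integral_Ioc]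

theorem coreSix_eq [Fintype E] (u : G.H1) : G.coreSix u = ENNReal.ofReal u.totalSix := by
  rw [coreSix, H1.totalSix, ENNReal.ofReal_sum_of_nonneg fun _ _ => u.edgeSix_nonneg _]
  exact Finset.sum_congr rfl fun e _ => lintegral_Icc_enorm_pow_eq_ofReal (by decide)
    (G.length_pos e).le ((u.sobolevOn_edge e).intervalIntegrable_pow 6)

variable [Fintype E] [Fintype H]

theorem mass_eq (u : G.H1) : G.mass u = ENNReal.ofReal u.totalMass := by
  rw [mass, H1.totalMass, ENNReal.ofReal_add (Finset.sum_nonneg fun _ _ => u.edgeMass_nonneg _)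
    (Finset.sum_nonneg fun _ _ => u.halfMass_nonneg _),
    ENNReal.ofReal_sum_of_nonneg fun _ _ => u.edgeMass_nonneg _,
    ENNReal.ofReal_sum_of_nonneg fun _ _ => u.halfMass_nonneg _]
  congr 1
  · exact Finset.sum_congr rfl fun e _ => lintegral_Icc_enorm_pow_eq_ofReal (by decide)
      (G.length_pos e).le ((u.sobolevOn_edge e).intervalIntegrable_pow 2)
  · exact Finset.sum_congr rfl fun h _ => lintegral_enorm_pow_eq_ofReal (by decide)
      (u.isH1On_half h).integrableOn_sq

theorem kinetic_eq (u : G.H1) : G.kinetic u = ENNReal.ofReal u.totalKinetic := by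
  rw [kinetic, H1.totalKinetic,
    ENNReal.ofReal_add (Finset.sum_nonneg fun _ _ => u.edgeKinetic_nonneg _)
    (Finset.sum_nonneg fun _ _ => u.halfKinetic_nonneg _),
    ENNReal.ofReal_sum_of_nonneg fun _ _ => u.edgeKinetic_nonneg _,
    ENNReal.ofReal_sum_of_nonneg fun _ _ => u.halfKinetic_nonneg _]
  congr 1
  · exact Finset.sum_congr rfl fun e _ => lintegral_Icc_enorm_pow_eq_ofReal (by decide)
      (G.length_pos e).le (u.sobolevOn_edge e).intervalIntegrable_sq
  · exact Finset.sum_congr rfl fun h _ => lintegral_enorm_pow_eq_ofReal (by decide)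
      (u.isH1On_half h).integrableOn_deriv_sq

theorem coreConst_le {c : ℝ} (hc : 0 ≤ c)
    (h : ∀ u : G.H1, u.totalSix ≤ c * (u.totalMass ^ 2 * u.totalKinetic)) :
    G.coreConst ≤ ENNReal.ofReal c := by
  refine iSup_le fun u => ENNReal.div_le_of_le_mul ?_
  rw [coreSix_eq, mass_eq, kinetic_eq, ← ENNReal.ofReal_pow u.totalMass_nonneg,
    ← ENNReal.ofReal_mul (pow_nonneg u.totalMass_nonneg 2), ← ENNReal.ofReal_mul hc]
  exact ENNReal.ofReal_le_ofReal (h u)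

/-- Bounds for the three functionals suffice, so the truncated profiles never have to be integrated
exactly. Positive `m` and `κ` keep the real quotient meaningful. -/
theorem le_coreConst (u : G.H1) {s m κ : ℝ} (hm : 0 < m) (hκ : 0 < κ) (hsu : s ≤ u.totalSix)
    (hmu : u.totalMass ≤ m) (hκu : u.totalKinetic ≤ κ) :
    ENNReal.ofReal (s / (m ^ 2 * κ)) ≤ G.coreConst := by
  refine le_trans ?_ (le_iSup (fun u => G.quotient u) u)
  rw [ENNReal.ofReal_div_of_pos (by positivity), ENNReal.ofReal_mul (by positivity),
    ENNReal.ofReal_pow hm.le, quotient, coreSix_eq, mass_eq, kinetic_eq]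
  gcongr

/-! ### Test functions supported on one edge -/

open Classical in
/-- The function equal to `v` on the edge `e₀` and to zero elsewhere. -/
noncomputable def singleEdge (e₀ : E) (v v' : ℝ → ℝ) (hd : ∀ x, HasDerivAt v (v' x) x)
    (hc : Continuous v') (val : V → ℝ) (hsrc : v 0 = val (G.src e₀))
    (htgt : v (G.length e₀) = val (G.tgt e₀))
    (hE : ∀ e, e ≠ e₀ → val (G.src e) = 0 ∧ val (G.tgt e) = 0)
    (hH : ∀ h, val (G.origin h) = 0) : G.H1 where
  onEdge e := if e = e₀ then v else fun _ => 0
  onEdgeDeriv e := if e = e₀ then v' else fun _ => 0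
  onHalf _ _ := 0
  onHalfDeriv _ _ := 0
  isH1On_edge e := by
    have hv : Continuous v := continuous_iff_continuousAt.2 fun x => (hd x).continuousAt
    split_ifs with h
    · exact isH1On_of_hasDerivAt hd hc (hv.pow 2).integrableOn_Icc (hc.pow 2).integrableOn_Icc
    · exact isH1On_of_hasDerivAt (fun x => hasDerivAt_const x 0) continuous_const (by simp)
        (by simp)
  isH1On_half _ :=
    isH1On_of_hasDerivAt (fun x => hasDerivAt_const x 0) continuous_const (by simp)
        (by simp)
  atVertex := val
  edge_src e := by
    split_ifs with h
    · rw [h, hsrc]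
    · exact ((hE e h).1).symm
  edge_tgt e := by
    split_ifs with h
    · rw [h, htgt]
    · exact ((hE e h).2).symm
  half_origin h := (hH h).symm

theorem le_coreConst_of_singleEdge (e₀ : E) (v v' : ℝ → ℝ) (hd : ∀ x, HasDerivAt v (v' x) x)
    (hc : Continuous v') (val : V → ℝ) (hsrc : v 0 = val (G.src e₀))
    (htgt : v (G.length e₀) = val (G.tgt e₀))
    (hE : ∀ e, e ≠ e₀ → val (G.src e) = 0 ∧ val (G.tgt e) = 0)
    (hH : ∀ h, val (G.origin h) = 0) {s m κ : ℝ} (hm : 0 < m) (hκ : 0 < κ)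
    (hsv : s ≤ ∫ x in 0..G.length e₀, v x ^ 6) (hmv : ∫ x in 0..G.length e₀, v x ^ 2 ≤ m)
    (hκv : ∫ x in 0..G.length e₀, v' x ^ 2 ≤ κ) :
    ENNReal.ofReal (s / (m ^ 2 * κ)) ≤ G.coreConst := by
  classical
  refine le_coreConst (singleEdge e₀ v v' hd hc val hsrc htgt hE hH) hm hκ ?_ ?_ ?_
  · rw [H1.totalSix, Finset.sum_eq_single e₀]
    · simpa [H1.edgeSix, singleEdge] using hsv
    · intro e _ he
      simp [H1.edgeSix, singleEdge, he]
    · simp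
  · rw [H1.totalMass, Finset.sum_eq_single e₀]
    · simpa [H1.edgeMass, H1.halfMass, singleEdge] using hmv
    · intro e _ he
      simp [H1.edgeMass, singleEdge, he]
    · simp
  · rw [H1.totalKinetic, Finset.sum_eq_single e₀]
    · simpa [H1.edgeKinetic, H1.halfKinetic, singleEdge] using hκv
    · intro e _ he
      simp [H1.edgeKinetic, singleEdge, he]
    · simp

end MetricGraph

/-! ### The truncated profile -/

theorem soliton_antitoneOn : AntitoneOn soliton (Ici 0) := by
  intro x hx y hy hxy
  unfold soliton
  have h1 : Real.cosh x ≤ Real.cosh y := by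
    rw [Real.cosh_le_cosh, abs_of_nonneg hx, abs_of_nonneg hy]
    exact hxy
  have := Real.cosh_pos x
  gcongr

/-- Bernoulli's inequality for `((t - c) / t)⁶`. The power `t⁵` is then weakened to `t²`, whose
integral along the profile is known. -/
theorem pow_six_sub_le {c t : ℝ} (hc : 0 ≤ c) (hct : c ≤ t) (ht : t ≤ 1) :
    t ^ 6 - 6 * c * t ^ 2 ≤ (t - c) ^ 6 := by
  have h0 : 0 ≤ t := hc.trans hct
  have h1 : t ^ 6 - 6 * c * t ^ 5 ≤ (t - c) ^ 6 := by
    rcases h0.eq_or_lt with rfl | hpos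
    · have : c = 0 := le_antisymm hct hc
      simp [this]
    · have h2 := one_add_mul_sub_le_pow (R := ℝ) (a := (t - c) / t) (by
        have : 0 ≤ (t - c) / t := div_nonneg (by linarith) h0
        linarith) 6
      have h3 := mul_le_mul_of_nonneg_left h2 (pow_nonneg h0 6)
      rw [← mul_pow, mul_div_cancel₀ _ hpos.ne'] at h3
      refine le_trans (le_of_eq ?_) h3
      push_cast
      field_simp
      ring
  have h2 : t ^ 5 ≤ t ^ 2 := pow_le_pow_of_le_one h0 ht (by norm_num)
  nlinarith [mul_le_mul_of_nonneg_left h2 hc]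

/-- The lower bound for `∫₀ˣ (soliton - soliton x)⁶`. -/
noncomputable def truncatedSix (X : ℝ) : ℝ :=
  (∫ x in 0..X, soliton x ^ 6) - 6 * soliton X * (Real.pi / 2)

theorem tendsto_truncatedSix : Filter.Tendsto truncatedSix Filter.atTop (nhds (Real.pi / 4)) := by
  have h1 := intervalIntegral_tendsto_integral_Ioi 0
    (soliton_six.1.mono_set Ioi_subset_Ici_self) Filter.tendsto_id
  rw [← integral_Ici_eq_integral_Ioi, soliton_six.2] at h1
  have h2 := h1.sub ((tendsto_soliton.const_mul 6).mul_const (Real.pi / 2))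
  simp only [id, mul_zero, zero_mul, sub_zero] at h2
  exact h2

theorem truncatedSix_le {X : ℝ} (hX : 0 ≤ X) :
    truncatedSix X ≤ ∫ x in 0..X, (soliton x - soliton X) ^ 6 := by
  have hc := continuous_soliton
  have h1 : ∫ x in 0..X, soliton x ^ 2 ≤ Real.pi / 2 := by
    rw [← soliton_mass.2]
    exact intervalIntegral_le_setIntegral_Ici soliton_mass.1 (fun x => sq_nonneg _) hX
  have h2 : ∫ x in 0..X, (soliton x ^ 6 - 6 * soliton X * soliton x ^ 2)
      ≤ ∫ x in 0..X, (soliton x - soliton X) ^ 6 := by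
    refine intervalIntegral.integral_mono_on hX (Continuous.intervalIntegrable (by fun_prop) _ _)
      (Continuous.intervalIntegrable (by fun_prop) _ _) fun x hx => ?_
    exact pow_six_sub_le (soliton_pos X).le
      (soliton_antitoneOn hx.1 (mem_Ici.2 hX) hx.2) (soliton_le_one x)
  rw [intervalIntegral.integral_sub (Continuous.intervalIntegrable (by fun_prop) _ _)
    (Continuous.intervalIntegrable (by fun_prop) _ _), intervalIntegral.integral_const_mul] at h2
  have h3 : 6 * soliton X * ∫ x in 0..X, soliton x ^ 2 ≤ 6 * soliton X * (Real.pi / 2) := by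
    have := soliton_pos X
    gcongr
  unfold truncatedSix
  linarith

theorem truncated_mass_le {X : ℝ} (hX : 0 ≤ X) :
    ∫ x in 0..X, (soliton x - soliton X) ^ 2 ≤ Real.pi / 2 := by
  have hc := continuous_soliton
  have h1 : ∫ x in 0..X, soliton x ^ 2 ≤ Real.pi / 2 := by
    rw [← soliton_mass.2]
    exact intervalIntegral_le_setIntegral_Ici soliton_mass.1 (fun x => sq_nonneg _) hX
  refine le_trans (intervalIntegral.integral_mono_on hX
    (Continuous.intervalIntegrable (by fun_prop) _ _)
    (Continuous.intervalIntegrable (by fun_prop) _ _) fun x hx => ?_) h1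
  have h2 := soliton_antitoneOn hx.1 (mem_Ici.2 hX) hx.2
  have h3 := soliton_pos X
  nlinarith

/-! ### Lower bounds by concentration on one edge -/

namespace MetricGraph

variable {V E H : Type*} {G : MetricGraph V E H} [Fintype E] [Fintype H]

/-- The rescaled and truncated profile on the edge `e₀` as a test function; `n` is the number of
half-profiles which it contains. -/
theorem le_coreConst_of_soliton (e₀ : E) (val : V → ℝ)
    (hE : ∀ e, e ≠ e₀ → val (G.src e) = 0 ∧ val (G.tgt e) = 0)
    (hH : ∀ h, val (G.origin h) = 0) {n lam d X : ℝ} (hn : 0 < n) (hlam : 0 < lam) (hX : 0 ≤ X)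
    (hint : ∀ f : ℝ → ℝ, Continuous f → (∀ x, f (-x) = f x) →
      ∫ x in (-d)..(lam * G.length e₀ - d), f x = n * ∫ x in 0..X, f x)
    (hsrc : soliton d - soliton X = val (G.src e₀))
    (htgt : soliton (lam * G.length e₀ - d) - soliton X = val (G.tgt e₀)) :
    ENNReal.ofReal (64 * truncatedSix X / (n ^ 2 * Real.pi ^ 3)) ≤ G.coreConst := by
  have hpi := Real.pi_pos
  have hcov : ∀ f : ℝ → ℝ, Continuous f → (∀ x, f (-x) = f x) →
      ∫ x in 0..G.length e₀, f (lam * x - d) = lam⁻¹ * (n * ∫ x in 0..X, f x) := by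
    intro f hf hev
    rw [intervalIntegral.integral_comp_mul_sub _ hlam.ne', smul_eq_mul, mul_zero, zero_sub,
      hint f hf hev]
  have hcs := continuous_soliton
  have hcd := continuous_solitonDeriv
  have key := le_coreConst_of_singleEdge (G := G) e₀ (fun x => soliton (lam * x - d) - soliton X)
    (fun x => solitonDeriv (lam * x - d) * lam)
    (fun x => by
      have h1 : HasDerivAt (fun x => lam * x - d) lam x := by
        simpa using ((hasDerivAt_id x).const_mul lam).sub_const d
      exact ((hasDerivAt_soliton _).comp x h1).sub_const _)
    (by fun_prop) val (by simpa [soliton_neg] using hsrc) htgt hE hH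
    -- The change of variables gives a factor `lam⁻¹` in each integral and `lam²` in the kinetic
    -- one. All powers of `lam` cancel in the quotient: only the number `n` of half-profiles
    -- remains.
    (s := lam⁻¹ * (n * truncatedSix X)) (m := lam⁻¹ * (n * (Real.pi / 2)))
    (κ := lam ^ 2 * (lam⁻¹ * (n * (Real.pi / 16)))) (by positivity) (by positivity) ?_ ?_ ?_
  · refine le_trans (le_of_eq ?_) key
    congr 1
    field_simp
    ring
  · rw [hcov (fun x => (soliton x - soliton X) ^ 6) (by fun_prop) fun x => by rw [soliton_neg]]
    gcongr
    exact truncatedSix_le hX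
  · rw [hcov (fun x => (soliton x - soliton X) ^ 2) (by fun_prop) fun x => by rw [soliton_neg]]
    gcongr
    exact truncated_mass_le hX
  · simp_rw [mul_pow]
    rw [intervalIntegral.integral_mul_const, mul_comm, hcov (fun x => solitonDeriv x ^ 2)
      (by fun_prop) fun x => by rw [solitonDeriv_neg, neg_sq]]
    gcongr
    rw [← soliton_kinetic.2]
    exact intervalIntegral_le_setIntegral_Ici soliton_kinetic.1 (fun x => sq_nonneg _) hX

/-- As `X → ∞` the truncation error disappears: one half-profile gives the constant of the
half-line, two give that of the line. -/
theorem ofReal_le_coreConst_of_eventually {n : ℝ} (hn : 0 < n)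
    (h : ∀ X > 0, ENNReal.ofReal (64 * truncatedSix X / (n ^ 2 * Real.pi ^ 3)) ≤ G.coreConst) :
    ENNReal.ofReal (16 / (n ^ 2 * Real.pi ^ 2)) ≤ G.coreConst := by
  have hpi := Real.pi_pos
  have h1 := ((tendsto_truncatedSix.const_mul 64).div_const (n ^ 2 * Real.pi ^ 3))
  have h2 := ENNReal.tendsto_ofReal h1
  have e : 64 * (Real.pi / 4) / (n ^ 2 * Real.pi ^ 3) = 16 / (n ^ 2 * Real.pi ^ 2) := by
    field_simp
    norm_num
  rw [e] at h2
  refine le_of_tendsto h2 ?_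
  filter_upwards [Filter.eventually_gt_atTop (0 : ℝ)] with X hX
  exact h X hX

/-- Concentration in the middle of an edge. -/
theorem line_le_coreConst (e₀ : E) : ENNReal.ofReal (4 / Real.pi ^ 2) ≤ G.coreConst := by
  have h := ofReal_le_coreConst_of_eventually (G := G) (n := 2) two_pos fun X hX => by
    have hℓ := G.length_pos e₀
    have hlam : 2 * X / G.length e₀ * G.length e₀ = 2 * X := by field_simp
    -- The edge is stretched to `[-X, X]`; the truncated profile vanishes at both ends, hence at all
    -- vertices.
    refine le_coreConst_of_soliton e₀ (fun _ => 0) (fun _ _ => ⟨rfl, rfl⟩) (fun _ => rfl)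
      (lam := 2 * X / G.length e₀) (d := X) (X := X) two_pos (by positivity) hX.le ?_ ?_ ?_
    · intro f hf hev
      rw [hlam, show 2 * X - X = X by ring, ← intervalIntegral.integral_add_adjacent_intervals
        (hf.intervalIntegrable (-X) 0) (hf.intervalIntegrable 0 X)]
      have := intervalIntegral.integral_comp_neg (a := 0) (b := X) f
      simp only [hev, neg_zero] at this
      rw [← this, two_mul]
    · simp
    · rw [hlam, show 2 * X - X = X by ring, sub_self]
  refine le_trans (le_of_eq ?_) h
  congr 1
  field_simp
  norm_num

end MetricGraph

namespace MetricGraph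

variable {V E H : Type*} {G : MetricGraph V E H}

/-! ### Graphs with a terminal edge -/

/-- Every vertex is an endpoint of a bounded edge. -/
theorem Admissible.exists_incident (hG : G.Admissible) (v : V) :
    ∃ e, G.src e = v ∨ G.tgt e = v := by
  obtain ⟨e⟩ := hG.core_nonempty
  rcases Relation.ReflTransGen.cases_head (hG.connected v (G.src e)) with h | ⟨w, ⟨f, hf⟩, _⟩
  · exact ⟨e, Or.inl h.symm⟩
  · rcases hf with ⟨h, _⟩ | ⟨_, h⟩
    · exact ⟨f, Or.inl h⟩
    · exact ⟨f, Or.inr h⟩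

variable [Fintype E] [Fintype H]

theorem halfLine_le_coreConst (hG : G.Admissible) (hT : G.HasTerminalEdge) :
    ENNReal.ofReal (16 / Real.pi ^ 2) ≤ G.coreConst := by
  classical
  obtain ⟨-, v, -, hdeg⟩ := hT
  -- Degree one makes this bounded edge the only edge end at `v`: the test function may be nonzero
  -- at `v` without spreading to other edges.
  obtain ⟨e₀, he₀⟩ := hG.exists_incident v
  have hℓ := G.length_pos e₀
  have h := ofReal_le_coreConst_of_eventually (G := G) (n := 1) one_pos fun X hX => by
    have hlam : X / G.length e₀ * G.length e₀ = X := by field_simp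
    rw [degree] at hdeg
    rcases he₀ with he₀ | he₀
    · have h1 : 0 < {e | G.src e = v}.ncard := (Set.ncard_pos (Set.toFinite _)).2 ⟨e₀, he₀⟩
      have h2 : {e | G.tgt e = v} = ∅ := (Set.ncard_eq_zero (Set.toFinite _)).1 (by omega)
      have h3 : {h | G.origin h = v} = ∅ := (Set.ncard_eq_zero (Set.toFinite _)).1 (by omega)
      obtain ⟨e₁, h4⟩ := Set.ncard_eq_one.1 (show {e | G.src e = v}.ncard = 1 by omega)
      have h5 : ∀ e, G.src e = v → e = e₀ := fun e he => by
        have ha : e ∈ ({e₁} : Set E) := h4 ▸ he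
        have hb : e₀ ∈ ({e₁} : Set E) := h4 ▸ he₀
        rw [mem_singleton_iff.1 ha, mem_singleton_iff.1 hb]
      have h6 : ∀ e, G.tgt e ≠ v := fun e he => (h2 ▸ he : e ∈ (∅ : Set E))
      have h7 : ∀ h, G.origin h ≠ v := fun h he => (h3 ▸ he : h ∈ (∅ : Set H))
      refine le_coreConst_of_soliton e₀ (fun w => if w = v then soliton 0 - soliton X else 0)
        (fun e he => ⟨if_neg fun h => he (h5 e h), if_neg (h6 e)⟩) (fun h => if_neg (h7 h))
        -- The peak sits at the initial end of the edge.
        (lam := X / G.length e₀) (d := 0) (X := X) one_pos (by positivity) hX.le ?_ ?_ ?_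
      · intro f hf hev
        simp [hlam]
      · simp [he₀]
      · simp [hlam, h6 e₀]
    · have h1 : 0 < {e | G.tgt e = v}.ncard := (Set.ncard_pos (Set.toFinite _)).2 ⟨e₀, he₀⟩
      have h2 : {e | G.src e = v} = ∅ := (Set.ncard_eq_zero (Set.toFinite _)).1 (by omega)
      have h3 : {h | G.origin h = v} = ∅ := (Set.ncard_eq_zero (Set.toFinite _)).1 (by omega)
      obtain ⟨e₁, h4⟩ := Set.ncard_eq_one.1 (show {e | G.tgt e = v}.ncard = 1 by omega)
      have h5 : ∀ e, G.tgt e = v → e = e₀ := fun e he => by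
        have ha : e ∈ ({e₁} : Set E) := h4 ▸ he
        have hb : e₀ ∈ ({e₁} : Set E) := h4 ▸ he₀
        rw [mem_singleton_iff.1 ha, mem_singleton_iff.1 hb]
      have h6 : ∀ e, G.src e ≠ v := fun e he => (h2 ▸ he : e ∈ (∅ : Set E))
      have h7 : ∀ h, G.origin h ≠ v := fun h he => (h3 ▸ he : h ∈ (∅ : Set H))
      refine le_coreConst_of_soliton e₀ (fun w => if w = v then soliton 0 - soliton X else 0)
        (fun e he => ⟨if_neg (h6 e), if_neg fun h => he (h5 e h)⟩) (fun h => if_neg (h7 h))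
        -- The peak sits at the final end of the edge.
        (lam := X / G.length e₀) (d := X) (X := X) one_pos (by positivity) hX.le ?_ ?_ ?_
      · intro f hf hev
        have := intervalIntegral.integral_comp_neg (a := 0) (b := X) f
        simp only [hev, neg_zero] at this
        rw [hlam, sub_self, ← this, one_mul]
      · simp [h6 e₀]
      · simp [hlam, he₀]
  simpa using h

/-! ### Graphs with exactly one half-line -/

theorem integral_exp_sq {a : ℝ} (ha : 0 < a) :
    IntegrableOn (fun x => Real.exp (-a * x) ^ 2) (Ici 0) ∧
      ∫ x in Ici 0, Real.exp (-a * x) ^ 2 = 1 / (2 * a) := by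
  have e : (fun x => Real.exp (-a * x) ^ 2) = fun x => Real.exp ((-2 * a) * x) := by
    funext x
    rw [← Real.exp_nat_mul]
    push_cast
    ring_nf
  rw [e, integral_Ici_eq_integral_Ioi, integral_exp_mul_Ioi (by linarith)]
  refine ⟨(integrableOn_Ici_iff_integrableOn_Ioi enorm_ne_top).2
    (integrableOn_exp_mul_Ioi (by linarith) 0), ?_⟩
  simp

theorem integral_exp_deriv_sq {a : ℝ} (ha : 0 < a) :
    IntegrableOn (fun x => (Real.exp (-a * x) * -a) ^ 2) (Ici 0) ∧
      ∫ x in Ici 0, (Real.exp (-a * x) * -a) ^ 2 = a / 2 := by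
  simp_rw [mul_pow]
  refine ⟨(integral_exp_sq ha).1.mul_const _, ?_⟩
  rw [integral_mul_const, (integral_exp_sq ha).2]
  field_simp

/-- The function `1 + s x (ℓ - x)` on the bounded edges and `exp (-a x)` on the half-lines. -/
noncomputable def bumpedConst (G : MetricGraph V E H) (s : ℝ) {a : ℝ} (ha : 0 < a) : G.H1 where
  onEdge e x := 1 + s * (x * (G.length e - x))
  onEdgeDeriv e x := s * (G.length e - 2 * x)
  onHalf _ x := Real.exp (-a * x)
  onHalfDeriv _ x := Real.exp (-a * x) * -a
  isH1On_edge e := by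
    refine isH1On_of_hasDerivAt (fun x => ?_) (by fun_prop)
      (Continuous.integrableOn_Icc (by fun_prop)) (Continuous.integrableOn_Icc (by fun_prop))
    have h1 := (hasDerivAt_id x).mul ((hasDerivAt_id x).const_sub (G.length e))
    refine ((h1.const_mul s).const_add 1).congr_deriv ?_
    simp only [id]
    ring
  isH1On_half _ := by
    refine isH1On_of_hasDerivAt (fun x => ?_) (by fun_prop) (integral_exp_sq ha).1
      (integral_exp_deriv_sq ha).1
    have h1 : HasDerivAt (fun x => -a * x) (-a) x := by
      simpa using (hasDerivAt_id x).const_mul (-a)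
    exact h1.exp
  atVertex _ := 1
  edge_src e := by simp
  edge_tgt e := by simp
  half_origin h := by simp

/-- At `s = 0` the quotient is L / ((2L)² · 1/(4L)) = 1, with `L` the length of the core. To first
order in `s` the numerator grows by `6 s I` and the denominator only by `2 s I`, so a small positive
`s` gives more than 1. -/
theorem one_lt_coreConst (hG : G.Admissible) (hH : Fintype.card H = 1) : 1 < G.coreConst := by
  obtain ⟨e₀⟩ := hG.core_nonempty
  set L := ∑ e, G.length e with hL
  have hLpos : 0 < L := Finset.sum_pos (fun e _ => G.length_pos e) ⟨e₀, Finset.mem_univ _⟩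
  set I := ∑ e, ∫ x in 0..G.length e, x * (G.length e - x) with hI
  set I₂ := ∑ e, ∫ x in 0..G.length e, (x * (G.length e - x)) ^ 2 with hI₂
  set J := ∑ e, ∫ x in 0..G.length e, (G.length e - 2 * x) ^ 2 with hJ
  have hIpos : 0 < I := by
    refine Finset.sum_pos (fun e _ => ?_) ⟨e₀, Finset.mem_univ _⟩
    refine intervalIntegral.intervalIntegral_pos_of_pos_on
      (Continuous.intervalIntegrable (by fun_prop) _ _) (fun x hx => ?_) (G.length_pos e)
    exact mul_pos hx.1 (by linarith [hx.2])
  have hI₂0 : 0 ≤ I₂ := Finset.sum_nonneg fun e _ =>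
    intervalIntegral.integral_nonneg (G.length_pos e).le fun x _ => sq_nonneg _
  have hJ0 : 0 ≤ J := Finset.sum_nonneg fun e _ =>
    intervalIntegral.integral_nonneg (G.length_pos e).le fun x _ => sq_nonneg _
  have hlim : Filter.Tendsto (fun s : ℝ => 4 * I - s * (I₂ + (2 * I + s * I₂) ^ 2 / (4 * L)
      + J * (2 * L + 2 * s * I + s ^ 2 * I₂) ^ 2)) (nhdsWithin 0 (Ioi 0)) (nhds (4 * I)) := by
    have : Continuous (fun s : ℝ => 4 * I - s * (I₂ + (2 * I + s * I₂) ^ 2 / (4 * L)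
      + J * (2 * L + 2 * s * I + s ^ 2 * I₂) ^ 2)) := by fun_prop
    have h0 := (this.tendsto 0).mono_left (nhdsWithin_le_nhds (s := Ioi 0))
    simpa using h0
  obtain ⟨s, hs, hs0⟩ := ((hlim.eventually (lt_mem_nhds (show 0 < 4 * I by positivity))).and
    self_mem_nhdsWithin).exists
  replace hs0 : 0 < s := hs0
  -- This rate minimizes the denominator (L + 1/(2a))² a/2 among the exponentials; the half-line
  -- then has the same mass as the core.
  obtain ⟨a, ha, haL⟩ : ∃ a, 0 < a ∧ a = 1 / (2 * L) := ⟨_, by positivity, rfl⟩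
  have key := le_coreConst (G.bumpedConst s ha) (s := L + 6 * s * I)
    (m := 2 * L + 2 * s * I + s ^ 2 * I₂) (κ := 1 / (4 * L) + s ^ 2 * J) (by positivity)
    (by positivity) ?_ ?_ ?_
  · refine lt_of_lt_of_le (ENNReal.one_lt_ofReal.2 ?_) key
    rw [one_lt_div (by positivity)]
    have e : (2 * L + 2 * s * I + s ^ 2 * I₂) ^ 2 * (1 / (4 * L) + s ^ 2 * J)
        = L + 6 * s * I - s * (4 * I - s * (I₂ + (2 * I + s * I₂) ^ 2 / (4 * L)
      + J * (2 * L + 2 * s * I + s ^ 2 * I₂) ^ 2)) := by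
      field_simp
      ring
    rw [e]
    have := mul_pos hs0 hs
    linarith
  · rw [H1.totalSix, hL, hI, Finset.mul_sum, ← Finset.sum_add_distrib]
    refine Finset.sum_le_sum fun e _ => ?_
    have hℓ := G.length_pos e
    have e1 : G.length e + 6 * s * ∫ x in 0..G.length e, x * (G.length e - x)
        = ∫ x in 0..G.length e, (1 + 6 * s * (x * (G.length e - x))) := by
      rw [intervalIntegral.integral_add (Continuous.intervalIntegrable (by fun_prop) _ _)
        (Continuous.intervalIntegrable (by fun_prop) _ _), intervalIntegral.integral_const_mul]
      simp
    rw [e1]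
    refine intervalIntegral.integral_mono_on hℓ.le (Continuous.intervalIntegrable (by fun_prop) _ _)
      (Continuous.intervalIntegrable (by simp only [bumpedConst]; fun_prop) _ _) fun x hx => ?_
    have hx0 : 0 ≤ s * (x * (G.length e - x)) :=
      mul_nonneg hs0.le (mul_nonneg hx.1 (by linarith [hx.2]))
    -- Bernoulli's inequality keeps only the first-order term of the sixth power.
    have := one_add_mul_le_pow (a := s * (x * (G.length e - x))) (by linarith) 6
    simp only [bumpedConst]
    push_cast at this
    linarith
  · have h1 : ∑ h, (G.bumpedConst s ha).halfMass h = L := by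
      simp only [H1.halfMass, bumpedConst, (integral_exp_sq ha).2, Finset.sum_const,
        Finset.card_univ, hH, one_smul]
      rw [haL]
      field_simp
    have h2 : ∑ e, (G.bumpedConst s ha).edgeMass e = L + 2 * s * I + s ^ 2 * I₂ := by
      rw [hL, hI, hI₂, Finset.mul_sum, Finset.mul_sum, ← Finset.sum_add_distrib,
        ← Finset.sum_add_distrib]
      refine Finset.sum_congr rfl fun e _ => ?_
      rw [← intervalIntegral.integral_const_mul, ← intervalIntegral.integral_const_mul]
      have e1 : G.length e = ∫ x in 0..G.length e, (1 : ℝ) := by simp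
      nth_rewrite 1 [e1]
      rw [← intervalIntegral.integral_add (Continuous.intervalIntegrable (by fun_prop) _ _)
        (Continuous.intervalIntegrable (by fun_prop) _ _),
        ← intervalIntegral.integral_add (Continuous.intervalIntegrable (by fun_prop) _ _)
        (Continuous.intervalIntegrable (by fun_prop) _ _)]
      refine intervalIntegral.integral_congr fun x _ => ?_
      simp only [bumpedConst]
      ring
    rw [H1.totalMass, h1, h2]
    linarith
  · have h1 : ∑ h, (G.bumpedConst s ha).halfKinetic h = 1 / (4 * L) := by
      simp only [H1.halfKinetic, bumpedConst, (integral_exp_deriv_sq ha).2, Finset.sum_const,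
        Finset.card_univ, hH, one_smul]
      rw [haL]
      field_simp
      norm_num
    have h2 : ∑ e, (G.bumpedConst s ha).edgeKinetic e = s ^ 2 * J := by
      rw [hJ, Finset.mul_sum]
      refine Finset.sum_congr rfl fun e _ => ?_
      rw [← intervalIntegral.integral_const_mul]
      refine intervalIntegral.integral_congr fun x _ => ?_
      simp only [bumpedConst]
      ring
    rw [H1.totalKinetic, h1, h2]
    linarith

end MetricGraph

/-! ### Calibration by the level -/

/-- The area under the circle of radius `B` between `0` and `w`. -/
noncomputable def circleArea (B w : ℝ) : ℝ := ∫ s in 0..w, √(B ^ 2 - s ^ 2)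

theorem hasDerivAt_circleArea (B w : ℝ) : HasDerivAt (circleArea B) (√(B ^ 2 - w ^ 2)) w := by
  have hc : Continuous fun s : ℝ => √(B ^ 2 - s ^ 2) := by fun_prop
  exact (hc.integral_hasStrictDerivAt 0 w).hasDerivAt

theorem circleArea_zero (B : ℝ) : circleArea B 0 = 0 := by simp [circleArea]

theorem circleArea_mono (B : ℝ) : Monotone (circleArea B) :=
  monotone_of_hasDerivAt_nonneg (hasDerivAt_circleArea B) fun _ => Real.sqrt_nonneg _

theorem sqrt_sq_sub_sq_le {B : ℝ} (hB : 0 ≤ B) (w : ℝ) : √(B ^ 2 - w ^ 2) ≤ B := by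
  rw [Real.sqrt_le_left hB]
  nlinarith [sq_nonneg w]

theorem lipschitzWith_circleArea {B : ℝ} (hB : 0 ≤ B) :
    LipschitzWith (Real.toNNReal B) (circleArea B) := by
  refine lipschitzWith_of_nnnorm_deriv_le
    (fun w => (hasDerivAt_circleArea B w).differentiableAt) fun w => ?_
  rw [(hasDerivAt_circleArea B w).deriv, ← NNReal.coe_le_coe, coe_nnnorm, Real.coe_toNNReal _ hB,
    Real.norm_of_nonneg (Real.sqrt_nonneg _)]
  exact sqrt_sq_sub_sq_le hB w

theorem circleArea_le {B w : ℝ} (hB : 0 ≤ B) (hw : 0 ≤ w) : circleArea B w ≤ B * w := by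
  have h := (lipschitzWith_circleArea hB).dist_le_mul w 0
  rw [circleArea_zero, Real.dist_eq, Real.dist_eq, sub_zero, sub_zero, abs_of_nonneg hw,
    Real.coe_toNNReal _ hB] at h
  exact (le_abs_self _).trans h

/-- A quarter of the disc of radius `B`. -/
theorem circleArea_self {B : ℝ} (hB : 0 < B) : circleArea B B = Real.pi * B ^ 2 / 4 := by
  have hc : Continuous fun s : ℝ => √(1 - s ^ 2) := by fun_prop
  have h1 : ∫ s in (0 : ℝ)..1, √(1 - s ^ 2) = Real.pi / 4 := by
    have h2 := integral_sqrt_one_sub_sq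
    rw [← intervalIntegral.integral_add_adjacent_intervals (hc.intervalIntegrable (-1) 0)
      (hc.intervalIntegrable 0 1)] at h2
    have h3 := intervalIntegral.integral_comp_neg (a := (0 : ℝ)) (b := 1)
      fun s : ℝ => √(1 - s ^ 2)
    simp only [neg_sq, neg_zero] at h3
    linarith
  have h4 := intervalIntegral.smul_integral_comp_mul_left (a := (0 : ℝ)) (b := 1)
    (fun s : ℝ => √(B ^ 2 - s ^ 2)) B
  rw [mul_zero, mul_one] at h4
  rw [circleArea, ← h4]
  have h5 : ∀ s : ℝ, √(B ^ 2 - (B * s) ^ 2) = B * √(1 - s ^ 2) := fun s => by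
    rw [show B ^ 2 - (B * s) ^ 2 = B ^ 2 * (1 - s ^ 2) by ring, Real.sqrt_mul (sq_nonneg B),
      Real.sqrt_sq hB.le]
  simp only [h5, intervalIntegral.integral_const_mul, h1, smul_eq_mul]
  ring

/-- The derivative of `s * circleArea B (u²)` is at most `u'² + s² u² (B² - u⁴)₊`. -/
theorem SobolevOn.level_calibration {u g q : ℝ → ℝ} {a b B : ℝ} (h : SobolevOn u g a b)
    (hB : 0 ≤ B) (s : ℝ) (hq : IntervalIntegrable q volume a b)
    (hle : ∀ x ∈ Ioo a b, u x ^ 2 * √(B ^ 2 - (u x ^ 2) ^ 2) ^ 2 ≤ q x) :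
    s * (circleArea B (u b ^ 2) - circleArea B (u a ^ 2))
      ≤ (∫ x in a..b, g x ^ 2) + s ^ 2 * ∫ x in a..b, q x := by
  have hac2 := h.absolutelyContinuous.fun_mul h.absolutelyContinuous
  have hac := (AbsolutelyContinuousOnInterval.lipschitzOnWith_comp
    ((lipschitzWith_circleArea hB).lipschitzOnWith (s := univ)) hac2
    (mapsTo_univ _ _)).const_mul s
  have key := hac.sub_le_integral h.le
    (f' := fun x => s * (√(B ^ 2 - (u x ^ 2) ^ 2) * (2 * u x * g x)))
    (r := fun x => g x ^ 2 + s ^ 2 * q x) ?_ (h.intervalIntegrable_sq.add (hq.const_mul _)) ?_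
  · rw [intervalIntegral.integral_add h.intervalIntegrable_sq (hq.const_mul _),
      intervalIntegral.integral_const_mul] at key
    refine le_trans (le_of_eq ?_) key
    simp only [sq]
    ring
  · filter_upwards [h.ae_hasDerivAt] with x hx hxI
    have hu := hx hxI
    have h1 := ((hasDerivAt_circleArea B _).comp x (hu.mul hu)).const_mul s
    refine h1.congr_deriv ?_
    simp only [Pi.mul_apply, sq]
    ring
  · intro x hx
    have h1 := hle x hx
    -- Completing the square in `u'`. Above the level `B` the square root of a negative number is 0,
    -- which provides the positive part.
    have h2 := sq_nonneg (g x - s * (√(B ^ 2 - (u x ^ 2) ^ 2) * u x))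
    have h3 := mul_le_mul_of_nonneg_left h1 (sq_nonneg s)
    nlinarith

/-- The form used on the core: below the level `B` the root is not truncated, and the price u²(B² -
u⁴) integrates to B² times the mass minus the sixth power. -/
theorem SobolevOn.level_calibration_of_le {u g : ℝ → ℝ} {a b B : ℝ} (h : SobolevOn u g a b)
    (hB : 0 ≤ B) (hu : ∀ x ∈ Icc a b, u x ^ 2 ≤ B) (s : ℝ) :
    s * (circleArea B (u b ^ 2) - circleArea B (u a ^ 2))
      ≤ (∫ x in a..b, g x ^ 2)
        + s ^ 2 * (B ^ 2 * (∫ x in a..b, u x ^ 2) - ∫ x in a..b, u x ^ 6) := by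
  have key := h.level_calibration hB s (q := fun x => B ^ 2 * u x ^ 2 - u x ^ 6)
    (((h.intervalIntegrable_pow 2).const_mul _).sub (h.intervalIntegrable_pow 6)) ?_
  · rwa [intervalIntegral.integral_sub ((h.intervalIntegrable_pow 2).const_mul _)
      (h.intervalIntegrable_pow 6), intervalIntegral.integral_const_mul] at key
  · intro x hx
    have h1 := hu x (Ioo_subset_Icc_self hx)
    rw [Real.sq_sqrt (by nlinarith [sq_nonneg (u x)])]
    exact le_of_eq (by ring)

/-- On a half-line `u²` may exceed `B`, and the sixth power is not counted there; (B² - u⁴)₊ is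
therefore bounded by B². The value at infinity drops out along points where `u` is small. -/
theorem halfLine_level_calibration {u g : ℝ → ℝ} (h : ∀ X, 0 ≤ X → SobolevOn u g 0 X)
    (hu2 : IntegrableOn (fun x => u x ^ 2) (Ici 0)) (hg2 : IntegrableOn (fun x => g x ^ 2) (Ici 0))
    {B s : ℝ} (hB : 0 ≤ B) (hs : 0 ≤ s) :
    s * circleArea B (u 0 ^ 2)
      ≤ (∫ x in Ici 0, g x ^ 2) + s ^ 2 * (B ^ 2 * ∫ x in Ici 0, u x ^ 2) := by
  refine le_of_forall_pos_le_add fun η hη => ?_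
  obtain ⟨Y, hY0, hY⟩ := exists_sq_lt_of_integrableOn_Ici hu2
    (show 0 < η / (s * B + 1) by positivity) le_rfl
  have hS := h Y hY0
  have key := hS.level_calibration hB (-s) (q := fun x => B ^ 2 * u x ^ 2)
    ((hS.intervalIntegrable_pow 2).const_mul _) fun x _ => by
      have h1 := sqrt_sq_sub_sq_le hB (u x ^ 2)
      have h2 := Real.sqrt_nonneg (B ^ 2 - (u x ^ 2) ^ 2)
      rw [mul_comm]
      gcongr
  rw [intervalIntegral.integral_const_mul] at key
  have h1 := intervalIntegral_le_setIntegral_Ici hu2 (fun x => sq_nonneg _) hY0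
  have h2 := intervalIntegral_le_setIntegral_Ici hg2 (fun x => sq_nonneg _) hY0
  have h3 : s ^ 2 * (B ^ 2 * ∫ x in 0..Y, u x ^ 2) ≤ s ^ 2 * (B ^ 2 * ∫ x in Ici 0, u x ^ 2) := by
    gcongr
  have h4 : s * circleArea B (u Y ^ 2) ≤ η := by
    calc s * circleArea B (u Y ^ 2) ≤ s * (B * u Y ^ 2) := by
          gcongr; exact circleArea_le hB (sq_nonneg _)
      _ ≤ (s * B + 1) * u Y ^ 2 := by nlinarith [sq_nonneg (u Y)]
      _ ≤ (s * B + 1) * (η / (s * B + 1)) := by gcongr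
      _ = η := by field_simp
  rw [neg_sq] at key
  linarith

/-! ### Cuts in graphs with a cycle covering -/

theorem intervalIntegral_indicator_lt {a F : ℝ} (h0 : 0 ≤ a) (haF : a ≤ F) :
    ∫ t in 0..F, (if t < a then (1 : ℝ) else 0) = a := by
  have h1 : ∫ t in 0..a, (if t < a then (1 : ℝ) else 0) = a := by
    rw [intervalIntegral.integral_congr_ae (g := fun _ => (1 : ℝ))]
    · simp
    · filter_upwards [compl_mem_ae_iff.2 (measure_singleton a)] with t ht htI
      rw [uIoc_of_le h0] at htI
      exact if_pos (lt_of_le_of_ne htI.2 ht)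
  have h2 : ∫ t in a..F, (if t < a then (1 : ℝ) else 0) = 0 := by
    rw [intervalIntegral.integral_congr (g := fun _ => (0 : ℝ))]
    · simp
    · intro t ht
      rw [uIcc_of_le haF] at ht
      exact if_neg (not_lt.2 ht.1)
  have hanti : Antitone fun t : ℝ => if t < a then (1 : ℝ) else 0 := by
    intro x y hxy
    beta_reduce
    split_ifs <;> linarith
  rw [← intervalIntegral.integral_add_adjacent_intervals
    (hanti.intervalIntegrable (a := 0) (b := a)) (hanti.intervalIntegrable (a := a) (b := F)),
    h1, h2, add_zero]

theorem intervalIntegrable_indicator_lt (a F : ℝ) :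
    IntervalIntegrable (fun t : ℝ => if t < a then (1 : ℝ) else 0) volume 0 F := by
  refine Antitone.intervalIntegrable fun x y hxy => ?_
  split_ifs <;> linarith

/-- The layer-cake formula for a difference: the levels `t` separating `a` from `b` have total
length `|a - b|`. -/
theorem intervalIntegral_abs_sub_indicator {a b F : ℝ} (ha : 0 ≤ a) (haF : a ≤ F) (hb : 0 ≤ b)
    (hbF : b ≤ F) :
    ∫ t in 0..F, |(if t < a then (1 : ℝ) else 0) - (if t < b then (1 : ℝ) else 0)| = |a - b| := by
  wlog hab : a ≤ b generalizing a b
  · rw [abs_sub_comm a b, ← this hb hbF ha haF (le_of_not_ge hab)]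
    exact intervalIntegral.integral_congr fun t _ => abs_sub_comm _ _
  rw [abs_sub_comm, abs_of_nonneg (sub_nonneg.2 hab), ← intervalIntegral_indicator_lt ha haF,
    ← intervalIntegral_indicator_lt hb hbF, ← intervalIntegral.integral_sub
    (intervalIntegrable_indicator_lt _ _) (intervalIntegrable_indicator_lt _ _),
    intervalIntegral_indicator_lt ha haF, intervalIntegral_indicator_lt hb hbF]
  refine intervalIntegral.integral_congr fun t _ => ?_
  split_ifs <;> first | (exfalso; linarith) | norm_num

namespace MetricGraph

variable {V E H : Type*} {G : MetricGraph V E H}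

open Classical in
/-- The characteristic function of `U`. -/
noncomputable def chi (U : Set V) (v : V) : ℕ := if v ∈ U then 1 else 0

open Classical in
/-- `1` if exactly one endpoint of the bounded edge `e` belongs to `U`, and `0` otherwise. -/
noncomputable def crossing (G : MetricGraph V E H) (U : Set V) (e : E) : ℕ :=
  if (G.src e ∈ U ↔ G.tgt e ∈ U) then 0 else 1

theorem crossing_add_chi (U : Set V) {e : E} {v w : V} (h : G.Joins e v w) :
    (G.crossing U e + chi U v + chi U w) % 2 = 0 := by
  rcases h with ⟨rfl, rfl⟩ | ⟨rfl, rfl⟩ <;> unfold crossing chi <;> split_ifs <;>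
    first | rfl | tauto

/-- The parity of the crossings records whether the two ends lie on the same side, so a closed path
crosses a cut an even number of times. -/
theorem IsPath.sum_crossing (U : Set V) {es : List E} {v w : V} (h : G.IsPath v es w) :
    ((es.map (G.crossing U)).sum + chi U v + chi U w) % 2 = 0 := by
  induction es generalizing v with
  | nil =>
    obtain rfl : v = w := h
    simp only [List.map_nil, List.sum_nil]
    omega
  | cons e es ih =>
    obtain ⟨x, hx, hp⟩ := h
    have h1 := ih hp
    have h2 := crossing_add_chi U hx
    rw [List.map_cons, List.sum_cons]
    omega

theorem exists_crossing_of_reflTransGen (U : Set V) {v w : V}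
    (h : Relation.ReflTransGen (fun a b => ∃ e, G.Joins e a b) v w) (hv : v ∈ U) (hw : w ∉ U) :
    ∃ e, G.crossing U e = 1 := by
  by_contra! hcon
  refine hw ?_
  induction h with
  | refl => exact hv
  | @tail b c _ hbc ih =>
    by_contra hc
    obtain ⟨e, he⟩ := hbc
    have h1 := crossing_add_chi U he
    have hb : b ∈ U := by
      by_contra hb
      exact hb (ih hb)
    have h2 : chi U b = 1 := if_pos hb
    have h3 : chi U c = 0 := if_neg hc
    have h4 : G.crossing U e ≤ 1 := by unfold crossing; split_ifs <;> norm_num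
    have := hcon e
    omega

theorem sum_crossing_list_le [Fintype E] (U : Set V) {es : List E} (hnd : es.Nodup) :
    (es.map (G.crossing U)).sum ≤ ∑ e, G.crossing U e := by
  classical
  rw [← List.sum_toFinset _ hnd]
  exact Finset.sum_le_univ_sum_of_nonneg fun _ => Nat.zero_le _

theorem H1.exists_core_max [Fintype E] (hG : G.Admissible) (u : G.H1) :
    ∃ e₀, ∃ x₀ ∈ Icc 0 (G.length e₀), ∀ e, ∀ x ∈ Icc 0 (G.length e),
      u.onEdge e x ^ 2 ≤ u.onEdge e₀ x₀ ^ 2 := by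
  have h1 : ∀ e, ∃ x₀ ∈ Icc 0 (G.length e), ∀ x ∈ Icc 0 (G.length e),
      u.onEdge e x ^ 2 ≤ u.onEdge e x₀ ^ 2 := fun e =>
    isCompact_Icc.exists_isMaxOn ⟨0, le_rfl, (G.length_pos e).le⟩
      ((u.sobolevOn_edge e).continuousOn.pow 2)
  choose m hm hmax using h1
  have := hG.core_nonempty
  obtain ⟨e₀, he₀⟩ := Finite.exists_max fun e => u.onEdge e (m e) ^ 2
  exact ⟨e₀, m e₀, hm e₀, fun e x hx => (hmax e x hx).trans (he₀ e)⟩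

theorem H1.edgeSix_le (u : G.H1) {B : ℝ} {e : E}
    (hB : ∀ x ∈ Icc 0 (G.length e), u.onEdge e x ^ 2 ≤ B) :
    u.edgeSix e ≤ B ^ 2 * u.edgeMass e := by
  have h := u.sobolevOn_edge e
  rw [H1.edgeSix, H1.edgeMass, ← intervalIntegral.integral_const_mul]
  refine intervalIntegral.integral_mono_on h.le (h.intervalIntegrable_pow 6)
    ((h.intervalIntegrable_pow 2).const_mul _) fun x hx => ?_
  have h1 := hB x hx
  have h2 := sq_nonneg (u.onEdge e x)
  rw [show u.onEdge e x ^ 6 = (u.onEdge e x ^ 2) ^ 2 * u.onEdge e x ^ 2 by ring]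
  gcongr

variable [Fintype E] [Fintype H]

/-- In a graph with a cycle covering at least two edges leave a nonempty set of vertices. -/
theorem two_le_cut (hG : G.Admissible) (hC : G.HasCycleCovering) {U : Set V} (hU : U.Nonempty) :
    2 ≤ ∑ e, G.crossing U e + ∑ h, chi U (G.origin h) := by
  classical
  obtain ⟨v, hv⟩ := hU
  obtain ⟨h₀⟩ := hG.noncompact
  -- The end of a half-line at infinity lies outside `U`, so some edge leaves `U`. The cycle through
  -- that edge then provides a second one, by parity.
  have hex : (∃ e, G.crossing U e = 1) ∨ ∃ h, chi U (G.origin h) = 1 := by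
    by_cases ho : G.origin h₀ ∈ U
    · exact Or.inr ⟨h₀, if_pos ho⟩
    · exact Or.inl (exists_crossing_of_reflTransGen U (hG.connected v _) hv ho)
  have hmem : ∀ {es : List E} {e : E}, e ∈ es → G.crossing U e = 1 →
      1 ≤ (es.map (G.crossing U)).sum := fun he h1 =>
    h1 ▸ List.single_le_sum (fun _ _ => Nat.zero_le _) _ (List.mem_map_of_mem he)
  have hpair : ∀ {h₁ h₂ : H}, h₁ ≠ h₂ →
      chi U (G.origin h₁) + chi U (G.origin h₂) ≤ ∑ h, chi U (G.origin h) := fun {h₁ h₂} hne => by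
    rw [← Finset.sum_pair (f := fun h => chi U (G.origin h)) hne]
    exact Finset.sum_le_univ_sum_of_nonneg fun _ => Nat.zero_le _
  obtain ⟨c, hc⟩ : ∃ c : E ⊕ H, (∀ e, c = Sum.inl e → G.crossing U e = 1) ∧
      ∀ h, c = Sum.inr h → chi U (G.origin h) = 1 := by
    rcases hex with ⟨e, he⟩ | ⟨h, hh⟩
    · exact ⟨Sum.inl e, fun e' h => by rw [← Sum.inl.inj h, he], fun h' h => by simp at h⟩
    · exact ⟨Sum.inr h, fun e' h => by simp at h, fun h' h => by rw [← Sum.inr.inj h, hh]⟩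
  obtain ⟨S, hS, hcS⟩ := hC c
  cases hS with
  | loop v es hne hnd hp =>
    obtain ⟨e, he, rfl⟩ := hcS
    have h1 := hmem he (hc.1 e rfl)
    have h2 := hp.sum_crossing U
    have h3 := sum_crossing_list_le (G := G) U hnd
    omega
  | unbounded h₁ h₂ hh es hnd hp =>
    have h2 := hp.sum_crossing U
    have h3 := sum_crossing_list_le (G := G) U hnd
    have h4 := hpair hh
    rcases hcS with ⟨e, he, rfl⟩ | hcS
    · have h1 := hmem he (hc.1 e rfl)
      omega
    · rcases hcS with rfl | rfl
      · have h1 := hc.2 h₁ rfl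
        omega
      · have h1 := hc.2 h₂ rfl
        omega

/-- Both sides are integrals over the levels `t` in `[0, F]`. At each level the integrand on the
right counts the edges leaving `{f > t}`, which are at least two if this set is nonempty. The edge
`e₀` stands for the one containing the maximum `F`: it is cut inside, so its two halves are counted
separately and contribute 2 when the set is empty. -/
theorem two_mul_le_total_variation [DecidableEq E] (hG : G.Admissible) (hC : G.HasCycleCovering)
    (e₀ : E) {F : ℝ} (f : V → ℝ) (hf0 : ∀ v, 0 ≤ f v) (hfF : ∀ v, f v ≤ F) :
    2 * F ≤ ∑ e ∈ Finset.univ.erase e₀, |f (G.src e) - f (G.tgt e)|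
      + ((F - f (G.src e₀)) + (F - f (G.tgt e₀))) + ∑ h, f (G.origin h) := by
  have hF : 0 ≤ F := (hf0 (G.src e₀)).trans (hfF _)
  let I : V → ℝ → ℝ := fun v t => if t < f v then 1 else 0
  have hI : ∀ v, IntervalIntegrable (I v) volume 0 F := fun v =>
    intervalIntegrable_indicator_lt _ _
  have hIv : ∀ v, ∫ t in 0..F, I v t = f v := fun v =>
    intervalIntegral_indicator_lt (hf0 v) (hfF v)
  have hIabs : ∀ v w, ∫ t in 0..F, |I v t - I w t| = |f v - f w| := fun v w =>
    intervalIntegral_abs_sub_indicator (hf0 v) (hfF v) (hf0 w) (hfF w)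
  have hIabs' : ∀ v w, IntervalIntegrable (fun t => |I v t - I w t|) volume 0 F := fun v w =>
    ((hI v).sub (hI w)).abs
  have hc : IntervalIntegrable (fun _ : ℝ => (1 : ℝ)) volume 0 F := intervalIntegrable_const
  have hone : ∀ v, IntervalIntegrable (fun t => 1 - I v t) volume 0 F := fun v => hc.sub (hI v)
  have honev : ∀ v, ∫ t in 0..F, (1 - I v t) = F - f v := fun v => by
    rw [intervalIntegral.integral_sub hc (hI v), hIv]
    simp
  have hs1 : IntervalIntegrable
      (fun t => ∑ e ∈ Finset.univ.erase e₀, |I (G.src e) t - I (G.tgt e) t|) volume 0 F :=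
    by simpa only [Finset.sum_fn] using
      IntervalIntegrable.sum (Finset.univ.erase e₀) fun e _ => hIabs' (G.src e) (G.tgt e)
  have hs2 : IntervalIntegrable (fun t => (1 - I (G.src e₀) t) + (1 - I (G.tgt e₀) t))
      volume 0 F := (hone _).add (hone _)
  have hs3 : IntervalIntegrable (fun t => ∑ h, I (G.origin h) t) volume 0 F :=
    by simpa only [Finset.sum_fn] using
      IntervalIntegrable.sum Finset.univ fun h _ => hI (G.origin h)
  have key : ∫ t in 0..F, (2 : ℝ) ≤ ∫ t in 0..F,
      (∑ e ∈ Finset.univ.erase e₀, |I (G.src e) t - I (G.tgt e) t|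
        + ((1 - I (G.src e₀) t) + (1 - I (G.tgt e₀) t)) + ∑ h, I (G.origin h) t) := by
    refine intervalIntegral.integral_mono_on hF intervalIntegrable_const
      ((hs1.add hs2).add hs3) fun t _ => ?_
    set U : Set V := {v | t < f v} with hU
    have hchi : ∀ v, I v t = (chi U v : ℝ) := fun v => by
      simp only [I, chi, hU, mem_ofPred_eq]
      split_ifs <;> simp
    have hcr : ∀ e, |I (G.src e) t - I (G.tgt e) t| = (G.crossing U e : ℝ) := fun e => by
      simp only [I, crossing, hU, mem_ofPred_eq]
      split_ifs <;> first | (exfalso; tauto) | simp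
    simp only [hcr]
    rcases U.eq_empty_or_nonempty with hemp | hne
    · have h0 : ∀ v, I v t = 0 := fun v => by rw [hchi, chi, hemp]; simp
      simp only [h0]
      have : (0 : ℝ) ≤ ∑ e ∈ Finset.univ.erase e₀, (G.crossing U e : ℝ) :=
        Finset.sum_nonneg fun _ _ => Nat.cast_nonneg _
      simp only [Finset.sum_const_zero]
      linarith
    · have h2 := two_le_cut hG hC hne
      have h3 : (2 : ℝ) ≤ ∑ e, (G.crossing U e : ℝ) + ∑ h, (chi U (G.origin h) : ℝ) := by
        exact_mod_cast h2
      rw [← Finset.sum_erase_add _ _ (Finset.mem_univ e₀), ← hcr e₀] at h3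
      have h4 : |I (G.src e₀) t - I (G.tgt e₀) t|
          ≤ (1 - I (G.src e₀) t) + (1 - I (G.tgt e₀) t) := by
        simp only [I]
        split_ifs <;> norm_num
      simp only [hchi] at h3 h4 ⊢
      linarith
  rw [intervalIntegral.integral_add (hs1.add hs2) hs3, intervalIntegral.integral_add hs1 hs2,
    intervalIntegral.integral_add (hone _) (hone _), intervalIntegral.integral_finsetSum
    (fun e _ => hIabs' _ _), intervalIntegral.integral_finsetSum (fun h _ => hI _)] at key
  simp only [hIv, hIabs, honev, intervalIntegral.integral_const, sub_zero, smul_eq_mul] at key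
  linarith

/-! ### The inequality under a cycle covering -/

theorem H1.totalSix_le (u : G.H1) {B : ℝ}
    (hB : ∀ e, ∀ x ∈ Icc 0 (G.length e), u.onEdge e x ^ 2 ≤ B) :
    u.totalSix ≤ B ^ 2 * u.totalMass := by
  have h1 : u.totalSix ≤ ∑ e, B ^ 2 * u.edgeMass e :=
    Finset.sum_le_sum fun e _ => u.edgeSix_le (hB e)
  have h2 : 0 ≤ B ^ 2 * ∑ h, u.halfMass h :=
    mul_nonneg (sq_nonneg _) (Finset.sum_nonneg fun _ _ => u.halfMass_nonneg _)
  rw [← Finset.mul_sum] at h1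
  rw [H1.totalMass]
  linarith

theorem H1.totalSix_le_of_hasCycleCovering (hG : G.Admissible) (hC : G.HasCycleCovering)
    (u : G.H1) : u.totalSix ≤ 4 / Real.pi ^ 2 * (u.totalMass ^ 2 * u.totalKinetic) := by
  classical
  obtain ⟨e₀, x₀, hx₀, hmax⟩ := u.exists_core_max hG
  set B := u.onEdge e₀ x₀ ^ 2 with hBdef
  have hB0 : 0 ≤ B := sq_nonneg _
  have hpi := Real.pi_pos
  have hSM := u.totalSix_le hmax
  rcases u.totalMass_nonneg.eq_or_lt with hM | hM
  · rw [← hM] at hSM ⊢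
    simpa using hSM
  rcases hB0.eq_or_lt with hB | hB
  · rw [← hB] at hSM
    have := u.totalKinetic_nonneg
    have : 0 ≤ 4 / Real.pi ^ 2 * (u.totalMass ^ 2 * u.totalKinetic) := by positivity
    simp at hSM
    linarith
  set f : V → ℝ := fun v => circleArea B (u.atVertex v ^ 2) with hf
  have hvB : ∀ v, u.atVertex v ^ 2 ≤ B := by
    intro v
    obtain ⟨e, rfl | rfl⟩ := hG.exists_incident v
    · rw [← u.edge_src]
      exact hmax e 0 ⟨le_rfl, (G.length_pos e).le⟩
    · rw [← u.edge_tgt]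
      exact hmax e _ ⟨(G.length_pos e).le, le_rfl⟩
  have hf0 : ∀ v, 0 ≤ f v := fun v => by
    rw [← circleArea_zero B]
    exact circleArea_mono B (sq_nonneg _)
  have hfF : ∀ v, f v ≤ circleArea B B := fun v => circleArea_mono B (hvB v)
  have hTV := two_mul_le_total_variation hG hC e₀ f hf0 hfF
  -- With this `s` the boundary gain `s · 2 · πB²/4` equals the price `s² B² M`; what is left is `s²
  -- S ≤ K`, where `S` is the sixth power, `M` the mass and `K` the kinetic term.
  set s := Real.pi / (2 * u.totalMass) with hs
  have hs0 : 0 < s := by positivity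
  have hedge : ∀ e, s * |f (G.src e) - f (G.tgt e)|
      ≤ u.edgeKinetic e + s ^ 2 * (B ^ 2 * u.edgeMass e - u.edgeSix e) := by
    intro e
    have h1 := (u.sobolevOn_edge e).level_calibration_of_le hB0 (hmax e) s
    have h2 := (u.sobolevOn_edge e).level_calibration_of_le hB0 (hmax e) (-s)
    rw [u.edge_src, u.edge_tgt] at h1 h2
    rw [neg_sq] at h2
    rcases abs_cases (f (G.src e) - f (G.tgt e)) with ⟨h, -⟩ | ⟨h, -⟩ <;> rw [h] <;>
      simp only [H1.edgeKinetic, H1.edgeMass, H1.edgeSix, hf] <;> linarith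
  -- The edge is cut at its maximum point and calibrated upwards on the left and downwards on the
  -- right.
  have hedge₀ : s * ((circleArea B B - f (G.src e₀)) + (circleArea B B - f (G.tgt e₀)))
      ≤ u.edgeKinetic e₀ + s ^ 2 * (B ^ 2 * u.edgeMass e₀ - u.edgeSix e₀) := by
    have hS := u.sobolevOn_edge e₀
    have hl := hS.mono le_rfl hx₀.1 hx₀.2
    have hr := hS.mono hx₀.1 hx₀.2 le_rfl
    have h1 := hl.level_calibration_of_le hB0
      (fun x hx => hmax e₀ x ⟨hx.1, hx.2.trans hx₀.2⟩) s
    have h2 := hr.level_calibration_of_le hB0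
      (fun x hx => hmax e₀ x ⟨hx₀.1.trans hx.1, hx.2⟩) (-s)
    rw [u.edge_src, ← hBdef] at h1
    rw [u.edge_tgt, ← hBdef, neg_sq] at h2
    have a1 := intervalIntegral.integral_add_adjacent_intervals hl.intervalIntegrable_sq
      hr.intervalIntegrable_sq
    have a2 := intervalIntegral.integral_add_adjacent_intervals (hl.intervalIntegrable_pow 2)
      (hr.intervalIntegrable_pow 2)
    have a3 := intervalIntegral.integral_add_adjacent_intervals (hl.intervalIntegrable_pow 6)
      (hr.intervalIntegrable_pow 6)
    simp only [H1.edgeKinetic, H1.edgeMass, H1.edgeSix, hf]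
    rw [← a1, ← a2, ← a3]
    linarith
  have hhalf : ∀ h, s * f (G.origin h) ≤ u.halfKinetic h + s ^ 2 * (B ^ 2 * u.halfMass h) := by
    intro h
    have h1 := halfLine_level_calibration (u.sobolevOn_half h) (u.isH1On_half h).integrableOn_sq
      (u.isH1On_half h).integrableOn_deriv_sq hB0 hs0.le
    rw [u.half_origin] at h1
    exact h1
  have t1 : s * ∑ e ∈ Finset.univ.erase e₀, |f (G.src e) - f (G.tgt e)|
      ≤ ∑ e ∈ Finset.univ.erase e₀,
        (u.edgeKinetic e + s ^ 2 * (B ^ 2 * u.edgeMass e - u.edgeSix e)) := by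
    rw [Finset.mul_sum]
    exact Finset.sum_le_sum fun e _ => hedge e
  have t2 : s * ∑ h, f (G.origin h)
      ≤ ∑ h, (u.halfKinetic h + s ^ 2 * (B ^ 2 * u.halfMass h)) := by
    rw [Finset.mul_sum]
    exact Finset.sum_le_sum fun h _ => hhalf h
  have t3 : ∑ e, (u.edgeKinetic e + s ^ 2 * (B ^ 2 * u.edgeMass e - u.edgeSix e))
      + ∑ h, (u.halfKinetic h + s ^ 2 * (B ^ 2 * u.halfMass h))
      = u.totalKinetic + s ^ 2 * (B ^ 2 * u.totalMass - u.totalSix) := by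
    simp only [H1.totalKinetic, H1.totalMass, H1.totalSix, Finset.sum_add_distrib,
      Finset.sum_sub_distrib, ← Finset.mul_sum]
    ring
  rw [← Finset.sum_erase_add _ _ (Finset.mem_univ e₀)] at t3
  have t4 := mul_le_mul_of_nonneg_left hTV hs0.le
  rw [circleArea_self hB] at t4 hedge₀
  have t5 : s * (2 * (Real.pi * B ^ 2 / 4))
      ≤ u.totalKinetic + s ^ 2 * (B ^ 2 * u.totalMass - u.totalSix) := by
    linarith
  have t6 : s * (2 * (Real.pi * B ^ 2 / 4)) = s ^ 2 * (B ^ 2 * u.totalMass) := by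
    rw [hs]
    field_simp
    ring
  have t7 : s ^ 2 * u.totalSix ≤ u.totalKinetic := by linarith
  rw [hs, div_pow, div_mul_eq_mul_div, div_le_iff₀ (by positivity)] at t7
  rw [div_mul_eq_mul_div, le_div_iff₀ (by positivity)]
  linarith

end MetricGraph

/-! ### Paths -/

namespace MetricGraph

variable {V E H : Type*} {G : MetricGraph V E H}

theorem Joins.symm {e : E} {v w : V} (h : G.Joins e v w) : G.Joins e w v := Or.symm h

theorem Joins.eq_or_eq {e : E} {v w x : V} (h : G.Joins e v w) (hx : G.Incident (Sum.inl e) x) :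
    x = v ∨ x = w := by
  rcases h with ⟨rfl, rfl⟩ | ⟨rfl, rfl⟩ <;> rcases hx with rfl | rfl <;> simp

theorem Joins.incident_left {e : E} {v w : V} (h : G.Joins e v w) :
    G.Incident (Sum.inl e) v := by
  rcases h with ⟨rfl, rfl⟩ | ⟨rfl, rfl⟩
  · exact Or.inl rfl
  · exact Or.inr rfl

theorem isPath_append {l₁ l₂ : List E} {v w : V} :
    G.IsPath v (l₁ ++ l₂) w ↔ ∃ x, G.IsPath v l₁ x ∧ G.IsPath x l₂ w := by
  induction l₁ generalizing v with
  | nil => exact ⟨fun h => ⟨v, rfl, h⟩, fun ⟨x, hx, h⟩ => by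
      obtain rfl : v = x := hx
      exact h⟩
  | cons e l ih =>
    constructor
    · rintro ⟨y, hy, h⟩
      obtain ⟨x, h1, h2⟩ := ih.1 h
      exact ⟨x, ⟨y, hy, h1⟩, h2⟩
    · rintro ⟨x, ⟨y, hy, h1⟩, h2⟩
      exact ⟨y, hy, ih.2 ⟨x, h1, h2⟩⟩

/-- If the first edge is met again later, the path can start there instead: either with that second
passage, if it leaves from `v`, or just after it, if it ends at `v`. -/
theorem IsPath.exists_nodup {es : List E} {v w : V} (h : G.IsPath v es w) :
    ∃ es', G.IsPath v es' w ∧ es'.Nodup ∧ es' ⊆ es := by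
  induction es generalizing v with
  | nil => exact ⟨[], h, List.nodup_nil, List.Subset.refl _⟩
  | cons e es ih =>
    obtain ⟨x, hx, hp⟩ := h
    obtain ⟨es', hp', hnd, hsub⟩ := ih hp
    by_cases he : e ∈ es'
    · obtain ⟨l₁, l₂, rfl⟩ := List.append_of_mem he
      obtain ⟨y, -, z, hz, h2⟩ := isPath_append.1 hp'
      have hnd2 : (e :: l₂).Nodup := (List.nodup_append.1 hnd).2.1
      have hsub2 : e :: l₂ ⊆ e :: es := fun f hf =>
        List.mem_cons_of_mem _ (hsub (List.mem_append_right _ hf))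
      rcases hx.eq_or_eq hz.incident_left with rfl | rfl
      · exact ⟨e :: l₂, ⟨z, hz, h2⟩, hnd2, hsub2⟩
      · rcases hz.eq_or_eq hx.incident_left with rfl | rfl
        · exact ⟨e :: l₂, ⟨z, hz, h2⟩, hnd2, hsub2⟩
        · exact ⟨l₂, h2, (List.nodup_cons.1 hnd2).2, fun f hf =>
            hsub2 (List.mem_cons_of_mem _ hf)⟩
    · exact ⟨e :: es', ⟨x, hx, hp'⟩, List.nodup_cons.2 ⟨he, hnd⟩, List.cons_subset_cons _ hsub⟩

/-- A path into the set `T`, stopped at its first vertex in `T`. -/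
theorem exists_isPath_first_hit (T : Set V) {v w : V}
    (h : Relation.ReflTransGen (fun a b => ∃ e, G.Joins e a b) v w) (hw : w ∈ T) :
    ∃ a ∈ T, ∃ es, G.IsPath v es a ∧
      (∀ f ∈ es, (∃ y ∉ T, G.Incident (Sum.inl f) y) ∧
        ∀ x ∈ T, G.Incident (Sum.inl f) x → x = a) ∧ (v ∈ T → es = []) := by
  induction h using Relation.ReflTransGen.head_induction_on with
  | refl => exact ⟨w, hw, [], rfl, by simp, fun _ => rfl⟩
  | @head v c hvc _ ih =>
    by_cases hv : v ∈ T
    · exact ⟨v, hv, [], rfl, by simp, fun _ => rfl⟩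
    · obtain ⟨e, he⟩ := hvc
      obtain ⟨a, haT, es, hp, hes, hnil⟩ := ih
      refine ⟨a, haT, e :: es, ⟨c, he, hp⟩, ?_, fun h => absurd h hv⟩
      intro f hf
      rcases List.mem_cons.1 hf with rfl | hf
      · refine ⟨⟨v, hv, he.incident_left⟩, fun x hxT hx => ?_⟩
        rcases he.eq_or_eq hx with rfl | rfl
        · exact absurd hxT hv
        · have h1 := hnil hxT
          subst h1
          exact hp
      · exact hes f hf

/-- From every half-line there is a path to an endpoint `a` of `e₀` which avoids `e₀` and which
meets the other endpoint only if it is `a`. -/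
theorem exists_isPath_to_edge (hG : G.Admissible) (h : H) (e₀ : E) :
    ∃ a b, G.Joins e₀ a b ∧ ∃ es : List E, G.IsPath (G.origin h) es a ∧ es.Nodup ∧ e₀ ∉ es ∧
      (∀ f ∈ es, G.Incident (Sum.inl f) b → b = a) ∧ (G.origin h = b → b = a) := by
  obtain ⟨a, haT, es, hp, hes, hnil⟩ := exists_isPath_first_hit {x | G.Incident (Sum.inl e₀) x}
    (hG.connected (G.origin h) (G.src e₀)) (Or.inl rfl)
  obtain ⟨b, hab⟩ : ∃ b, G.Joins e₀ a b := by
    rcases haT with rfl | rfl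
    · exact ⟨_, Or.inl ⟨rfl, rfl⟩⟩
    · exact ⟨_, Or.inr ⟨rfl, rfl⟩⟩
  obtain ⟨es', hp', hnd, hsub⟩ := hp.exists_nodup
  refine ⟨a, b, hab, es', hp', hnd, fun he => ?_, fun f hf hb => ?_, fun hb => ?_⟩
  -- Edges of the path have an endpoint off `e₀`, so `e₀` is not one of them.
  · obtain ⟨⟨y, hy, hy'⟩, -⟩ := hes e₀ (hsub he)
    exact hy hy'
  · exact (hes f (hsub hf)).2 b hab.symm.incident_left hb
  · have h1 := hnil (by rw [hb]; exact hab.symm.incident_left)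
    subst h1
    rw [← hb]
    exact hp

/-- Without terminal edges one can leave an edge which is not a loop at its end. -/
theorem exists_exit [Finite E] [Finite H] (hT : ¬ G.HasTerminalEdge) {e₀ : E} {a b : V}
    (hab : G.Joins e₀ a b) (hne : b ≠ a) :
    (∃ f, f ≠ e₀ ∧ G.Incident (Sum.inl f) b) ∨ ∃ h, G.origin h = b := by
  by_contra! hcon
  obtain ⟨hf, hh⟩ := hcon
  refine hT ⟨Sum.inl e₀, b, hab.symm.incident_left, ?_⟩
  have h0 : {h | G.origin h = b} = ∅ := eq_empty_of_forall_notMem fun h => hh h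
  have h1 : ∀ f, G.Incident (Sum.inl f) b → f = e₀ := fun f hfb => by
    by_contra hne'
    exact hf f hne' hfb
  rw [degree, h0, ncard_empty]
  rcases hab with ⟨hs, ht⟩ | ⟨hs, ht⟩
  · have h2 : {e | G.src e = b} = ∅ := eq_empty_of_forall_notMem fun f hfb => by
      have h3 : f = e₀ := h1 f (Or.inl hfb)
      subst h3
      exact hne (hfb.symm.trans hs)
    have h4 : {e | G.tgt e = b} = {e₀} := by
      ext f
      exact ⟨fun hfb => h1 f (Or.inr hfb), fun h => by rw [mem_singleton_iff.1 h]; exact ht⟩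
    rw [h2, h4, ncard_empty, ncard_singleton]
  · have h2 : {e | G.tgt e = b} = ∅ := eq_empty_of_forall_notMem fun f hfb => by
      have h3 : f = e₀ := h1 f (Or.inr hfb)
      subst h3
      exact hne (hfb.symm.trans ht)
    have h4 : {e | G.src e = b} = {e₀} := by
      ext f
      exact ⟨fun hfb => h1 f (Or.inl hfb), fun h => by rw [mem_singleton_iff.1 h]; exact hs⟩
    rw [h2, h4, ncard_empty, ncard_singleton]

/-! ### The calibration along a path -/

/-- The function `w`, with derivative `q`, is `u` on the edge `e`, parametrized from `a` to `b`. -/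
structure H1.Oriented (u : G.H1) (e : E) (a b : V) (w q : ℝ → ℝ) : Prop where
  sobolev : SobolevOn w q 0 (G.length e)
  left : w 0 = u.atVertex a
  right : w (G.length e) = u.atVertex b
  mass : ∫ x in 0..G.length e, w x ^ 2 = u.edgeMass e
  kinetic : ∫ x in 0..G.length e, q x ^ 2 = u.edgeKinetic e
  six : ∫ x in 0..G.length e, w x ^ 6 = u.edgeSix e
  surj : ∀ x ∈ Icc 0 (G.length e), ∃ y ∈ Icc 0 (G.length e), w y = u.onEdge e x
  range : ∀ y ∈ Icc 0 (G.length e), ∃ x ∈ Icc 0 (G.length e), w y = u.onEdge e x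

theorem H1.Oriented.reverse {u : G.H1} {e : E} {a b : V} {w q : ℝ → ℝ} (h : u.Oriented e a b w q) :
    u.Oriented e b a (fun x => w (G.length e - x)) (fun x => -q (G.length e - x)) where
  sobolev := by simpa using h.sobolev.reflect (G.length e)
  left := by simpa using h.right
  right := by simpa using h.left
  mass := by
    rw [← h.mass]
    simp [intervalIntegral.integral_comp_sub_left (fun x => w x ^ 2) (G.length e)]
  kinetic := by
    rw [← h.kinetic]
    simp [intervalIntegral.integral_comp_sub_left (fun x => q x ^ 2) (G.length e)]
  six := by
    rw [← h.six]
    simp [intervalIntegral.integral_comp_sub_left (fun x => w x ^ 6) (G.length e)]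
  surj x hx := by
    obtain ⟨y, hy, h1⟩ := h.surj x hx
    exact ⟨G.length e - y, ⟨by linarith [hy.2], by linarith [hy.1]⟩, by simpa using h1⟩
  range y hy := h.range _ ⟨by linarith [hy.2], by linarith [hy.1]⟩

theorem H1.exists_oriented (u : G.H1) {e : E} {a b : V} (h : G.Joins e a b) :
    ∃ w q, u.Oriented e a b w q := by
  have h1 : u.Oriented e (G.src e) (G.tgt e) (u.onEdge e) (u.onEdgeDeriv e) :=
    ⟨u.sobolevOn_edge e, u.edge_src e, u.edge_tgt e, rfl, rfl, rfl, fun x hx => ⟨x, hx, rfl⟩,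
      fun x hx => ⟨x, hx, rfl⟩⟩
  rcases h with ⟨rfl, rfl⟩ | ⟨rfl, rfl⟩
  · exact ⟨_, _, h1⟩
  · exact ⟨_, _, h1.reverse⟩

theorem sin_mul_ne_zero {k c d : ℝ} (hk : 0 < k) (hc : 0 < c) (hd : k * d < Real.pi) :
    ∀ y ∈ Icc c d, Real.sin (k * y) ≠ 0 := fun y hy =>
  (Real.sin_pos_of_pos_of_lt_pi (mul_pos hk (hc.trans_le hy.1))
    (lt_of_le_of_lt (by gcongr; exact hy.2) hd)).ne'

theorem H1.list_sum_edgeMass_nonneg (u : G.H1) (es : List E) : 0 ≤ (es.map u.edgeMass).sum :=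
  List.sum_nonneg fun x hx => by
    obtain ⟨e, -, rfl⟩ := List.mem_map.1 hx
    exact u.edgeMass_nonneg e

/-- The calibrations of successive edges telescope: `u` is continuous at the vertices and each edge
starts with the mass accumulated before it. -/
theorem H1.path_calibration (u : G.H1) {k : ℝ} (hk : 0 < k) {es : List E} {v w : V}
    (hp : G.IsPath v es w) {m : ℝ} (hm : 0 < m)
    (hkm : k * (m + (es.map u.edgeMass).sum) < Real.pi) :
    k * Real.cot (k * (m + (es.map u.edgeMass).sum)) * u.atVertex w ^ 4
        - k * Real.cot (k * m) * u.atVertex v ^ 4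
      ≤ 4 * (es.map u.edgeKinetic).sum - k ^ 2 * (es.map u.edgeSix).sum := by
  induction es generalizing v m with
  | nil =>
    obtain rfl : v = w := hp
    simp
  | cons e es ih =>
    obtain ⟨x, hx, hp⟩ := hp
    obtain ⟨f, q, ho⟩ := u.exists_oriented hx
    simp only [List.map_cons, List.sum_cons] at hkm ⊢
    have hm' : 0 < m + u.edgeMass e := by linarith [u.edgeMass_nonneg e]
    have hlist := u.list_sum_edgeMass_nonneg es
    have h1 := ih hp hm' (by rwa [add_assoc])
    have h2 := ho.sobolev.mass_calibration (c := m) (k := k) (by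
      rw [ho.mass]
      refine sin_mul_ne_zero hk hm (lt_of_le_of_lt ?_ hkm)
      gcongr
      linarith)
    rw [ho.mass, ho.kinetic, ho.six, ho.left, ho.right] at h2
    rw [add_assoc] at h1
    linarith

/-- The calibration along a half-line, a path of bounded edges and a part of a further edge. -/
theorem H1.half_path_calibration (u : G.H1) {k ε : ℝ} (hk : 0 < k) (hε : 0 < ε) {h : H}
    {es : List E} {a b : V} (hp : G.IsPath (G.origin h) es a) {e₀ : E} {w q : ℝ → ℝ}
    (ho : u.Oriented e₀ a b w q) {y : ℝ} (hy : y ∈ Icc 0 (G.length e₀))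
    (hkm : k * (ε + (u.halfMass h + (es.map u.edgeMass).sum + ∫ x in 0..y, w x ^ 2)) < Real.pi) :
    k * Real.cot (k * (ε + (u.halfMass h + (es.map u.edgeMass).sum + ∫ x in 0..y, w x ^ 2)))
        * w y ^ 4
      ≤ 4 * (u.halfKinetic h + (es.map u.edgeKinetic).sum + ∫ x in 0..y, q x ^ 2)
        - k ^ 2 * ((es.map u.edgeSix).sum + ∫ x in 0..y, w x ^ 6) := by
  have hlist := u.list_sum_edgeMass_nonneg es
  have hh := u.halfMass_nonneg h
  have hw0 : 0 ≤ ∫ x in 0..y, w x ^ 2 :=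
    intervalIntegral.integral_nonneg hy.1 fun _ _ => sq_nonneg _
  have h1 := halfLine_mass_calibration (u.sobolevOn_half h) (u.isH1On_half h).integrableOn_sq
    (u.isH1On_half h).integrableOn_deriv_sq hε hk (lt_of_le_of_lt (by
      gcongr
      change u.halfMass h ≤ _
      linarith) hkm) (le_refl (0 : ℝ))
  rw [u.half_origin, intervalIntegral.integral_same] at h1
  change k * Real.cot (k * (ε + u.halfMass h)) * _ ≤ 4 * u.halfKinetic h - _ at h1
  have h2 := u.path_calibration hk hp (m := ε + u.halfMass h) (by linarith) (lt_of_le_of_lt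
    (mul_le_mul_of_nonneg_left (by linarith) hk.le) hkm)
  have hS := ho.sobolev.mono le_rfl hy.1 hy.2
  have h3 := hS.mass_calibration (c := ε + u.halfMass h + (es.map u.edgeMass).sum) (k := k)
    (sin_mul_ne_zero hk (by linarith) (by
      refine lt_of_le_of_lt (le_of_eq ?_) hkm
      ring))
  rw [ho.left] at h3
  rw [show ε + (u.halfMass h + (es.map u.edgeMass).sum + ∫ x in 0..y, w x ^ 2)
    = ε + u.halfMass h + (es.map u.edgeMass).sum + ∫ x in 0..y, w x ^ 2 by ring]
  linarith

theorem list_sum_le_sum [Fintype E] {F : E → ℝ} (hF : ∀ e, 0 ≤ F e) {es : List E}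
    (hnd : es.Nodup) :
    (es.map F).sum ≤ ∑ e, F e := by
  classical
  rw [← List.sum_toFinset _ hnd]
  exact Finset.sum_le_univ_sum_of_nonneg hF

end MetricGraph

/-! ### Mass of an exit segment -/

namespace SobolevOn

variable {u g : ℝ → ℝ} {a b : ℝ}

/-- Young's inequality, -2uu' ≤ τu² + u'²/τ: a drop of `u²` costs mass or kinetic energy. The
parameter `τ` is optimized only at the end. -/
theorem sq_sub_sq_le (h : SobolevOn u g a b) {τ : ℝ} (hτ : 0 < τ) {x : ℝ} (hx : x ∈ Icc a b) :
    u a ^ 2 - u x ^ 2 ≤ τ * (∫ x in a..b, u x ^ 2) + (∫ x in a..b, g x ^ 2) / τ := by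
  have hm := h.mono le_rfl hx.1 hx.2
  have hr := h.mono hx.1 hx.2 le_rfl
  have hac := (hm.absolutelyContinuous.fun_mul hm.absolutelyContinuous).const_mul (-1)
  have key := hac.sub_le_integral hx.1 (f' := fun x => -1 * (2 * u x * g x))
    (r := fun x => τ * u x ^ 2 + g x ^ 2 / τ) ?_
    (((hm.intervalIntegrable_pow 2).const_mul _).add (hm.intervalIntegrable_sq.div_const _)) ?_
  · rw [intervalIntegral.integral_add ((hm.intervalIntegrable_pow 2).const_mul _)
      (hm.intervalIntegrable_sq.div_const _), intervalIntegral.integral_const_mul,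
      intervalIntegral.integral_div] at key
    have h1 := intervalIntegral.integral_add_adjacent_intervals (hm.intervalIntegrable_pow 2)
      (hr.intervalIntegrable_pow 2)
    have h2 := intervalIntegral.integral_add_adjacent_intervals hm.intervalIntegrable_sq
      hr.intervalIntegrable_sq
    have h3 : 0 ≤ ∫ t in x..b, u t ^ 2 :=
      intervalIntegral.integral_nonneg hx.2 fun _ _ => sq_nonneg _
    have h4 : 0 ≤ ∫ t in x..b, g t ^ 2 :=
      intervalIntegral.integral_nonneg hx.2 fun _ _ => sq_nonneg _
    have h5 : τ * ∫ t in a..x, u t ^ 2 ≤ τ * ∫ t in a..b, u t ^ 2 := by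
      gcongr; linarith
    have h6 : (∫ t in a..x, g t ^ 2) / τ ≤ (∫ t in a..b, g t ^ 2) / τ := by
      gcongr; linarith
    nlinarith [key]
  · filter_upwards [hm.ae_hasDerivAt] with t ht htI
    have hu := ht htI
    refine ((hu.mul hu).const_mul (-1)).congr_deriv ?_
    ring
  · intro t _
    have h1 : τ * u t ^ 2 + g t ^ 2 / τ - -1 * (2 * u t * g t) = (τ * u t + g t) ^ 2 / τ := by
      field_simp
      ring
    have h2 : 0 ≤ (τ * u t + g t) ^ 2 / τ := by positivity
    linarith

theorem mul_le_integral_sq (h : SobolevOn u g a b) {c : ℝ} (hc : ∀ x ∈ Icc a b, c ≤ u x ^ 2) :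
    c * (b - a) ≤ ∫ x in a..b, u x ^ 2 := by
  have h1 := intervalIntegral.integral_mono_on h.le (intervalIntegrable_const (c := c))
    (h.intervalIntegrable_pow 2) hc
  simpa [mul_comm] using h1

end SobolevOn

/-! ### Calibration from infinity to the maximum point -/

namespace MetricGraph

variable {V E H : Type*} {G : MetricGraph V E H}

theorem list_sum_map_mul_sub (c : ℝ) (F F' : E → ℝ) (es : List E) :
    (es.map fun e => c * F e - F' e).sum = c * (es.map F).sum - (es.map F').sum := by
  induction es with
  | nil => simp
  | cons e es ih =>
    simp only [List.map_cons, List.sum_cons, ih]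
    ring

/-- Choice of the orientation of an edge such that a given point of a loop is in the first half. -/
theorem H1.exists_oriented_of_mem (u : G.H1) {e : E} {a b : V} (hab : G.Joins e a b) {x₀ : ℝ}
    (hx₀ : x₀ ∈ Icc 0 (G.length e)) :
    ∃ w q, u.Oriented e a b w q ∧ ∃ y ∈ Icc 0 (G.length e), w y = u.onEdge e x₀ ∧
      (b = a → y ≤ G.length e / 2) := by
  obtain ⟨w, q, ho⟩ := u.exists_oriented hab
  obtain ⟨y, hy, hwy⟩ := ho.surj x₀ hx₀
  by_cases h : b = a ∧ G.length e / 2 < y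
  · obtain ⟨rfl, h⟩ := h
    exact ⟨_, _, ho.reverse, G.length e - y, ⟨by linarith [hy.2], by linarith [hy.1]⟩,
      by simpa using hwy, fun _ => by linarith⟩
  · refine ⟨w, q, ho, y, hy, hwy, fun hba => ?_⟩
    by_contra hcon
    exact h ⟨hba, not_le.1 hcon⟩

theorem exists_length_le [Finite E] (hG : G.Admissible) : ∃ l, 0 < l ∧ ∀ e, l ≤ G.length e := by
  have := hG.core_nonempty
  obtain ⟨e, he⟩ := Finite.exists_min G.length
  exact ⟨G.length e, G.length_pos e, he⟩

theorem H1.totalSix_le_length [Fintype E] (u : G.H1) {B : ℝ}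
    (hmax : ∀ e, ∀ x ∈ Icc 0 (G.length e), u.onEdge e x ^ 2 ≤ B) :
    u.totalSix ≤ B ^ 3 * ∑ e, G.length e := by
  rw [H1.totalSix, Finset.mul_sum]
  refine Finset.sum_le_sum fun e _ => ?_
  have h := u.sobolevOn_edge e
  have h1 := intervalIntegral.integral_mono_on h.le (h.intervalIntegrable_pow 6)
    (intervalIntegrable_const (c := B ^ 3)) fun x hx => by
      have h2 := hmax e x hx
      rw [show u.onEdge e x ^ 6 = (u.onEdge e x ^ 2) ^ 3 by ring]
      gcongr
  rw [intervalIntegral.integral_const, sub_zero, smul_eq_mul, mul_comm] at h1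
  exact h1

variable [Fintype E] [Fintype H]

/-- Leaving the maximum point along a segment: either the segment carries mass because `u` stays
large on it, or because `u` drops. -/
theorem exit_alternative {w q w' q' : ℝ → ℝ} {y ℓ l B R K : ℝ} (h : SobolevOn w q y ℓ)
    (h' : SobolevOn w' q' 0 l) (hglue : w ℓ = w' 0) (hy : w y ^ 2 = B)
    (hR : (∫ x in y..ℓ, w x ^ 2) + ∫ x in 0..l, w' x ^ 2 ≤ R)
    (hK : (∫ x in y..ℓ, q x ^ 2) + ∫ x in 0..l, q' x ^ 2 ≤ K) :
    B / 2 * ((ℓ - y) + l) ≤ R ∨ ∀ τ > 0, B / 2 ≤ τ * R + K / τ := by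
  have nn : 0 ≤ ∫ x in 0..l, w' x ^ 2 :=
    intervalIntegral.integral_nonneg h'.le fun _ _ => sq_nonneg _
  have nn' : 0 ≤ ∫ x in 0..l, q' x ^ 2 :=
    intervalIntegral.integral_nonneg h'.le fun _ _ => sq_nonneg _
  by_cases h1 : ∀ x ∈ Icc y ℓ, B / 2 ≤ w x ^ 2
  · by_cases h2 : ∀ x ∈ Icc 0 l, B / 2 ≤ w' x ^ 2
    · left
      have e1 := h.mul_le_integral_sq h1
      have e2 := h'.mul_le_integral_sq h2
      linarith
    · right
      push Not at h2
      obtain ⟨x, hx, hlt⟩ := h2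
      intro τ hτ
      have e1 := h.sq_sub_sq_le hτ (x := ℓ) ⟨h.le, le_rfl⟩
      have e2 := h'.sq_sub_sq_le hτ hx
      rw [hy, hglue] at e1
      have e3 := mul_le_mul_of_nonneg_left hR hτ.le
      have e4 := div_le_div_of_nonneg_right hK hτ.le
      rw [add_div] at e4
      linarith
  · right
    push Not at h1
    obtain ⟨x, hx, hlt⟩ := h1
    intro τ hτ
    have e1 := h.sq_sub_sq_le hτ hx
    rw [hy] at e1
    have e3 := mul_le_mul_of_nonneg_left hR hτ.le
    have e4 := div_le_div_of_nonneg_right hK hτ.le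
    have e5 : 0 ≤ τ * ∫ x in 0..l, w' x ^ 2 := by positivity
    have e6 : 0 ≤ (∫ x in 0..l, q' x ^ 2) / τ := by positivity
    rw [add_div] at e4
    linarith

/-- The estimate along a path from infinity to a maximum point of `u²` on the core; `m` is the mass
carried by the path. -/
theorem H1.exists_path_estimate (hG : G.Admissible) (u : G.H1) {B : ℝ} {e₀ : E} {x₀ : ℝ}
    (hx₀ : x₀ ∈ Icc 0 (G.length e₀)) (hB : u.onEdge e₀ x₀ ^ 2 = B)
    (hmax : ∀ e, ∀ x ∈ Icc 0 (G.length e), u.onEdge e x ^ 2 ≤ B)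
    {l : ℝ} (hl : 0 < l) (hlle : ∀ e, l ≤ G.length e) :
    ∃ m, 0 ≤ m ∧ m ≤ u.totalMass ∧
      (∀ k ε, 0 < k → 0 < ε → k * (ε + m) < Real.pi →
        k * Real.cot (k * (ε + m)) * B ^ 2
          ≤ 4 * u.totalKinetic - k ^ 2 * (u.totalSix - B ^ 2 * (u.totalMass - m))) ∧
      (¬ G.HasTerminalEdge → B * l / 4 ≤ u.totalMass - m ∨
        ∀ τ > 0, B / 2 ≤ τ * (u.totalMass - m) + u.totalKinetic / τ) := by
  classical
  have hB0 : 0 ≤ B := hB ▸ sq_nonneg _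
  obtain ⟨h⟩ := hG.noncompact
  obtain ⟨a, b, hab, es, hp, hnd, he₀, hes, hhb⟩ := exists_isPath_to_edge hG h e₀
  obtain ⟨w, q, ho, y, hy, hwy, hloop⟩ := u.exists_oriented_of_mem hab hx₀
  have hwB : ∀ x ∈ Icc 0 (G.length e₀), w x ^ 2 ≤ B := fun x hx => by
    obtain ⟨z, hz, h1⟩ := ho.range x hx
    rw [h1]
    exact hmax e₀ z hz
  have hSl := ho.sobolev.mono le_rfl hy.1 hy.2
  have hSr := ho.sobolev.mono hy.1 hy.2 le_rfl
  have am := intervalIntegral.integral_add_adjacent_intervals (hSl.intervalIntegrable_pow 2)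
    (hSr.intervalIntegrable_pow 2)
  have ak := intervalIntegral.integral_add_adjacent_intervals hSl.intervalIntegrable_sq
    hSr.intervalIntegrable_sq
  have as := intervalIntegral.integral_add_adjacent_intervals (hSl.intervalIntegrable_pow 6)
    (hSr.intervalIntegrable_pow 6)
  rw [ho.mass] at am
  rw [ho.kinetic] at ak
  rw [ho.six] at as
  have nl : 0 ≤ ∫ x in 0..y, w x ^ 2 :=
    intervalIntegral.integral_nonneg hy.1 fun _ _ => sq_nonneg _
  have nr : 0 ≤ ∫ x in y..G.length e₀, w x ^ 2 :=
    intervalIntegral.integral_nonneg hy.2 fun _ _ => sq_nonneg _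
  have nrq : 0 ≤ ∫ x in y..G.length e₀, q x ^ 2 :=
    intervalIntegral.integral_nonneg hy.2 fun _ _ => sq_nonneg _
  have nlq : 0 ≤ ∫ x in 0..y, q x ^ 2 :=
    intervalIntegral.integral_nonneg hy.1 fun _ _ => sq_nonneg _
  have hsixr : ∫ x in y..G.length e₀, w x ^ 6 ≤ B ^ 2 * ∫ x in y..G.length e₀, w x ^ 2 := by
    rw [← intervalIntegral.integral_const_mul]
    refine intervalIntegral.integral_mono_on hy.2 (hSr.intervalIntegrable_pow 6)
      ((hSr.intervalIntegrable_pow 2).const_mul _) fun x hx => ?_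
    have h1 := hwB x ⟨hy.1.trans hx.1, hx.2⟩
    rw [show w x ^ 6 = (w x ^ 2) ^ 2 * w x ^ 2 by ring]
    gcongr
  have hcons : (e₀ :: es).Nodup := List.nodup_cons.2 ⟨he₀, hnd⟩
  have hhm : u.halfMass h ≤ ∑ h, u.halfMass h :=
    Finset.single_le_sum (fun h _ => u.halfMass_nonneg h) (Finset.mem_univ h)
  have hhk : u.halfKinetic h ≤ ∑ h, u.halfKinetic h :=
    Finset.single_le_sum (fun h _ => u.halfKinetic_nonneg h) (Finset.mem_univ h)
  have hem := list_sum_le_sum u.edgeMass_nonneg hcons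
  have hek := list_sum_le_sum u.edgeKinetic_nonneg hcons
  -- Each edge has a nonnegative deficit `B² · mass - six`. Summed off the path, the deficits bound
  -- the sixth power there by `B²` times the mass there.
  have hed := list_sum_le_sum (F := fun e => B ^ 2 * u.edgeMass e - u.edgeSix e)
    (fun e => sub_nonneg.2 (u.edgeSix_le (hmax e))) hcons
  simp only [List.map_cons, List.sum_cons] at hem hek hed
  rw [list_sum_map_mul_sub, Finset.sum_sub_distrib, ← Finset.mul_sum] at hed
  have hlist := u.list_sum_edgeMass_nonneg es
  have hlistk : 0 ≤ (es.map u.edgeKinetic).sum := List.sum_nonneg fun x hx => by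
    obtain ⟨e, -, rfl⟩ := List.mem_map.1 hx
    exact u.edgeKinetic_nonneg e
  have hh0 := u.halfMass_nonneg h
  have hhk0 := u.halfKinetic_nonneg h
  refine ⟨u.halfMass h + (es.map u.edgeMass).sum + ∫ x in 0..y, w x ^ 2, by linarith, ?_, ?_, ?_⟩
  · rw [H1.totalMass]
    linarith
  · intro k ε hk hε hkm
    have h1 := u.half_path_calibration hk hε hp ho hy hkm
    rw [show w y ^ 4 = B ^ 2 by rw [← hB, hwy]; ring] at h1
    refine h1.trans ?_
    have h2 : 4 * (u.halfKinetic h + (es.map u.edgeKinetic).sum + ∫ x in 0..y, q x ^ 2)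
        ≤ 4 * u.totalKinetic := by
      rw [H1.totalKinetic]
      linarith
    have h3 : u.totalSix - B ^ 2 * (u.totalMass
        - (u.halfMass h + (es.map u.edgeMass).sum + ∫ x in 0..y, w x ^ 2))
        ≤ (es.map u.edgeSix).sum + ∫ x in 0..y, w x ^ 6 := by
      rw [H1.totalSix, H1.totalMass]
      have h4 := mul_le_mul_of_nonneg_left hhm (sq_nonneg B)
      have h5 : u.edgeMass e₀ = _ := am.symm
      have h6 : u.edgeSix e₀ = _ := as.symm
      rw [h5, h6] at hed
      linarith
    have h4 := mul_le_mul_of_nonneg_left h3 (sq_nonneg k)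
    linarith
  · intro hT
    have hyB : w y ^ 2 = B := by rw [hwy, hB]
    have hBl : 0 ≤ B * l := by positivity
    by_cases hba : b = a
    · have hhalf := hloop hba
      -- On a loop the orientation leaves at least half of the edge ahead of `y`; no further edge is
      -- needed, and the second segment has length zero.
      have hS0 : SobolevOn (fun _ => w (G.length e₀)) (fun _ => 0) 0 0 :=
        ⟨le_rfl, by simp, fun x _ => by simp⟩
      rcases exit_alternative (R := u.totalMass
          - (u.halfMass h + (es.map u.edgeMass).sum + ∫ x in 0..y, w x ^ 2))
          (K := u.totalKinetic) hSr hS0 rfl hyB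
          (by rw [intervalIntegral.integral_same, H1.totalMass]; linarith)
          (by rw [intervalIntegral.integral_same, H1.totalKinetic]; linarith) with h1 | h1
      · left
        have h2 : l / 2 ≤ G.length e₀ - y + 0 := by linarith [hlle e₀]
        have h3 := mul_le_mul_of_nonneg_left h2 (show 0 ≤ B / 2 by positivity)
        linarith
      · exact Or.inr h1
    -- Past the end `b ≠ a` one continues on another bounded edge or half-line. It is not on the
    -- path, which avoids `b`, so its mass belongs to the remainder.
    · obtain ⟨w', q', l', hS', hglue, hll', hR, hK⟩ : ∃ w' q' : ℝ → ℝ, ∃ l', SobolevOn w' q' 0 l' ∧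
          w (G.length e₀) = w' 0 ∧ l ≤ l' ∧
          (∫ x in y..G.length e₀, w x ^ 2) + ∫ x in 0..l', w' x ^ 2 ≤ u.totalMass
            - (u.halfMass h + (es.map u.edgeMass).sum + ∫ x in 0..y, w x ^ 2) ∧
          (∫ x in y..G.length e₀, q x ^ 2) + ∫ x in 0..l', q' x ^ 2 ≤ u.totalKinetic := by
        rcases exists_exit hT hab hba with ⟨f, hfe, hfb⟩ | ⟨h', hh'⟩
        · have hfes : f ∉ es := fun hf => hba (hes f hf hfb)
          have hcons' : (f :: e₀ :: es).Nodup := List.nodup_cons.2 ⟨fun hf => by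
            rcases List.mem_cons.1 hf with rfl | hf
            · exact hfe rfl
            · exact hfes hf, hcons⟩
          obtain ⟨c, hbc⟩ : ∃ c, G.Joins f b c := by
            rcases hfb with rfl | rfl
            · exact ⟨_, Or.inl ⟨rfl, rfl⟩⟩
            · exact ⟨_, Or.inr ⟨rfl, rfl⟩⟩
          obtain ⟨w', q', ho'⟩ := u.exists_oriented hbc
          have hem' := list_sum_le_sum u.edgeMass_nonneg hcons'
          have hek' := list_sum_le_sum u.edgeKinetic_nonneg hcons'
          simp only [List.map_cons, List.sum_cons] at hem' hek'
          refine ⟨w', q', G.length f, ho'.sobolev, by rw [ho.right, ho'.left], hlle f, ?_, ?_⟩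
          · rw [ho'.mass, H1.totalMass]
            linarith
          · rw [ho'.kinetic, H1.totalKinetic]
            linarith
        · have hne : h ≠ h' := fun hcon => hba (hhb (by rw [hcon, hh']))
          have h2m : u.halfMass h + u.halfMass h' ≤ ∑ h, u.halfMass h := by
            rw [← Finset.sum_pair hne]
            exact Finset.sum_le_univ_sum_of_nonneg u.halfMass_nonneg
          have h2k : u.halfKinetic h + u.halfKinetic h' ≤ ∑ h, u.halfKinetic h := by
            rw [← Finset.sum_pair hne]
            exact Finset.sum_le_univ_sum_of_nonneg u.halfKinetic_nonneg
          have h3 : ∫ x in 0..l, u.onHalf h' x ^ 2 ≤ u.halfMass h' :=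
            intervalIntegral_le_setIntegral_Ici (u.isH1On_half h').integrableOn_sq
              (fun _ => sq_nonneg _) hl.le
          have h4 : ∫ x in 0..l, u.onHalfDeriv h' x ^ 2 ≤ u.halfKinetic h' :=
            intervalIntegral_le_setIntegral_Ici (u.isH1On_half h').integrableOn_deriv_sq
              (fun _ => sq_nonneg _) hl.le
          refine ⟨u.onHalf h', u.onHalfDeriv h', l, u.sobolevOn_half h' l hl.le,
            by rw [ho.right, u.half_origin, hh'], le_rfl, ?_, ?_⟩
          · rw [H1.totalMass]
            linarith
          · rw [H1.totalKinetic]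
            linarith
      rcases exit_alternative hSr hS' hglue hyB hR hK with h1 | h1
      · left
        have h2 : l / 2 ≤ G.length e₀ - y + l' := by linarith [hy.2]
        have h3 := mul_le_mul_of_nonneg_left h2 (show 0 ≤ B / 2 by positivity)
        linarith
      · exact Or.inr h1

/-! ### The upper bounds for the graph -/

/-- With t = tan(y/2) ≥ y/2, the duplication formula gives tan y = 2t/(1 - t²) ≥ 2t(1 + t²). -/
theorem add_cube_le_tan {y : ℝ} (h0 : 0 ≤ y) (h1 : y < Real.pi / 2) :
    y + y ^ 3 / 4 ≤ Real.tan y := by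
  have hpi := Real.pi_pos
  have ht := Real.le_tan (x := y / 2) (by linarith) (by linarith)
  have hc : 0 < Real.cos y := Real.cos_pos_of_mem_Ioo ⟨by linarith, h1⟩
  have hch : 0 < Real.cos (y / 2) := Real.cos_pos_of_mem_Ioo ⟨by linarith, by linarith⟩
  set t := Real.tan (y / 2) with htdef
  have ht0 : 0 ≤ t := by linarith
  have h2 : Real.tan y = 2 * t / (1 - t ^ 2) := by
    rw [show y = 2 * (y / 2) by ring, Real.tan_two_mul]
  have h3 : 0 < 1 - t ^ 2 := by
    have : Real.cos y = (1 - t ^ 2) * Real.cos (y / 2) ^ 2 := by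
      rw [show y = 2 * (y / 2) by ring, Real.cos_two_mul, htdef, Real.tan_eq_sin_div_cos]
      have := Real.sin_sq_add_cos_sq (y / 2)
      rw [show 2 * (y / 2) / 2 = y / 2 by ring]
      field_simp
      linarith
    by_contra hcon
    nlinarith [sq_nonneg (Real.cos (y / 2))]
  have h4 : y + y ^ 3 / 4 ≤ 2 * t * (1 + t ^ 2) := by
    have : (y / 2) ^ 3 ≤ t ^ 3 := by gcongr
    nlinarith
  rw [h2, le_div_iff₀ h3]
  have h5 : (y + y ^ 3 / 4) * (1 - t ^ 2) ≤ 2 * t * (1 + t ^ 2) * (1 - t ^ 2) := by gcongr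
  nlinarith [pow_nonneg ht0 5]

/-- The Gagliardo–Nirenberg inequality on the graph, with a remainder which contains the mass `R`
off a path from infinity to the maximum point of `u²` on the core. -/
theorem H1.exists_totalSix_add_le (hG : G.Admissible) (u : G.H1) {B : ℝ} {e₀ : E} {x₀ : ℝ}
    (hx₀ : x₀ ∈ Icc 0 (G.length e₀)) (hB : u.onEdge e₀ x₀ ^ 2 = B)
    (hmax : ∀ e, ∀ x ∈ Icc 0 (G.length e), u.onEdge e x ^ 2 ≤ B)
    {l : ℝ} (hl : 0 < l) (hlle : ∀ e, l ≤ G.length e) (hM : 0 < u.totalMass) :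
    ∃ R, 0 ≤ R ∧
      (Real.pi / (2 * u.totalMass)) ^ 4 * R ^ 3 * B ^ 2 / 4
        + (Real.pi / (2 * u.totalMass)) ^ 2 * u.totalSix ≤ 4 * u.totalKinetic ∧
      B ^ 2 ≤ 27 * (u.totalMass * u.totalKinetic) ∧
      (¬ G.HasTerminalEdge → B * l / 4 ≤ R ∨ ∀ τ > 0, B / 2 ≤ τ * R + u.totalKinetic / τ) := by
  obtain ⟨m, hm0, hmM, hcal, hexit⟩ := u.exists_path_estimate hG hx₀ hB hmax hl hlle
  set M := u.totalMass with hMdef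
  set K := u.totalKinetic with hK
  set S := u.totalSix with hS
  have hpi := Real.pi_pos
  have hS0 : 0 ≤ S := Finset.sum_nonneg fun e _ => u.edgeSix_nonneg e
  have hBB := sq_nonneg B
  refine ⟨M - m, sub_nonneg.2 hmM, ?_, ?_, hexit⟩
  · have key : ∀ ε > 0, (Real.pi / (2 * (M + ε))) ^ 4 * (M - m) ^ 3 * B ^ 2 / 4
        + (Real.pi / (2 * (M + ε))) ^ 2 * S ≤ 4 * K := by
      intro ε hε
      set k := Real.pi / (2 * (M + ε)) with hk
      have hk0 : 0 < k := by positivity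
      have h1 : k * (ε + m) = Real.pi / 2 - k * (M - m) := by
        have : k * (M + ε) = Real.pi / 2 := by rw [hk]; field_simp
        linarith
      have hy0 : 0 ≤ k * (M - m) := mul_nonneg hk0.le (sub_nonneg.2 hmM)
      have hy1 : k * (M - m) < Real.pi / 2 := by
        have : 0 < k * (ε + m) := by positivity
        linarith
      have h2 := hcal k ε hk0 hε (by rw [h1]; linarith)
      rw [h1, Real.cot_eq_cos_div_sin, Real.cos_pi_div_two_sub, Real.sin_pi_div_two_sub,
        ← Real.tan_eq_sin_div_cos] at h2
      have h3 := add_cube_le_tan hy0 hy1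
      have h4 : k * (k * (M - m) + (k * (M - m)) ^ 3 / 4) * B ^ 2
          ≤ k * Real.tan (k * (M - m)) * B ^ 2 := by gcongr
      -- The last term cancels the sixth power lost off the path; the first is the gain.
      have h5 : k * (k * (M - m) + (k * (M - m)) ^ 3 / 4) * B ^ 2
          = k ^ 4 * (M - m) ^ 3 * B ^ 2 / 4 + k ^ 2 * (B ^ 2 * (M - m)) := by ring
      linarith
    have hc : ContinuousAt (fun ε : ℝ => (Real.pi / (2 * (M + ε))) ^ 4 * (M - m) ^ 3 * B ^ 2 / 4
        + (Real.pi / (2 * (M + ε))) ^ 2 * S) 0 := by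
      have h1 : ContinuousAt (fun ε : ℝ => Real.pi / (2 * (M + ε))) 0 :=
        continuousAt_const.div (by fun_prop) (by simp [hM.ne'])
      fun_prop
    have hlim := hc.tendsto.mono_left (nhdsWithin_le_nhds (s := Ioi 0))
    rw [add_zero] at hlim
    exact le_of_tendsto hlim (eventually_nhdsWithin_of_forall key)
  -- A smaller `k`, with `ε = M`, keeps the angle below π/4, where cot ≥ 1, and makes the loss off
  -- the path at most half of the boundary term. The result is B² ≤ 64MK/π, and 64/π < 27.
  · set k := Real.pi / (8 * M) with hk
    have hk0 : 0 < k := by positivity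
    have hkM : k * M = Real.pi / 8 := by rw [hk]; field_simp
    have h1 : k * (M + m) ≤ Real.pi / 4 := by
      have := mul_le_mul_of_nonneg_left hmM hk0.le
      linarith
    have h2 := hcal k M hk0 hM (by linarith)
    have h3 : 1 ≤ Real.cot (k * (M + m)) := by
      have := Real.cot_le_cot_of_le (x := k * (M + m)) (y := Real.pi / 4) (by positivity) h1
        (by linarith)
      rw [Real.cot_eq_cos_div_sin (Real.pi / 4), Real.cos_pi_div_four, Real.sin_pi_div_four,
        div_self (by positivity)] at this
      exact this
    have h4 : k * 1 * B ^ 2 ≤ k * Real.cot (k * (M + m)) * B ^ 2 := by gcongr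
    have h5 : k * (M - m) ≤ 1 / 2 := by
      have := mul_nonneg hk0.le hm0
      linarith [Real.pi_lt_four]
    have h6 : k * (B ^ 2 * (k * (M - m))) ≤ k * (B ^ 2 * (1 / 2)) := by gcongr
    have h7 : 0 ≤ k ^ 2 * S := by positivity
    have h8 : k * B ^ 2 ≤ 8 * K := by linarith
    rw [hk, div_mul_eq_mul_div, div_le_iff₀ (by positivity)] at h8
    have h9 := Real.pi_gt_three
    nlinarith

theorem H1.totalSix_le_halfLine (hG : G.Admissible) (u : G.H1) :
    u.totalSix ≤ 16 / Real.pi ^ 2 * (u.totalMass ^ 2 * u.totalKinetic) := by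
  obtain ⟨e₀, x₀, hx₀, hmax⟩ := u.exists_core_max hG
  obtain ⟨l, hl, hlle⟩ := exists_length_le hG
  have hpi := Real.pi_pos
  rcases u.totalMass_nonneg.eq_or_lt with hM | hM
  · have := u.totalSix_le hmax
    rw [← hM] at this ⊢
    simpa using this
  obtain ⟨R, hR, h1, -, -⟩ := u.exists_totalSix_add_le hG hx₀ rfl hmax hl hlle hM
  have h2 : 0 ≤ (Real.pi / (2 * u.totalMass)) ^ 4 * R ^ 3 * (u.onEdge e₀ x₀ ^ 2) ^ 2 / 4 := by
    positivity
  have h3 : (Real.pi / (2 * u.totalMass)) ^ 2 * u.totalSix ≤ 4 * u.totalKinetic := by linarith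
  rw [div_pow, div_mul_eq_mul_div, div_le_iff₀ (by positivity)] at h3
  rw [div_mul_eq_mul_div, le_div_iff₀ (by positivity)]
  linarith

/-- Without terminal edges the inequality holds with a constant below that of the half-line. -/
theorem exists_totalSix_le_of_not_hasTerminalEdge (hG : G.Admissible)
    (hT : ¬ G.HasTerminalEdge) :
    ∃ c, 0 ≤ c ∧ c < 16 / Real.pi ^ 2 ∧
      ∀ u : G.H1, u.totalSix ≤ c * (u.totalMass ^ 2 * u.totalKinetic) := by
  obtain ⟨l, hl, hlle⟩ := exists_length_le hG
  have hpi := Real.pi_pos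
  set L := ∑ e, G.length e with hL
  have hLpos : 0 < L := by
    obtain ⟨e⟩ := hG.core_nonempty
    exact Finset.sum_pos (fun e _ => G.length_pos e) ⟨e, Finset.mem_univ _⟩
  -- The fraction of the mass that lies off the path: `1/16` if `u²` drops to half its maximum on
  -- the exit segment, `l / (108 L)` if it stays large, with 108 = 4 · 27.
  set θ := min (1 / 16) (l / (108 * L)) with hθ
  have hθ0 : 0 < θ := lt_min (by norm_num) (by positivity)
  set d := (Real.pi / 2) ^ 4 * θ ^ 3 / 4 with hd
  have hd0 : 0 < d := by positivity
  -- Quotients up to 1 are already below 16/π² because π < 4. The remainder is needed only for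
  -- quotients above 1.
  refine ⟨max 1 ((4 - d) * 4 / Real.pi ^ 2), le_max_of_le_left zero_le_one, max_lt ?_ ?_, ?_⟩
  · rw [one_lt_div (by positivity)]
    nlinarith [Real.pi_lt_four]
  · gcongr
    linarith
  intro u
  have hMK : 0 ≤ u.totalMass ^ 2 * u.totalKinetic :=
    mul_nonneg (sq_nonneg _) u.totalKinetic_nonneg
  by_cases hsmall : u.totalSix ≤ u.totalMass ^ 2 * u.totalKinetic
  · refine hsmall.trans ?_
    calc u.totalMass ^ 2 * u.totalKinetic = 1 * (u.totalMass ^ 2 * u.totalKinetic) := by ring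
      _ ≤ _ := by gcongr; exact le_max_left _ _
  push Not at hsmall
  obtain ⟨e₀, x₀, hx₀, hmax⟩ := u.exists_core_max hG
  set B := u.onEdge e₀ x₀ ^ 2 with hB
  have hB0 : 0 ≤ B := sq_nonneg _
  have hSM := u.totalSix_le hmax
  have hSL := u.totalSix_le_length hmax
  rw [← hL] at hSL
  have hSpos : 0 < u.totalSix := hMK.trans_lt hsmall
  have hM : 0 < u.totalMass := by
    refine u.totalMass_nonneg.lt_of_ne fun h => ?_
    rw [← h, mul_zero] at hSM
    linarith
  have hBpos : 0 < B := by
    refine hB0.lt_of_ne fun h => ?_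
    rw [← h] at hSM
    simp at hSM
    linarith
  obtain ⟨R, hR, h1, h2, hexit⟩ := u.exists_totalSix_add_le hG hx₀ hB.symm hmax hl hlle hM
  set M := u.totalMass with hMdef
  set K := u.totalKinetic with hK
  have hKpos : 0 < K := by
    refine u.totalKinetic_nonneg.lt_of_ne fun h => ?_
    rw [← hK] at h
    rw [← h] at h2
    have := pow_pos hBpos 2
    linarith
  -- From M²K < S ≤ B²M, with `S` the sixth power.
  have hMKB : M * K < B ^ 2 := by
    have : M * (M * K) < M * B ^ 2 := by nlinarith
    exact lt_of_mul_lt_mul_left this hM.le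
  -- From B²M ≤ 27M²K < 27S ≤ 27B³L: a large quotient forces the maximum to be comparable with the
  -- mass.
  have hMB : M < 27 * (B * L) := by
    have h3 : B ^ 2 * M < B ^ 2 * (27 * (B * L)) := by nlinarith
    exact lt_of_mul_lt_mul_left h3 (sq_nonneg B)
  have hRM : θ * M ≤ R := by
    rcases hexit hT with h | h
    · calc θ * M ≤ l / (108 * L) * M := by gcongr; exact min_le_right _ _
        _ ≤ l / (108 * L) * (27 * (B * L)) := by gcongr
        _ = B * l / 4 := by field_simp; norm_num
        _ ≤ R := h
    -- This `τ` makes the kinetic term `B / 4`, half of the left side; the rest gives B² ≤ 16KR, and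
    -- then M ≤ 16R by MK < B².
    · have h3 := h (4 * K / B) (by positivity)
      have h4 : K / (4 * K / B) = B / 4 := by field_simp
      rw [h4] at h3
      have h5 : B ^ 2 ≤ 16 * (K * R) := by
        have h6 : B / 4 ≤ 4 * K / B * R := by linarith
        rw [div_mul_eq_mul_div, le_div_iff₀ hBpos] at h6
        linarith
      have h6 : K * M ≤ K * (16 * R) := by linarith
      have h7 := le_of_mul_le_mul_left h6 hKpos
      calc θ * M ≤ 1 / 16 * M := by gcongr; exact min_le_left _ _
        _ ≤ R := by linarith
  have h3 : d * K ≤ (Real.pi / (2 * M)) ^ 4 * R ^ 3 * B ^ 2 / 4 := by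
    calc d * K = (Real.pi / (2 * M)) ^ 4 * (θ * M) ^ 3 * (M * K) / 4 := by
          rw [hd]; field_simp
      _ ≤ (Real.pi / (2 * M)) ^ 4 * R ^ 3 * B ^ 2 / 4 := by gcongr
  have h4 : (Real.pi / (2 * M)) ^ 2 * u.totalSix ≤ (4 - d) * K := by linarith
  have h5 : u.totalSix ≤ (4 - d) * 4 / Real.pi ^ 2 * (M ^ 2 * K) := by
    rw [div_pow, div_mul_eq_mul_div, div_le_iff₀ (by positivity)] at h4
    rw [div_mul_eq_mul_div, le_div_iff₀ (by positivity)]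
    linarith
  exact h5.trans (by gcongr; exact le_max_right _ _)

end MetricGraph

theorem mainTheorem6 {V E H : Type*} [Fintype E] [Fintype H]
    (G : MetricGraph V E H) (hG : G.Admissible) :
    (G.HasTerminalEdge → G.coreConst = gnConstHalfLine) ∧
    (¬ G.HasTerminalEdge → G.coreConst < gnConstHalfLine) ∧
    (¬ G.HasTerminalEdge → G.HasCycleCovering → G.coreConst = gnConstLine) ∧
    (Fintype.card H = 1 → ¬ G.HasTerminalEdge → 1 < G.coreConst) := by
  have hpi := Real.pi_pos
  refine ⟨fun hT => ?_, fun hT => ?_, fun _ hC => ?_, fun hH _ =>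
    MetricGraph.one_lt_coreConst hG hH⟩
  · refine le_antisymm (le_trans ?_ le_gnConstHalfLine)
      (gnConstHalfLine_le.trans (MetricGraph.halfLine_le_coreConst hG hT))
    exact MetricGraph.coreConst_le (by positivity) fun u => u.totalSix_le_halfLine hG
  · obtain ⟨c, hc0, hc, h⟩ := MetricGraph.exists_totalSix_le_of_not_hasTerminalEdge hG hT
    refine lt_of_lt_of_le ?_ le_gnConstHalfLine
    refine (MetricGraph.coreConst_le hc0 h).trans_lt ?_
    exact (ENNReal.ofReal_lt_ofReal_iff (by positivity)).2 hc
  · obtain ⟨e₀⟩ := hG.core_nonempty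
    refine le_antisymm (le_trans ?_ le_gnConstLine)
      (gnConstLine_le.trans (MetricGraph.line_le_coreConst e₀))
    exact MetricGraph.coreConst_le (by positivity)
      fun u => u.totalSix_le_of_hasCycleCovering hG hC
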